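/- Let $f:\mathbb R\to\mathbb R$ be $C^2$ with $f>0$, $f'>0$, $f''\ge 0$, $\lim_{S\to\infty}f(S)=\infty$ and $\lim_{S\to-\infty}f(S)=0$. Let $k:(0,\infty)\to\mathbb R$ be $C^2$ with $k>0$, $k'<0$, $k''>0$, $$\int_1^\infty k^2(y)\,dy<\infty,\qquad \int_1^\infty k(y)\,dy=\infty,\qquad k(y)\to\infty\ \text{ and }\ \frac{k'(y)}{k(y)}\to-\infty\ \text{ as } y\to0+ .$$ Consider the gas with specific internal energy $$E(\tau,S)=f(S)\int_{\ln(\tau+1)}^{\infty}k^2(y)\,dy\qquad(\tau>0,\ S\in\mathbb R),$$ where $\tau=1/\rho$ is the specific volume and $S$ the specific entropy, and put $p=-E_\tau$, $T=E_S$, $\hat p(\rho,S)=p(1/\rho,S)$ for $\rho>0$, and $\hat p(0,S)=0$. The Euler equations are $$\rho_t+(\rho u)_x=0,\quad (\rho u)_t+(\rho u^2+p)_x=0,\quad \big(\tfrac12\rho u^2+\rho E\big)_t+\big(u(\tfrac12\rho u^2+\rho E+p)\big)_x=0 .$$ A solution of the Riemann problem with data $U_l=(\rho_l,u_l,S_l)$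 for $x<0$ and $U_r=(\rho_r,u_r,S_r)$ for $x>0$, where $\rho_l,\rho_r>0$, is a self-similar flow $(\rho,u,S)(x,t)=W(x/t)$, $t>0$, with $\rho\ge0$, which tends to $U_l$ as $x/t\to-\infty$ and to $U_r$ as $x/t\to+\infty$, such that, with the exception of finitely many rays $x/t=\xi$, it is near each ray either a $C^1$ solution of the Euler equations with $\rho>0$ or a vacuum ($\rho=0$), and such that at each exceptional ray - it has one-sided limits, each of which is either a state with $\rho>0$ or a vacuum (all three conserved densities and all three fluxes tend to $0$); - these limits satisfy the Rankine–Hugoniot conditions with speed $\xi$; and - if the limits differ and gas crosses the ray, the pressure is larger behind the discontinuity than ahead of it. On an exceptional ray the value of the flow is taken to be the limit from the right. (i) For all data $U_l,U_r$ with $\rho_l,\rho_r>0$ the Riemann problem has exactly one solution, defined for all $t>0$, and this solution contains no vacuum: its density is bounded below by a positive constant. (ii) The gas satisfies the following thermodynamic constraints, for all $\tau>0$ and $S\in\mathbb R$: $E\in C^2$; $dE=T\,dS-p\,d\tau$; $p>0$ and $T\ge0$; $E>0$ and $\lim_{\tau\to\infty}E(\tau,S)=0$; $E_{\tau\tau}=-p_\tau>0$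 and $E_{SS}=T_S\ge0$; $$\int_1^\infty p(\tau',S)\,d\tau'=\int_0^1\frac{\hat p(\rho,S)}{\rho^2}\,d\rho<\infty\quad\text{and}\quad E(\tau,S)=\int_\tau^\infty p(\tau',S)\,d\tau';$$ and $\hat p(\rho,S)$, $\hat p(\rho,S)/\rho$ and $\hat p_\rho(\rho,S)$ tend to $0$ as $\rho\to0+$. Moreover $p$ can be written as a function $p(\tau,E)$ of $\tau$ and $E$, and $\frac{\partial}{\partial\tau}p(\tau,E)\le\frac{p^2}{2E}$. (Nothing is claimed about the remaining constraints $E_{\tau\tau}E_{SS}\ge E_{\tau S}^2$ and $E_{\tau S}\le0$.) -/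

import Mathlib

open Filter Topology MeasureTheory Set

noncomputable section

namespace GasDynamics

/-! ### Equations of state `E = E(τ, S)` -/

/-- The pressure `p(τ, S) = -E_τ(τ, S)`. -/
def pressure (E : ℝ → ℝ → ℝ) (τ S : ℝ) : ℝ := -deriv (fun t => E t S) τ

/-- The temperature `T(τ, S) = E_S(τ, S)`. -/
def temperature (E : ℝ → ℝ → ℝ) (τ S : ℝ) : ℝ := deriv (fun s => E τ s) S

/-- The pressure as a function of density and entropy, `p̂(ρ, S) = p(1/ρ, S)` for `ρ > 0`;
the pressure of the vacuum `ρ = 0` is zero. -/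
def pHat (E : ℝ → ℝ → ℝ) (ρ S : ℝ) : ℝ := if 0 < ρ then pressure E (1 / ρ) S else 0

/-- The thermodynamic constraints on an energy `E(τ, S)`, `τ > 0`, `S ∈ ℝ`, without the two
conditions `E_ττ E_SS ≥ E_τS²` and `E_τS ≤ 0`. -/
structure ThermodynamicConstraints (E : ℝ → ℝ → ℝ) : Prop where
  /-- smoothness -/
  smooth : ContDiffOn ℝ 2 (fun q : ℝ × ℝ => E q.1 q.2) (Ioi 0 ×ˢ univ)
  /-- the Second Law `dE = T dS - p dτ` -/
  second_law : ∀ τ, 0 < τ → ∀ S, HasFDerivAt (fun q : ℝ × ℝ => E q.1 q.2)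
    (temperature E τ S • ContinuousLinearMap.snd ℝ ℝ ℝ
      - pressure E τ S • ContinuousLinearMap.fst ℝ ℝ ℝ) (τ, S)
  /-- the standard constraints `p > 0` and `T ≥ 0` -/
  pressure_pos : ∀ τ, 0 < τ → ∀ S, 0 < pressure E τ S
  temperature_nonneg : ∀ τ, 0 < τ → ∀ S, 0 ≤ temperature E τ S
  /-- stability of matter, normalized by `E_∞ = 0` -/
  energy_at_infinity : ∀ S, Tendsto (fun τ => E τ S) atTop (𝓝 0)
  energy_pos : ∀ τ, 0 < τ → ∀ S, 0 < E τ S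
  /-- thermodynamic stability `E_ττ = -p_τ > 0` and `E_SS = T_S ≥ 0` -/
  energy_tau_tau_pos : ∀ τ, 0 < τ → ∀ S, 0 < deriv (fun t => deriv (fun r => E r S) t) τ
  energy_S_S_nonneg : ∀ τ, 0 < τ → ∀ S, 0 ≤ deriv (fun s => deriv (fun r => E τ r) s) S
  /-- the energy condition -/
  pressure_integrable : ∀ S, IntegrableOn (fun τ => pressure E τ S) (Ioi 1)
  pressure_integral : ∀ S,
    ∫ τ in Ioi (1 : ℝ), pressure E τ S = ∫ ρ in Ioo (0 : ℝ) 1, pHat E ρ S / ρ ^ 2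
  energy_eq_integral : ∀ τ, 0 < τ → ∀ S, E τ S = ∫ t in Ioi τ, pressure E t S
  /-- the resulting behavior of the pressure near vacuum -/
  pHat_zero : ∀ S, Tendsto (fun ρ => pHat E ρ S) (𝓝[>] 0) (𝓝 0)
  pHat_div_zero : ∀ S, Tendsto (fun ρ => pHat E ρ S / ρ) (𝓝[>] 0) (𝓝 0)
  deriv_pHat_zero : ∀ S, Tendsto (fun ρ => deriv (fun r => pHat E r S) ρ) (𝓝[>] 0) (𝓝 0)

/-- Smith's medium condition: the pressure is a function `P(τ, e)` of specific volume and energy,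
and `∂P/∂τ ≤ p² / (2e)`. -/
def MediumCondition (E : ℝ → ℝ → ℝ) : Prop :=
  ∃ P : ℝ → ℝ → ℝ, (∀ τ, 0 < τ → ∀ S, P τ (E τ S) = pressure E τ S) ∧
    ∀ τ, 0 < τ → ∀ S, DifferentiableAt ℝ (fun t => P t (E τ S)) τ ∧
      deriv (fun t => P t (E τ S)) τ ≤ pressure E τ S ^ 2 / (2 * E τ S)

/-! ### The Euler equations -/

/-- A state of the gas: density, velocity, specific entropy. The state is a vacuum if `rho = 0`,
and then `u` and `S` carry no information. -/
@[ext]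
structure GasState where
  rho : ℝ
  u : ℝ
  S : ℝ

/-- The densities of mass, momentum and energy. They vanish at a vacuum. -/
def conserved (E : ℝ → ℝ → ℝ) (U : GasState) : Fin 3 → ℝ :=
  ![U.rho,
    U.rho * U.u,
    1 / 2 * U.rho * U.u ^ 2 + U.rho * E (1 / U.rho) U.S]

/-- The fluxes of mass, momentum and energy. They vanish at a vacuum. -/
def flux (E : ℝ → ℝ → ℝ) (U : GasState) : Fin 3 → ℝ :=
  ![U.rho * U.u,
    U.rho * U.u ^ 2 + pHat E U.rho U.S,
    U.u * (1 / 2 * U.rho * U.u ^ 2 + U.rho * E (1 / U.rho) U.S + pHat E U.rho U.S)]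

/-- The Euler equations for the flow `V(x, t)` at the point `(x, t)`. -/
def EulerAt (E : ℝ → ℝ → ℝ) (V : ℝ → ℝ → GasState) (x t : ℝ) : Prop :=
  ∀ i, deriv (fun s => conserved E (V x s) i) t + deriv (fun y => flux E (V y t) i) x = 0

/-- The Rankine-Hugoniot conditions for a discontinuity of speed `ξ`. -/
def RankineHugoniot (E : ℝ → ℝ → ℝ) (ξ : ℝ) (Ul Ur : GasState) : Prop :=
  ∀ i, ξ * (conserved E Ur i - conserved E Ul i) = flux E Ur i - flux E Ul i

/-- The entropy condition: the pressure is bigger behind a shock than ahead of it. If the gas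
crosses the discontinuity from left to right, the left state is ahead (backward shock); if it
crosses from right to left, the right state is ahead (forward shock). A discontinuity that no gas
crosses is a contact and is not restricted. -/
def EntropyAdmissible (E : ℝ → ℝ → ℝ) (ξ : ℝ) (Ul Ur : GasState) : Prop :=
  Ul ≠ Ur →
    (0 < Ul.rho * (Ul.u - ξ) → pHat E Ul.rho Ul.S < pHat E Ur.rho Ur.S) ∧
    (Ur.rho * (Ur.u - ξ) < 0 → pHat E Ur.rho Ur.S < pHat E Ul.rho Ul.S)

/-! ### The Riemann problem -/

/-- Componentwise convergence of states. -/
def StateTendsto (W : ℝ → GasState) (l : Filter ℝ) (U : GasState) : Prop :=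
  Tendsto (fun ξ => (W ξ).rho) l (𝓝 U.rho) ∧ Tendsto (fun ξ => (W ξ).u) l (𝓝 U.u) ∧
    Tendsto (fun ξ => (W ξ).S) l (𝓝 U.S)

/-- `U` is the limit of `W` along `l`: either a state of positive density, or a vacuum, at which
all conserved densities and all fluxes tend to zero. -/
def HasTrace (E : ℝ → ℝ → ℝ) (W : ℝ → GasState) (l : Filter ℝ) (U : GasState) : Prop :=
  (0 < U.rho ∧ StateTendsto W l U) ∨
    (U.rho = 0 ∧ Tendsto (fun ξ => conserved E (W ξ)) l (𝓝 0) ∧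
      Tendsto (fun ξ => flux E (W ξ)) l (𝓝 0))

/-- Near the ray `x / t = ξ` the flow `V(x, t) = W(x / t)` is a `C¹` solution of the Euler
equations with positive density. -/
def IsSmoothAt (E : ℝ → ℝ → ℝ) (W : ℝ → GasState) (ξ : ℝ) : Prop :=
  0 < (W ξ).rho ∧ ContDiffAt ℝ 1 (fun η => (W η).rho) ξ ∧ ContDiffAt ℝ 1 (fun η => (W η).u) ξ ∧
    ContDiffAt ℝ 1 (fun η => (W η).S) ξ ∧
    ∀ t, 0 < t → EulerAt E (fun x s => W (x / s)) (ξ * t) t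

/-- Across the ray `x / t = ξ` the flow has one-sided limits that satisfy the Rankine-Hugoniot
conditions and the entropy condition. (Equal limits are allowed, as at the edge of a
rarefaction.) The value on the ray itself is taken to be the limit from the right. -/
def IsAdmissibleJumpAt (E : ℝ → ℝ → ℝ) (W : ℝ → GasState) (ξ : ℝ) : Prop :=
  HasTrace E W (𝓝[>] ξ) (W ξ) ∧
    ∃ U, HasTrace E W (𝓝[<] ξ) U ∧ RankineHugoniot E ξ U (W ξ) ∧ EntropyAdmissible E ξ U (W ξ)

/-- The self-similar flow `V(x, t) = W(x / t)`, `t > 0`, is an admissible, piecewise smooth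
solution, possibly with vacuum regions, of the Riemann problem with left state `Ul` (for `x < 0`)
and right state `Ur` (for `x > 0`): apart from finitely many rays, it is near each ray either a
`C¹` solution or a vacuum, and across the exceptional rays it has admissible jumps. -/
structure IsRiemannSolution (E : ℝ → ℝ → ℝ) (Ul Ur : GasState) (W : ℝ → GasState) : Prop where
  rho_nonneg : ∀ ξ, 0 ≤ (W ξ).rho
  /-- `V(x, t) → Ul` as `t → 0+` for `x < 0` -/
  left_data : StateTendsto W atBot Ul
  /-- `V(x, t) → Ur` as `t → 0+` for `x > 0` -/
  right_data : StateTendsto W atTop Ur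
  piecewise_smooth : ∃ B : Finset ℝ,
    (∀ ξ, ξ ∉ B → IsSmoothAt E W ξ ∨ ∀ᶠ η in 𝓝 ξ, (W η).rho = 0) ∧
    (∀ ξ, ξ ∈ B → IsAdmissibleJumpAt E W ξ)

/-- The density of the flow is bounded away from zero. -/
def VacuumFree (W : ℝ → GasState) : Prop := ∃ δ > 0, ∀ ξ, δ ≤ (W ξ).rho

/-! ### The class of separable energies -/

/-- The assumptions on the factor `f(S)`. -/
structure IsEntropyFactor (f : ℝ → ℝ) : Prop where
  smooth : ContDiff ℝ 2 f
  pos : ∀ S, 0 < f S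
  deriv_pos : ∀ S, 0 < deriv f S
  deriv_deriv_nonneg : ∀ S, 0 ≤ deriv (deriv f) S
  tendsto_atTop : Tendsto f atTop atTop
  tendsto_atBot : Tendsto f atBot (𝓝 0)

/-- The assumptions on the function `k(y)`, `y > 0`; its values at `y ≤ 0` play no role. -/
structure IsVolumeKernel (k : ℝ → ℝ) : Prop where
  smooth : ContDiffOn ℝ 2 k (Ioi 0)
  pos : ∀ y, 0 < y → 0 < k y
  deriv_neg : ∀ y, 0 < y → deriv k y < 0
  deriv_deriv_pos : ∀ y, 0 < y → 0 < deriv (deriv k) y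
  /-- `∫₁^∞ k² < ∞` -/
  sq_integrable : IntegrableOn (fun y => k y ^ 2) (Ioi 1)
  /-- `∫₁^∞ k = ∞` -/
  integral_diverges : Tendsto (fun Y => ∫ y in (1 : ℝ)..Y, k y) atTop atTop
  tendsto_zero : Tendsto k (𝓝[>] 0) atTop
  log_deriv_tendsto_zero : Tendsto (fun y => deriv k y / k y) (𝓝[>] 0) atBot

/-- The energy `E(τ, S) = f(S) ∫_{ln(τ+1)}^∞ k²(y) dy`. -/
def separableEnergy (f k : ℝ → ℝ) (τ S : ℝ) : ℝ :=
  f S * ∫ y in Ioi (Real.log (τ + 1)), k y ^ 2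

end GasDynamics

end

noncomputable section

namespace GasDynamics

/-! ### The kernel `k` -/

namespace IsVolumeKernel

variable {k : ℝ → ℝ}

/-! Write E = f(S) K(τ) and p = f(S) P(τ), where K(τ) is the integral of k² over (ln(τ+1), ∞) and P
= -K' = k²(ln(τ+1))/(τ+1). What the Riemann problem needs of k is collected in `IsProfile`. P is
decreasing and strictly convex. The strict medium condition K P' < -P²/2 follows from `cube_le`. K/P
→ 0 at 0 follows from k'/k → -∞. The integral of √(-P') diverges at infinity because √(-P') dτ ≥ k
dy for y = ln(τ+1).

The medium condition makes the Hugoniot function strictly increasing in the volume, so each shock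
curve is parametrized by the pressure behind the shock. As a function of that pressure, the velocity
lost across a wave increases continuously from -∞ to ∞; the limit -∞ at zero pressure is where ∫ k =
∞ enters. The two outer waves must agree in pressure and velocity at the contact, so the middle
pressure exists (`exists_pressure`) and is unique (`strictMonoOn_velocityDrop`).

Uniqueness is claimed among all admissible self-similar flows, so the wave pattern has to be
derived. The mass flux m = ρ(u - ξ) does not jump and satisfies m' = -ρ where the flow is smooth;
hence it has exactly one zero, the contact. To the left of it m > 0, and on continuous pieces the
entropy is constant and each smooth point is stationary or sonic (`continuous_piece`). Lax's
inequalities (`lax`), a consequence of the convexity of P, forbid another backward wave beside a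
shock. So the left part is a single shock or rarefaction (`eq_waveFan`), and reflection gives the
right part.

Vacuum is impossible: the Rankine–Hugoniot conditions do not let a jump separate it from gas, so at
the leftmost vacuum point the gas would have to expand continuously. Then u - c would tend to +∞,
whereas ξ - (u - c) is nondecreasing (`not_tendsto_vacuum`). The thermodynamic claims are
computations with the product f K. -/

theorem contDiffAt (hk : IsVolumeKernel k) {y : ℝ} (hy : 0 < y) : ContDiffAt ℝ 2 k y :=
  hk.smooth.contDiffAt (Ioi_mem_nhds hy)

theorem hasDerivAt (hk : IsVolumeKernel k) {y : ℝ} (hy : 0 < y) : HasDerivAt k (deriv k y) y :=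
  ((hk.contDiffAt hy).differentiableAt (by norm_num)).hasDerivAt

theorem contDiffOn_deriv (hk : IsVolumeKernel k) : ContDiffOn ℝ 1 (deriv k) (Ioi 0) :=
  hk.smooth.deriv_of_isOpen isOpen_Ioi (by norm_num)

theorem hasDerivAt_deriv (hk : IsVolumeKernel k) {y : ℝ} (hy : 0 < y) :
    HasDerivAt (deriv k) (deriv (deriv k) y) y :=
  ((hk.contDiffOn_deriv.contDiffAt (Ioi_mem_nhds hy)).differentiableAt (by norm_num)).hasDerivAt

theorem strictAntiOn (hk : IsVolumeKernel k) : StrictAntiOn k (Ioi 0) :=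
  strictAntiOn_of_deriv_neg (convex_Ioi 0) hk.smooth.continuousOn
    (fun y hy => hk.deriv_neg y (by simpa using hy))

theorem strictMonoOn_deriv (hk : IsVolumeKernel k) : StrictMonoOn (deriv k) (Ioi 0) :=
  strictMonoOn_of_deriv_pos (convex_Ioi 0) hk.contDiffOn_deriv.continuousOn
    (fun y hy => hk.deriv_deriv_pos y (by simpa using hy))

theorem continuousOn_sq (hk : IsVolumeKernel k) : ContinuousOn (fun y => k y ^ 2) (Ioi 0) :=
  hk.smooth.continuousOn.pow 2

theorem integrableOn_sq (hk : IsVolumeKernel k) {y : ℝ} (hy : 0 < y) :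
    IntegrableOn (fun y => k y ^ 2) (Ioi y) := by
  have h1 : IntegrableOn (fun y => k y ^ 2) (Icc y 1) :=
    (hk.continuousOn_sq.mono fun x hx => lt_of_lt_of_le hy hx.1).integrableOn_Icc
  refine (h1.union hk.sq_integrable).mono_set fun x hx => ?_
  rcases le_or_gt x 1 with h | h
  · exact Or.inl ⟨le_of_lt hx, h⟩
  · exact Or.inr h

theorem intervalIntegrable_sq (hk : IsVolumeKernel k) {a b : ℝ} (ha : 0 < a) (hb : 0 < b) :
    IntervalIntegrable (fun y => k y ^ 2) volume a b :=
  (hk.continuousOn_sq.mono fun _ hx => lt_of_lt_of_le (lt_min ha hb) hx.1).intervalIntegrable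

theorem hasDerivAt_tail (hk : IsVolumeKernel k) {y : ℝ} (hy : 0 < y) :
    HasDerivAt (fun z => ∫ s in Ioi z, k s ^ 2) (-(k y ^ 2)) y := by
  have h : HasDerivAt (fun z => (∫ s in Ioi (1 : ℝ), k s ^ 2) - ∫ s in (1 : ℝ)..z, k s ^ 2)
      (-(k y ^ 2)) y := by
    refine HasDerivAt.const_sub _ (intervalIntegral.integral_hasDerivAt_right
      (hk.intervalIntegrable_sq one_pos hy) ?_ (hk.continuousOn_sq.continuousAt (Ioi_mem_nhds hy)))
    exact hk.continuousOn_sq.stronglyMeasurableAtFilter isOpen_Ioi y hy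
  refine h.congr_of_eventuallyEq ?_
  filter_upwards [Ioi_mem_nhds hy] with z hz
  rw [← intervalIntegral.integral_Ioi_sub_Ioi' hk.sq_integrable (hk.integrableOn_sq hz)]
  ring

theorem tail_tendsto (_hk : IsVolumeKernel k) :
    Tendsto (fun z => ∫ s in Ioi z, k s ^ 2) atTop (𝓝 0) :=
  tendsto_integral_Ioi_zero tendsto_id

theorem tail_pos (hk : IsVolumeKernel k) {y : ℝ} (hy : 0 < y) : 0 < ∫ s in Ioi y, k s ^ 2 := by
  have hanti : StrictAntiOn (fun z => ∫ s in Ioi z, k s ^ 2) (Ioi 0) := by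
    refine strictAntiOn_of_deriv_neg (convex_Ioi 0)
      (fun z hz => (hk.hasDerivAt_tail hz).continuousAt.continuousWithinAt) fun z hz => ?_
    rw [interior_Ioi] at hz
    rw [(hk.hasDerivAt_tail hz).deriv]
    have := hk.pos z hz
    simp only [Left.neg_neg_iff]
    positivity
  have h1 : 0 ≤ ∫ s in Ioi (y + 1), k s ^ 2 := integral_nonneg fun s => sq_nonneg _
  exact h1.trans_lt (hanti hy (show 0 < y + 1 by linarith) (by linarith))

/-- Since k² decreases, k(y)² is at most its integral over [y-1, y], a difference of two tails that
both tend to zero. -/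
theorem tendsto_atTop_zero (hk : IsVolumeKernel k) : Tendsto k atTop (𝓝 0) := by
  have hsq : Tendsto (fun y => k y ^ 2) atTop (𝓝 0) := by
    have h1 : Tendsto (fun y : ℝ => (∫ s in Ioi (y - 1), k s ^ 2) - ∫ s in Ioi y, k s ^ 2) atTop
        (𝓝 0) := by
      simpa [sub_eq_add_neg] using (hk.tail_tendsto.comp
        (tendsto_atTop_add_const_right atTop (-1 : ℝ) tendsto_id)).sub hk.tail_tendsto
    refine tendsto_of_tendsto_of_tendsto_of_le_of_le' tendsto_const_nhds h1
      (Eventually.of_forall fun y => sq_nonneg _) ?_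
    filter_upwards [eventually_gt_atTop 1] with y hy
    rw [intervalIntegral.integral_Ioi_sub_Ioi (hk.integrableOn_sq (by linarith)) (by linarith)]
    have : ∫ s in (y - 1)..y, k y ^ 2 ≤ ∫ s in (y - 1)..y, k s ^ 2 := by
      refine intervalIntegral.integral_mono_on (by linarith) intervalIntegrable_const
        (hk.intervalIntegrable_sq (by linarith) (by linarith)) fun s hs => ?_
      have h0 : 0 < s := by linarith [hs.1]
      have := hk.strictAntiOn.antitoneOn h0 (show (0 : ℝ) < y by linarith) hs.2
      exact pow_le_pow_left₀ (hk.pos y (by linarith)).le this 2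
    simpa using this
  have := hsq.sqrt
  simp only [Real.sqrt_zero] at this
  refine this.congr' ?_
  filter_upwards [eventually_gt_atTop 0] with y hy
  exact Real.sqrt_sq (hk.pos y hy).le

/-- By convexity k'(y) < 0 is at least the slope of the chord over [y-1, y], and that slope tends to
zero with k. -/
theorem deriv_tendsto_atTop_zero (hk : IsVolumeKernel k) : Tendsto (deriv k) atTop (𝓝 0) := by
  have h1 : Tendsto (fun y : ℝ => k y - k (y - 1)) atTop (𝓝 0) := by
    simpa [sub_eq_add_neg] using hk.tendsto_atTop_zero.sub
      (hk.tendsto_atTop_zero.comp (tendsto_atTop_add_const_right atTop (-1 : ℝ) tendsto_id))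
  refine tendsto_of_tendsto_of_tendsto_of_le_of_le' h1 tendsto_const_nhds ?_ ?_
  · filter_upwards [eventually_gt_atTop 1] with y hy
    obtain ⟨c, hc, hc'⟩ := exists_deriv_eq_slope k (show y - 1 < y by linarith)
      (hk.smooth.continuousOn.mono fun x hx => show (0 : ℝ) < x by linarith [hx.1])
      (fun x hx => (hk.hasDerivAt (show (0 : ℝ) < x by linarith [hx.1])).differentiableAt
        |>.differentiableWithinAt)
    have : deriv k c = k y - k (y - 1) := by rw [hc']; ring
    rw [← this]
    exact (hk.strictMonoOn_deriv (show (0 : ℝ) < c by linarith [hc.1])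
      (show (0 : ℝ) < y by linarith) hc.2).le
  · filter_upwards [eventually_gt_atTop 0] with y hy using (hk.deriv_neg y hy).le

/-- The inequality behind the medium condition. -/
theorem cube_le (hk : IsVolumeKernel k) {y : ℝ} (hy : 0 < y) :
    k y ^ 3 ≤ 3 * -deriv k y * ∫ s in Ioi y, k s ^ 2 := by
  -- The slope is frozen at y. Convexity makes the derivative 3k²(k'(z) - k'(y)) nonnegative for z ≥
  -- y, and g → 0 at infinity, so g(y) ≤ 0.
  set g : ℝ → ℝ := fun z => k z ^ 3 + 3 * deriv k y * ∫ s in Ioi z, k s ^ 2 with hg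
  have hd : ∀ z, 0 < z → HasDerivAt g (3 * k z ^ 2 * (deriv k z - deriv k y)) z := by
    intro z hz
    have := ((hk.hasDerivAt hz).pow 3).add ((hk.hasDerivAt_tail hz).const_mul (3 * deriv k y))
    refine this.congr_deriv ?_
    push_cast; ring
  have hmono : MonotoneOn g (Ici y) := by
    refine monotoneOn_of_deriv_nonneg (convex_Ici y)
      (fun z hz => (hd z (hy.trans_le hz)).continuousAt.continuousWithinAt)
      (fun z hz => (hd z (hy.trans_le (interior_subset hz))).differentiableAt.differentiableWithinAt)
      fun z hz => ?_
    have hz' := interior_subset hz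
    rw [(hd z (hy.trans_le hz')).deriv]
    have := hk.strictMonoOn_deriv.monotoneOn hy (hy.trans_le hz') hz'
    have := sub_nonneg.2 this
    positivity
  have hlim : Tendsto g atTop (𝓝 0) := by
    simpa using (hk.tendsto_atTop_zero.pow 3).add (hk.tail_tendsto.const_mul (3 * deriv k y))
  have : g y ≤ 0 := by
    refine ge_of_tendsto hlim ?_
    filter_upwards [eventually_ge_atTop y] with z hz using hmono self_mem_Ici hz hz
  simp only [hg] at this
  linarith

/-- Once -k' ≥ k/ε on (0, δ], the tail minus (ε/2)k² is increasing there. So the tail at y is at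
most (ε/2)k(y)² plus the fixed tail at δ, which is negligible against k(y)² → ∞. -/
theorem tail_div_sq_tendsto_zero (hk : IsVolumeKernel k) :
    Tendsto (fun y => (∫ s in Ioi y, k s ^ 2) / k y ^ 2) (𝓝[>] 0) (𝓝 0) := by
  rw [Metric.tendsto_nhds]
  intro ε hε
  obtain ⟨δ, hδ0, hδ⟩ : ∃ δ > 0, ∀ y ∈ Ioc (0 : ℝ) δ, deriv k y / k y ≤ -(1 / ε) := by
    obtain ⟨δ, hδ, h⟩ := mem_nhdsGT_iff_exists_Ioc_subset.1
      (hk.log_deriv_tendsto_zero.eventually_le_atBot (-(1 / ε)))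
    exact ⟨δ, hδ, fun y hy => h hy⟩
  set g : ℝ → ℝ := fun z => (∫ s in Ioi z, k s ^ 2) - ε / 2 * k z ^ 2 with hg
  have hd : ∀ z, 0 < z → HasDerivAt g (-(k z ^ 2) - ε * k z * deriv k z) z := by
    intro z hz
    have := (hk.hasDerivAt_tail hz).sub (((hk.hasDerivAt hz).pow 2).const_mul (ε / 2))
    refine this.congr_deriv ?_
    push_cast; ring
  have hmono : MonotoneOn g (Ioc 0 δ) := by
    refine monotoneOn_of_deriv_nonneg (convex_Ioc 0 δ)
      (fun z hz => (hd z hz.1).continuousAt.continuousWithinAt)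
      (fun z hz => (hd z (interior_subset hz).1).differentiableAt.differentiableWithinAt)
      fun z hz => ?_
    have hz' := interior_subset hz
    rw [(hd z hz'.1).deriv]
    have h1 := hδ z hz'
    have h2 := hk.pos z hz'.1
    rw [div_le_iff₀ h2] at h1
    have h3 : ε * deriv k z ≤ -k z := by
      have := mul_le_mul_of_nonneg_left h1 hε.le
      field_simp at this
      linarith
    nlinarith
  have hlarge : ∀ᶠ y in 𝓝[>] 0, (∫ s in Ioi δ, k s ^ 2) / k y ^ 2 < ε / 2 := by
    have h2 : Tendsto (fun y => k y ^ 2) (𝓝[>] 0) atTop :=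
      (tendsto_pow_atTop two_ne_zero).comp hk.tendsto_zero
    exact (h2.const_div_atTop (∫ s in Ioi δ, k s ^ 2)).eventually_lt_const (by linarith)
  filter_upwards [hlarge, Ioc_mem_nhdsGT hδ0] with y h1 hy
  have hky := hk.pos y hy.1
  have hkt := hk.tail_pos hy.1
  rw [Real.dist_eq, sub_zero, abs_of_pos (by positivity)]
  have h2 := hmono hy ⟨hδ0, le_rfl⟩ hy.2
  simp only [hg] at h2
  rw [div_lt_iff₀ (by positivity)] at h1 ⊢
  have : 0 ≤ ε / 2 * k δ ^ 2 := by positivity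
  nlinarith

end IsVolumeKernel

/-! ### Separable gases

For `E = f(S) K(τ)` and `p = f(S) P(τ)`, `P = -K'`, the properties of the functions of `τ` that
the solution of the Riemann problem depends on. -/

/-- `medium` makes the Hugoniot function monotone in the volume, and `ratio_tendsto` gives it a
negative limit at zero volume, so shocks of every strength exist. `integral_speed` makes
rarefactions gain unbounded velocity; together with `speed_bounded` it makes the characteristic
speed diverge, which excludes vacuum. -/
structure IsProfile (K P : ℝ → ℝ) : Prop where
  K_pos : ∀ τ, 0 < τ → 0 < K τ
  P_pos : ∀ τ, 0 < τ → 0 < P τ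
  hasDerivAt_K : ∀ τ, 0 < τ → HasDerivAt K (-P τ) τ
  smooth : ContDiffOn ℝ 2 P (Ioi 0)
  deriv_neg : ∀ τ, 0 < τ → deriv P τ < 0
  deriv_deriv_pos : ∀ τ, 0 < τ → 0 < deriv (deriv P) τ
  medium : ∀ τ, 0 < τ → K τ * deriv P τ < -(P τ ^ 2 / 2)
  ratio_tendsto : Tendsto (fun τ => K τ / P τ) (𝓝[>] 0) (𝓝 0)
  tendsto_atTop : Tendsto P atTop (𝓝 0)
  integral_speed : Tendsto (fun τ => ∫ t in (1 : ℝ)..τ, √(-deriv P t)) atTop atTop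
  speed_bounded : ∃ C, ∀ τ, 1 ≤ τ → τ * √(-deriv P τ) ≤ C

/-- The factor `K(τ)` of the energy. -/
def energyFactor (k : ℝ → ℝ) (τ : ℝ) : ℝ := ∫ y in Ioi (Real.log (τ + 1)), k y ^ 2

/-- The factor `P(τ)` of the pressure. -/
def pressureFactor (k : ℝ → ℝ) (τ : ℝ) : ℝ := k (Real.log (τ + 1)) ^ 2 / (τ + 1)

/-! ### The substitution y = ln(τ+1): from the kernel to the profile -/

theorem log_add_one_pos {τ : ℝ} (hτ : 0 < τ) : 0 < Real.log (τ + 1) :=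
  Real.log_pos (by linarith)

theorem hasDerivAt_log_add_one {τ : ℝ} (hτ : 0 < τ) :
    HasDerivAt (fun t => Real.log (t + 1)) (1 / (τ + 1)) τ := by
  simpa using ((hasDerivAt_id τ).add_const (1 : ℝ)).log (by simp; linarith)

theorem tendsto_log_add_one : Tendsto (fun t : ℝ => Real.log (t + 1)) atTop atTop :=
  Real.tendsto_log_atTop.comp (tendsto_atTop_add_const_right _ _ tendsto_id)

theorem tendsto_log_add_one_zero : Tendsto (fun t : ℝ => Real.log (t + 1)) (𝓝[>] 0) (𝓝[>] 0) := by
  refine tendsto_nhdsWithin_iff.2 ⟨?_, ?_⟩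
  · have : ContinuousAt (fun t : ℝ => Real.log (t + 1)) 0 := by
      refine ContinuousAt.log (by fun_prop) (by norm_num)
    simpa using this.tendsto.mono_left nhdsWithin_le_nhds
  · filter_upwards [self_mem_nhdsWithin] with t ht using log_add_one_pos ht

namespace IsVolumeKernel

variable {k : ℝ → ℝ}

theorem hasDerivAt_energyFactor (hk : IsVolumeKernel k) {τ : ℝ} (hτ : 0 < τ) :
    HasDerivAt (energyFactor k) (-pressureFactor k τ) τ := by
  have := (hk.hasDerivAt_tail (log_add_one_pos hτ)).comp τ (hasDerivAt_log_add_one hτ)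
  refine this.congr_deriv ?_
  simp only [pressureFactor]; ring

theorem hasDerivAt_pressureFactor (hk : IsVolumeKernel k) {τ : ℝ} (hτ : 0 < τ) :
    HasDerivAt (pressureFactor k)
      ((2 * k (Real.log (τ + 1)) * deriv k (Real.log (τ + 1)) - k (Real.log (τ + 1)) ^ 2)
        / (τ + 1) ^ 2) τ := by
  have h1 := ((hk.hasDerivAt (log_add_one_pos hτ)).comp τ (hasDerivAt_log_add_one hτ)).pow 2
  have h2 := h1.div ((hasDerivAt_id τ).add_const (1 : ℝ)) (by simp; linarith)
  refine h2.congr_deriv ?_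
  simp only [Function.comp, id, Pi.pow_apply]
  field_simp
  norm_num
  ring

theorem deriv_pressureFactor (hk : IsVolumeKernel k) {τ : ℝ} (hτ : 0 < τ) :
    deriv (pressureFactor k) τ =
      (2 * k (Real.log (τ + 1)) * deriv k (Real.log (τ + 1)) - k (Real.log (τ + 1)) ^ 2)
        / (τ + 1) ^ 2 := (hk.hasDerivAt_pressureFactor hτ).deriv

/-- The numerator is 2k'² + 2kk'' - 6kk' + 2k², in which no term is negative because k > 0, k' < 0
and k'' > 0. -/
theorem deriv_deriv_pressureFactor_pos (hk : IsVolumeKernel k) {τ : ℝ} (hτ : 0 < τ) :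
    0 < deriv (deriv (pressureFactor k)) τ := by
  set y := Real.log (τ + 1) with hy
  have hy0 : 0 < y := log_add_one_pos hτ
  have h1 := (hk.hasDerivAt hy0).comp τ (hasDerivAt_log_add_one hτ)
  have h2 := (hk.hasDerivAt_deriv hy0).comp τ (hasDerivAt_log_add_one hτ)
  have h3 := (((h1.const_mul 2).mul h2).sub (h1.pow 2)).div
    (((hasDerivAt_id τ).add_const (1 : ℝ)).pow 2) (by simp; positivity)
  have h4 : deriv (deriv (pressureFactor k)) τ = (2 * deriv k y ^ 2 + 2 * k y * deriv (deriv k) y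
      - 6 * k y * deriv k y + 2 * k y ^ 2) / (τ + 1) ^ 3 := by
    refine HasDerivAt.deriv ?_
    refine HasDerivAt.congr_of_eventuallyEq (f₁ := deriv (pressureFactor k)) (h3.congr_deriv ?_) ?_
    · simp only [Function.comp, id, Pi.pow_apply, ← hy]
      field_simp
      norm_num
      ring
    · filter_upwards [Ioi_mem_nhds hτ] with t ht
      rw [hk.deriv_pressureFactor ht]
      simp
  rw [h4]
  have := hk.pos y hy0
  have := hk.deriv_neg y hy0
  have := hk.deriv_deriv_pos y hy0
  have : 0 < k y * deriv (deriv k) y := by positivity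
  have : 0 < k y * -deriv k y := mul_pos (by assumption) (by linarith)
  refine div_pos ?_ (by positivity)
  nlinarith [sq_nonneg (deriv k y), sq_nonneg (k y)]

theorem neg_deriv_pressureFactor (hk : IsVolumeKernel k) {τ : ℝ} (hτ : 0 < τ) :
    -deriv (pressureFactor k) τ =
      (k (Real.log (τ + 1)) ^ 2 + 2 * k (Real.log (τ + 1)) * -deriv k (Real.log (τ + 1)))
        / (τ + 1) ^ 2 := by
  rw [hk.deriv_pressureFactor hτ]; ring

theorem contDiffOn_pressureFactor (hk : IsVolumeKernel k) :
    ContDiffOn ℝ 2 (pressureFactor k) (Ioi 0) := by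
  have h1 : ContDiffOn ℝ 2 (fun t : ℝ => Real.log (t + 1)) (Ioi 0) :=
    ContDiffOn.log (by fun_prop) fun t (ht : 0 < t) => by linarith
  exact ((hk.smooth.comp h1 fun t ht => log_add_one_pos ht).pow 2).div (by fun_prop)
    fun t (ht : 0 < t) => by linarith

/-- Up to the factor f(S) this is the ρ-derivative of the pressure at ρ = 1/τ. It is bounded by k² -
2kk' at ln(τ+1), which tends to zero. -/
theorem tendsto_sq_mul_deriv (hk : IsVolumeKernel k) :
    Tendsto (fun τ => τ ^ 2 * -deriv (pressureFactor k) τ) atTop (𝓝 0) := by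
  have h : Tendsto (fun y => k y ^ 2 + 2 * k y * -deriv k y) atTop (𝓝 0) := by
    simpa using (hk.tendsto_atTop_zero.pow 2).add
      ((hk.tendsto_atTop_zero.const_mul 2).mul hk.deriv_tendsto_atTop_zero.neg)
  refine tendsto_of_tendsto_of_tendsto_of_le_of_le' tendsto_const_nhds
    (h.comp tendsto_log_add_one) ?_ ?_ <;>
  · filter_upwards [eventually_gt_atTop 0] with τ hτ
    rw [hk.neg_deriv_pressureFactor hτ]
    have h1 := hk.pos _ (log_add_one_pos hτ)
    have h2 := neg_pos.2 (hk.deriv_neg _ (log_add_one_pos hτ))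
    have hA : 0 ≤ k (Real.log (τ + 1)) ^ 2 +
      2 * k (Real.log (τ + 1)) * -deriv k (Real.log (τ + 1)) := by positivity
    try simp only [Function.comp_def]
    generalize k (Real.log (τ + 1)) ^ 2 +
      2 * k (Real.log (τ + 1)) * -deriv k (Real.log (τ + 1)) = A at *
    first
    | positivity
    | rw [← mul_div_assoc, div_le_iff₀ (by positivity)]
      nlinarith

theorem isProfile (hk : IsVolumeKernel k) : IsProfile (energyFactor k) (pressureFactor k) where
  K_pos τ hτ := hk.tail_pos (log_add_one_pos hτ)
  P_pos τ hτ := by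
    have := hk.pos _ (log_add_one_pos hτ)
    unfold pressureFactor; positivity
  hasDerivAt_K τ hτ := hk.hasDerivAt_energyFactor hτ
  smooth := hk.contDiffOn_pressureFactor
  deriv_neg τ hτ := by
    have h1 := hk.pos _ (log_add_one_pos hτ)
    have h2 := neg_pos.2 (hk.deriv_neg _ (log_add_one_pos hτ))
    have : 0 < -deriv (pressureFactor k) τ := by
      rw [hk.neg_deriv_pressureFactor hτ]; positivity
    linarith
  deriv_deriv_pos τ hτ := hk.deriv_deriv_pressureFactor_pos hτ
  medium τ hτ := by
    have h0 := log_add_one_pos hτ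
    have h1 := hk.pos _ h0
    have h2 := neg_pos.2 (hk.deriv_neg _ h0)
    have h3 := hk.cube_le h0
    have h4 := hk.tail_pos h0
    have : pressureFactor k τ ^ 2 / 2 < energyFactor k τ * -deriv (pressureFactor k) τ := by
      rw [hk.neg_deriv_pressureFactor hτ]
      unfold pressureFactor energyFactor
      generalize k (Real.log (τ + 1)) = a at *
      generalize -deriv k (Real.log (τ + 1)) = b at *
      generalize (∫ s in Ioi (Real.log (τ + 1)), k s ^ 2) = c at *
      -- `cube_le` gives a⁴ ≤ 3abc, so 2abc ≥ (2/3)a⁴, which already exceeds a⁴/2.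
      have : a ^ 4 / 2 < c * (a ^ 2 + 2 * a * b) := by
        have := mul_le_mul_of_nonneg_left h3 h1.le
        have : 0 < c * a ^ 2 := by positivity
        have : 0 < a ^ 4 := by positivity
        nlinarith
      have h5 : 0 < (τ + 1) ^ 2 := by positivity
      calc (a ^ 2 / (τ + 1)) ^ 2 / 2 = a ^ 4 / 2 / (τ + 1) ^ 2 := by field_simp
        _ < c * (a ^ 2 + 2 * a * b) / (τ + 1) ^ 2 := by gcongr
        _ = _ := by ring
    linarith
  ratio_tendsto := by
    have h1 := hk.tail_div_sq_tendsto_zero.comp tendsto_log_add_one_zero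
    have h2 : Tendsto (fun τ : ℝ => τ + 1) (𝓝[>] 0) (𝓝 (0 + 1)) :=
      Tendsto.mono_left (Continuous.tendsto (by fun_prop) 0) nhdsWithin_le_nhds
    have h3 := h1.mul h2
    rw [zero_mul] at h3
    refine h3.congr fun τ => ?_
    simp only [Function.comp, energyFactor, pressureFactor]
    rw [div_div_eq_mul_div, div_mul_eq_mul_div]
  tendsto_atTop := by
    have := ((hk.tendsto_atTop_zero.comp tendsto_log_add_one).pow 2).div_atTop
      (tendsto_atTop_add_const_right _ (1 : ℝ) tendsto_id)
    exact this
  integral_speed := by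
    have hcont : ContinuousOn (fun t => √(-deriv (pressureFactor k) t)) (Ioi 0) :=
      ((hk.contDiffOn_pressureFactor.deriv_of_isOpen isOpen_Ioi
        (by norm_num : (1 : WithTop ℕ∞) + 1 ≤ 2)).continuousOn.neg).sqrt
    -- G compares the speed integral with ∫ k through dy = dτ/(τ+1). Dropping -2kk' from the
    -- numerator of -P' leaves (k/(τ+1))², so G increases and the divergence of ∫ k carries over.
    set G : ℝ → ℝ := fun τ => (∫ t in (1 : ℝ)..τ, √(-deriv (pressureFactor k) t))
      - ∫ y in (1 : ℝ)..Real.log (τ + 1), k y with hG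
    have hd : ∀ τ, 0 < τ → HasDerivAt G (√(-deriv (pressureFactor k) τ)
        - k (Real.log (τ + 1)) * (1 / (τ + 1))) τ := by
      intro τ hτ
      have hL := log_add_one_pos hτ
      refine HasDerivAt.sub ?_ ?_
      · exact intervalIntegral.integral_hasDerivAt_right
          (hcont.mono fun x hx => lt_of_lt_of_le (lt_min one_pos hτ) hx.1).intervalIntegrable
          (hcont.stronglyMeasurableAtFilter isOpen_Ioi τ hτ)
          (hcont.continuousAt (Ioi_mem_nhds hτ))
      · have hc := hk.smooth.continuousOn
        have := intervalIntegral.integral_hasDerivAt_right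
          (hc.mono fun x hx => lt_of_lt_of_le (lt_min one_pos hL) hx.1).intervalIntegrable
          (hc.stronglyMeasurableAtFilter isOpen_Ioi _ hL)
          (hc.continuousAt (Ioi_mem_nhds hL))
        exact this.comp τ (hasDerivAt_log_add_one hτ)
    have hmono : MonotoneOn G (Ioi 0) := by
      refine monotoneOn_of_deriv_nonneg (convex_Ioi 0)
        (fun z hz => (hd z hz).continuousAt.continuousWithinAt)
        (fun z hz => (hd z (interior_subset hz)).differentiableAt.differentiableWithinAt)
        fun τ hτ => ?_
      have hτ : 0 < τ := interior_subset hτ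
      rw [(hd τ hτ).deriv, sub_nonneg]
      have h1 := hk.pos _ (log_add_one_pos hτ)
      have h2 := neg_pos.2 (hk.deriv_neg _ (log_add_one_pos hτ))
      apply Real.le_sqrt_of_sq_le
      rw [hk.neg_deriv_pressureFactor hτ, mul_pow, one_div, inv_pow, ← div_eq_mul_inv]
      gcongr
      have : 0 ≤ 2 * k (Real.log (τ + 1)) * -deriv k (Real.log (τ + 1)) := by positivity
      linarith
    have h1 := tendsto_atTop_add_const_right _ (G 1)
      (hk.integral_diverges.comp tendsto_log_add_one)
    refine tendsto_atTop_mono' _ ?_ h1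
    filter_upwards [eventually_ge_atTop 1] with τ hτ
    have := hmono (show (0 : ℝ) < 1 by norm_num) (show (0 : ℝ) < τ by linarith) hτ
    simp only [hG, Function.comp] at this ⊢
    linarith
  speed_bounded := by
    -- τ²(-P') is at most k² - 2kk' at ln(τ+1), which decreases in τ; the bound is its value at τ =
    -- 1.
    refine ⟨√(k (Real.log 2) ^ 2 + 2 * k (Real.log 2) * -deriv k (Real.log 2)), fun τ hτ => ?_⟩
    have hτ0 : 0 < τ := by linarith
    have h2 : 0 < Real.log 2 := Real.log_pos (by norm_num)
    have hl : Real.log 2 ≤ Real.log (τ + 1) := Real.log_le_log (by norm_num) (by linarith)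
    have h3 := log_add_one_pos hτ0
    have hk1 := hk.strictAntiOn.antitoneOn h2 h3 hl
    have hk2 := hk.strictMonoOn_deriv.monotoneOn h2 h3 hl
    have hp := hk.pos _ h3
    have hn := neg_pos.2 (hk.deriv_neg _ h3)
    apply Real.le_sqrt_of_sq_le
    have hpos : 0 ≤ -deriv (pressureFactor k) τ := by
      rw [hk.neg_deriv_pressureFactor hτ0]; positivity
    rw [mul_pow, Real.sq_sqrt hpos, hk.neg_deriv_pressureFactor hτ0, ← mul_div_assoc,
      div_le_iff₀ (by positivity)]
    have hp2 := hk.pos _ h2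
    have hA : k (Real.log (τ + 1)) ^ 2 + 2 * k (Real.log (τ + 1)) * -deriv k (Real.log (τ + 1))
        ≤ k (Real.log 2) ^ 2 + 2 * k (Real.log 2) * -deriv k (Real.log 2) := by
      gcongr
    rw [mul_comm]
    have : τ ^ 2 ≤ (τ + 1) ^ 2 := by nlinarith
    exact mul_le_mul hA this (by positivity) (le_trans (by positivity) hA)

end IsVolumeKernel

/-- The roots of a family of strictly increasing functions depend continuously on the parameter. -/
theorem continuousOn_root {h : ℝ → ℝ → ℝ} {A I : Set ℝ} {T : ℝ → ℝ} (hI : IsOpen I)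
    (hmono : ∀ p ∈ A, StrictMonoOn (fun τ => h τ p) I) (hT : ∀ p ∈ A, T p ∈ I)
    (hroot : ∀ p ∈ A, h (T p) p = 0) (hc : ∀ τ ∈ I, ContinuousOn (h τ) A) : ContinuousOn T A := by
  intro p hp
  obtain ⟨ε, hε, hball⟩ := Metric.isOpen_iff.1 hI _ (hT p hp)
  have hmem : ∀ x, |x - T p| < ε → x ∈ I := fun x hx => hball (by simpa [Real.dist_eq] using hx)
  refine tendsto_order.2 ⟨fun a ha => ?_, fun b hb => ?_⟩
  · set c := max a (T p - ε / 2) with hcdef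
    have hc1 : c < T p := max_lt ha (by linarith)
    have hcI : c ∈ I := hmem _ (by
      rw [abs_lt]; constructor <;> linarith [le_max_right a (T p - ε / 2)])
    have h1 : h c p < 0 := by
      have := hmono p hp hcI (hT p hp) hc1
      simp only [hroot p hp] at this; exact this
    filter_upwards [(hc c hcI p hp).eventually_lt_const h1, self_mem_nhdsWithin] with x hx hxA
    refine (le_max_left a (T p - ε / 2)).trans_lt (lt_of_not_ge fun hle => ?_)
    have := (hmono x hxA).monotoneOn (hT x hxA) hcI hle
    simp only [hroot x hxA] at this
    linarith
  · set c := min b (T p + ε / 2) with hcdef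
    have hc1 : T p < c := lt_min hb (by linarith)
    have hcI : c ∈ I := hmem _ (by
      rw [abs_lt]; constructor <;> linarith [min_le_right b (T p + ε / 2)])
    have h1 : 0 < h c p := by
      have := hmono p hp (hT p hp) hcI hc1
      simp only [hroot p hp] at this; exact this
    filter_upwards [(hc c hcI p hp).eventually_const_lt h1, self_mem_nhdsWithin] with x hx hxA
    refine lt_of_lt_of_le (lt_of_not_ge fun hle => ?_) (min_le_left b (T p + ε / 2))
    have := (hmono x hxA).monotoneOn hcI (hT x hxA) hle
    simp only [hroot x hxA] at this
    linarith

/-! ### Sound speed, Hugoniot function and wave curve: definitions -/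

/-- The factor `q = √(-P')` of the Lagrangian sound speed. -/
def speed (P : ℝ → ℝ) (τ : ℝ) : ℝ := √(-deriv P τ)

/-- The integral of the Lagrangian sound speed, which gives the velocity in a simple wave. -/
def speedIntegral (P : ℝ → ℝ) (τ : ℝ) : ℝ := ∫ t in (1 : ℝ)..τ, speed P t

/-- The characteristic speed in a simple wave, as a function of the specific volume. -/
def charSpeed (P : ℝ → ℝ) (τ : ℝ) : ℝ := speedIntegral P τ - τ * speed P τ

/-- The Hugoniot function for the state `(τ₀, p₀)` ahead of a shock. -/
def hugoniot (K P : ℝ → ℝ) (τ₀ p₀ τ p : ℝ) : ℝ :=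
  p * (K τ / P τ) - p₀ * (K τ₀ / P τ₀) - (p + p₀) / 2 * (τ₀ - τ)

/-- The specific volume behind a shock of pressure `p`. -/
def shockVolume (K P : ℝ → ℝ) (τ₀ p₀ p : ℝ) : ℝ :=
  Classical.epsilon fun τ => 0 < τ ∧ hugoniot K P τ₀ p₀ τ p = 0

/-- The specific volume behind a rarefaction of pressure `p`. -/
def rarefactionVolume (P : ℝ → ℝ) (φ₀ p : ℝ) : ℝ :=
  Classical.epsilon fun τ => 0 < τ ∧ φ₀ * P τ = p

/-- The velocity lost across a wave that takes the gas from `(τ₀, p₀)`, `p₀ = φ₀ P(τ₀)`, to the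
pressure `p`. -/
def velocityDrop (K P : ℝ → ℝ) (τ₀ φ₀ p : ℝ) : ℝ :=
  √((max p (φ₀ * P τ₀) - φ₀ * P τ₀) *
      (τ₀ - shockVolume K P τ₀ (φ₀ * P τ₀) (max p (φ₀ * P τ₀))))
    - √φ₀ * (speedIntegral P (rarefactionVolume P φ₀ (min p (φ₀ * P τ₀))) - speedIntegral P τ₀)

/-! ### Convexity of the isentropes and Lax's condition -/

namespace IsProfile

variable {K P : ℝ → ℝ}

theorem hasDerivAt_P (h : IsProfile K P) {τ : ℝ} (hτ : 0 < τ) : HasDerivAt P (deriv P τ) τ :=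
  ((h.smooth.contDiffAt (Ioi_mem_nhds hτ)).differentiableAt (by norm_num)).hasDerivAt

theorem contDiffOn_deriv (h : IsProfile K P) : ContDiffOn ℝ 1 (deriv P) (Ioi 0) :=
  h.smooth.deriv_of_isOpen isOpen_Ioi (by norm_num)

theorem hasDerivAt_deriv (h : IsProfile K P) {τ : ℝ} (hτ : 0 < τ) :
    HasDerivAt (deriv P) (deriv (deriv P) τ) τ :=
  ((h.contDiffOn_deriv.contDiffAt (Ioi_mem_nhds hτ)).differentiableAt (by norm_num)).hasDerivAt

theorem strictAntiOn (h : IsProfile K P) : StrictAntiOn P (Ioi 0) :=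
  strictAntiOn_of_deriv_neg (convex_Ioi 0) h.smooth.continuousOn
    (fun y hy => h.deriv_neg y (by simpa using hy))

theorem strictMonoOn_deriv (h : IsProfile K P) : StrictMonoOn (deriv P) (Ioi 0) :=
  strictMonoOn_of_deriv_pos (convex_Ioi 0) h.contDiffOn_deriv.continuousOn
    (fun y hy => h.deriv_deriv_pos y (by simpa using hy))

theorem tangent_lt (h : IsProfile K P) {s t : ℝ} (hs : 0 < s) (ht : 0 < t) (hst : s ≠ t) :
    P t + deriv P t * (s - t) < P s := by
  rcases lt_or_gt_of_ne hst with hlt | hlt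
  · obtain ⟨c, hc, hc'⟩ := exists_deriv_eq_slope P hlt
      (h.smooth.continuousOn.mono fun x hx => hs.trans_le hx.1)
      (fun x hx => (h.hasDerivAt_P (hs.trans hx.1)).differentiableAt.differentiableWithinAt)
    have := h.strictMonoOn_deriv (hs.trans hc.1) ht hc.2
    rw [hc', div_lt_iff₀ (by linarith)] at this
    linarith
  · obtain ⟨c, hc, hc'⟩ := exists_deriv_eq_slope P hlt
      (h.smooth.continuousOn.mono fun x hx => ht.trans_le hx.1)
      (fun x hx => (h.hasDerivAt_P (ht.trans hx.1)).differentiableAt.differentiableWithinAt)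
    have := h.strictMonoOn_deriv ht (ht.trans hc.1) hc.1
    rw [hc', lt_div_iff₀ (by linarith)] at this
    linarith

/-- P lies above its tangent at τ; this is that inequality integrated over [τ, τ₀]. -/
theorem tangent_area_lt (h : IsProfile K P) {τ τ₀ : ℝ} (hτ : 0 < τ) (hlt : τ < τ₀) :
    P τ * (τ₀ - τ) + deriv P τ / 2 * (τ₀ - τ) ^ 2 < K τ - K τ₀ := by
  set g : ℝ → ℝ := fun t => -K t - P τ * (t - τ) - deriv P τ / 2 * (t - τ) ^ 2 with hg
  have hd : ∀ t, 0 < t → HasDerivAt g (P t - P τ - deriv P τ * (t - τ)) t := by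
    intro t ht
    have h1 := (hasDerivAt_id t).sub_const τ
    have := ((h.hasDerivAt_K t ht).neg.sub (h1.const_mul (P τ))).sub
      ((h1.pow 2).const_mul (deriv P τ / 2))
    refine this.congr_deriv ?_
    simp; ring
  have hmono : StrictMonoOn g (Icc τ τ₀) := by
    refine strictMonoOn_of_deriv_pos (convex_Icc _ _)
      (fun t ht => (hd t (hτ.trans_le ht.1)).continuousAt.continuousWithinAt) fun t ht => ?_
    rw [interior_Icc] at ht
    rw [(hd t (hτ.trans ht.1)).deriv]
    linarith [h.tangent_lt (hτ.trans ht.1) hτ ht.1.ne']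
  have := hmono (left_mem_Icc.2 hlt.le) (right_mem_Icc.2 hlt.le) hlt
  simp only [hg] at this
  linarith

/-- P lies below its chord. With the right endpoint t as variable, the derivative of g is half the
gap at τ between P and its tangent at t. -/
theorem lt_trapezoid (h : IsProfile K P) {τ τ₀ : ℝ} (hτ : 0 < τ) (hlt : τ < τ₀) :
    K τ - K τ₀ < (P τ + P τ₀) / 2 * (τ₀ - τ) := by
  set g : ℝ → ℝ := fun t => (P τ + P t) / 2 * (t - τ) + K t with hg
  have hd : ∀ t, 0 < t → HasDerivAt g ((P τ - P t + deriv P t * (t - τ)) / 2) t := by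
    intro t ht
    have h1 := (hasDerivAt_id t).sub_const τ
    have := ((((h.hasDerivAt_P ht).const_add (P τ)).div_const 2).mul h1).add (h.hasDerivAt_K t ht)
    refine this.congr_deriv ?_
    simp; ring
  have hmono : StrictMonoOn g (Icc τ τ₀) := by
    refine strictMonoOn_of_deriv_pos (convex_Icc _ _)
      (fun t ht => (hd t (hτ.trans_le ht.1)).continuousAt.continuousWithinAt) fun t ht => ?_
    rw [interior_Icc] at ht
    rw [(hd t (hτ.trans ht.1)).deriv]
    linarith [h.tangent_lt hτ (hτ.trans ht.1) ht.1.ne]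
  have := hmono (left_mem_Icc.2 hlt.le) (right_mem_Icc.2 hlt.le) hlt
  simp only [hg] at this
  linarith

/-- Lax's condition: a shock is supersonic with respect to the state ahead of it, and subsonic with
respect to the state behind it. -/
theorem lax (h : IsProfile K P) {τ τ₀ φ φ₀ : ℝ} (hτ : 0 < τ) (hlt : τ < τ₀) (hφ : 0 < φ)
    (hφ₀ : 0 < φ₀)
    (hug : φ * K τ - φ₀ * K τ₀ = (φ * P τ + φ₀ * P τ₀) / 2 * (τ₀ - τ)) :
    φ₀ * -deriv P τ₀ * (τ₀ - τ) < φ * P τ - φ₀ * P τ₀ ∧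
      φ * P τ - φ₀ * P τ₀ < φ * -deriv P τ * (τ₀ - τ) := by
  have hτ₀ := hτ.trans hlt
  have htr := h.lt_trapezoid hτ hlt
  have hP₀ := h.P_pos τ₀ hτ₀
  have hP := h.P_pos τ hτ
  have hK₀ := h.K_pos τ₀ hτ₀
  have hv : 0 < τ₀ - τ := by linarith
  -- The entropy rises across the shock: the Hugoniot relation reads φ D = φ₀ D₀ with D = K τ - P τ
  -- (τ₀ - τ)/2 and D₀ = K τ₀ + P τ₀ (τ₀ - τ)/2, and D < D₀ is the trapezoid inequality.
  have hφle : φ₀ < φ := by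
    by_contra hcon
    have hD : 0 < K τ - P τ / 2 * (τ₀ - τ) := by
      have : 0 < φ * (K τ - P τ / 2 * (τ₀ - τ)) := by
        have : φ * (K τ - P τ / 2 * (τ₀ - τ)) = φ₀ * (K τ₀ + P τ₀ / 2 * (τ₀ - τ)) := by
          linear_combination hug
        rw [this]; positivity
      exact pos_of_mul_pos_right this hφ.le
    nlinarith
  constructor
  · have := h.tangent_lt hτ hτ₀ hlt.ne
    nlinarith
  -- Otherwise the trapezoid in the Hugoniot relation is at most φ times the area under the tangent
  -- at τ, hence less than φ(K τ - K τ₀), which is below φ K τ - φ₀ K τ₀ because φ₀ < φ.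
  · by_contra hcon
    push Not at hcon
    have h1 := h.tangent_area_lt hτ hlt
    have h3 : φ * K τ - φ₀ * K τ₀ ≤ φ * (P τ * (τ₀ - τ) + deriv P τ / 2 * (τ₀ - τ) ^ 2) := by
      rw [hug]
      nlinarith
    nlinarith

/-! #### Simple waves -/

theorem speed_pos (h : IsProfile K P) {τ : ℝ} (hτ : 0 < τ) : 0 < speed P τ :=
  Real.sqrt_pos.2 (by linarith [h.deriv_neg τ hτ])

theorem speed_sq (h : IsProfile K P) {τ : ℝ} (hτ : 0 < τ) : speed P τ ^ 2 = -deriv P τ :=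
  Real.sq_sqrt (by linarith [h.deriv_neg τ hτ])

theorem contDiffOn_speed (h : IsProfile K P) : ContDiffOn ℝ 1 (speed P) (Ioi 0) :=
  h.contDiffOn_deriv.neg.sqrt fun τ hτ => by
    have := h.deriv_neg τ hτ
    linarith

theorem hasDerivAt_speed (h : IsProfile K P) {τ : ℝ} (hτ : 0 < τ) :
    HasDerivAt (speed P) (-deriv (deriv P) τ / (2 * speed P τ)) τ :=
  (h.hasDerivAt_deriv hτ).neg.sqrt (by have := h.deriv_neg τ hτ; simp; linarith)

theorem hasDerivAt_speedIntegral (h : IsProfile K P) {τ : ℝ} (hτ : 0 < τ) :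
    HasDerivAt (speedIntegral P) (speed P τ) τ := by
  have hc := h.contDiffOn_speed.continuousOn
  exact intervalIntegral.integral_hasDerivAt_right
    (hc.mono fun x hx => lt_of_lt_of_le (lt_min one_pos hτ) hx.1).intervalIntegrable
    (hc.stronglyMeasurableAtFilter isOpen_Ioi τ hτ) (hc.continuousAt (Ioi_mem_nhds hτ))

theorem continuousOn_speedIntegral (h : IsProfile K P) : ContinuousOn (speedIntegral P) (Ioi 0) :=
  fun _ hτ => (h.hasDerivAt_speedIntegral hτ).continuousAt.continuousWithinAt

theorem strictMonoOn_speedIntegral (h : IsProfile K P) :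
    StrictMonoOn (speedIntegral P) (Ioi 0) := by
  refine strictMonoOn_of_deriv_pos (convex_Ioi 0) h.continuousOn_speedIntegral fun τ hτ => ?_
  rw [interior_Ioi] at hτ
  rw [(h.hasDerivAt_speedIntegral hτ).deriv]
  exact h.speed_pos hτ

theorem contDiffOn_speedIntegral (h : IsProfile K P) :
    ContDiffOn ℝ 1 (speedIntegral P) (Ioi 0) := by
  rw [contDiffOn_one_iff_derivWithin (uniqueDiffOn_Ioi 0)]
  refine ⟨fun τ hτ => (h.hasDerivAt_speedIntegral hτ).differentiableAt.differentiableWithinAt,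
    h.contDiffOn_speed.continuousOn.congr fun τ hτ => ?_⟩
  rw [derivWithin_of_isOpen isOpen_Ioi hτ, (h.hasDerivAt_speedIntegral hτ).deriv]

theorem hasDerivAt_charSpeed (h : IsProfile K P) {τ : ℝ} (hτ : 0 < τ) :
    HasDerivAt (charSpeed P) (τ * (deriv (deriv P) τ / (2 * speed P τ))) τ := by
  refine ((h.hasDerivAt_speedIntegral hτ).sub
    ((hasDerivAt_id τ).mul (h.hasDerivAt_speed hτ))).congr_deriv ?_
  simp; ring

theorem charSpeed_deriv_pos (h : IsProfile K P) {τ : ℝ} (hτ : 0 < τ) :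
    0 < τ * (deriv (deriv P) τ / (2 * speed P τ)) := by
  have := h.deriv_deriv_pos τ hτ
  have := h.speed_pos hτ
  positivity

theorem contDiffOn_charSpeed (h : IsProfile K P) : ContDiffOn ℝ 1 (charSpeed P) (Ioi 0) :=
  h.contDiffOn_speedIntegral.sub (contDiffOn_id.mul h.contDiffOn_speed)

/-- Genuine nonlinearity: the derivative is τ P''/(2√(-P')). Along a backward simple wave u - c is a
constant plus √f(S) times this function, so u - c determines the volume. -/
theorem strictMonoOn_charSpeed (h : IsProfile K P) : StrictMonoOn (charSpeed P) (Ioi 0) := by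
  refine strictMonoOn_of_deriv_pos (convex_Ioi 0) h.contDiffOn_charSpeed.continuousOn
    fun τ hτ => ?_
  rw [interior_Ioi] at hτ
  rw [(h.hasDerivAt_charSpeed hτ).deriv]
  exact h.charSpeed_deriv_pos hτ

theorem tendsto_speedIntegral (h : IsProfile K P) : Tendsto (speedIntegral P) atTop atTop :=
  h.integral_speed

/-- The term τ√(-P') stays bounded while the speed integral diverges; a rarefaction reaching vacuum
would need unbounded characteristic speeds. -/
theorem tendsto_charSpeed (h : IsProfile K P) : Tendsto (charSpeed P) atTop atTop := by
  obtain ⟨C, hC⟩ := h.speed_bounded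
  refine tendsto_atTop_mono' _ ?_ (tendsto_atTop_add_const_right _ (-C) h.tendsto_speedIntegral)
  filter_upwards [eventually_ge_atTop 1] with τ hτ
  have := hC τ hτ
  simp only [charSpeed, speed]
  linarith

/-! #### The wave curve -/

/-- The derivative is -(K P' + P²/2)/P², positive by the medium condition. Because E = p K/P, this
is what makes the Hugoniot function increase with the volume at fixed pressures. -/
theorem strictMonoOn_ratio (h : IsProfile K P) :
    StrictMonoOn (fun τ => K τ / P τ + τ / 2) (Ioi 0) := by
  have hd : ∀ τ, 0 < τ → HasDerivAt (fun τ => K τ / P τ + τ / 2)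
      ((-P τ * P τ - K τ * deriv P τ) / P τ ^ 2 + 1 / 2) τ := fun τ hτ =>
    ((h.hasDerivAt_K τ hτ).div (h.hasDerivAt_P hτ) (h.P_pos τ hτ).ne').add
      ((hasDerivAt_id τ).div_const 2)
  refine strictMonoOn_of_deriv_pos (convex_Ioi 0)
    (fun τ hτ => (hd τ hτ).continuousAt.continuousWithinAt) fun τ hτ => ?_
  rw [interior_Ioi] at hτ
  rw [(hd τ hτ).deriv]
  have hP := h.P_pos τ hτ
  have hm := h.medium τ hτ
  have : (-P τ * P τ - K τ * deriv P τ) / P τ ^ 2 + 1 / 2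
      = (-(P τ ^ 2 / 2) - K τ * deriv P τ) / P τ ^ 2 := by
    field_simp; ring
  rw [this]
  exact div_pos (by linarith) (by positivity)

theorem continuousOn_ratio (h : IsProfile K P) : ContinuousOn (fun τ => K τ / P τ) (Ioi 0) :=
  ContinuousOn.div (fun τ hτ => (h.hasDerivAt_K τ hτ).continuousAt.continuousWithinAt)
    h.smooth.continuousOn fun τ hτ => (h.P_pos τ hτ).ne'

theorem strictMonoOn_hugoniot (h : IsProfile K P) (τ₀ : ℝ) {p₀ p : ℝ} (hp₀ : 0 < p₀)
    (hp : 0 < p) : StrictMonoOn (fun τ => hugoniot K P τ₀ p₀ τ p) (Ioi 0) := by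
  intro s hs t ht hst
  have := h.strictMonoOn_ratio hs ht hst
  simp only [hugoniot] at this ⊢
  nlinarith

theorem hugoniot_self (p₀ τ₀ p : ℝ) :
    hugoniot K P τ₀ p₀ τ₀ p = (p - p₀) * (K τ₀ / P τ₀) := by
  simp only [hugoniot]; ring

/-- As τ → 0 the ratio K/P vanishes and the Hugoniot function has a negative limit, while at τ₀ it
is nonnegative; the root comes from the intermediate value theorem. -/
theorem exists_shockVolume (h : IsProfile K P) {τ₀ p₀ p : ℝ} (hτ₀ : 0 < τ₀) (hp₀ : 0 < p₀)
    (hp : p₀ ≤ p) : ∃ τ, 0 < τ ∧ τ ≤ τ₀ ∧ hugoniot K P τ₀ p₀ τ p = 0 := by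
  have hlim : Tendsto (fun τ => hugoniot K P τ₀ p₀ τ p) (𝓝[>] 0)
      (𝓝 (p * 0 - p₀ * (K τ₀ / P τ₀) - (p + p₀) / 2 * (τ₀ - 0))) := by
    have hid : Tendsto (fun τ : ℝ => τ) (𝓝[>] 0) (𝓝 0) :=
      tendsto_id.mono_left nhdsWithin_le_nhds
    exact ((h.ratio_tendsto.const_mul p).sub tendsto_const_nhds).sub
      ((tendsto_const_nhds.sub hid).const_mul _)
  have ha := div_pos (h.K_pos τ₀ hτ₀) (h.P_pos τ₀ hτ₀)
  have hneg : p * 0 - p₀ * (K τ₀ / P τ₀) - (p + p₀) / 2 * (τ₀ - 0) < 0 := by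
    have : 0 < p₀ * (K τ₀ / P τ₀) := by positivity
    have : 0 < (p + p₀) / 2 * τ₀ := by nlinarith
    linarith
  obtain ⟨s, hs, hs0, hs1⟩ := ((hlim.eventually_lt_const hneg).and (Ioo_mem_nhdsGT hτ₀)).exists
  have hcont : ContinuousOn (fun τ => hugoniot K P τ₀ p₀ τ p) (Icc s τ₀) := by
    have := h.continuousOn_ratio.mono (fun x (hx : x ∈ Icc s τ₀) => hs0.trans_le hx.1)
    unfold hugoniot
    fun_prop
  have hend : 0 ≤ hugoniot K P τ₀ p₀ τ₀ p := by
    rw [hugoniot_self]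
    exact mul_nonneg (by linarith) ha.le
  obtain ⟨τ, hτ, hτ'⟩ := intermediate_value_Icc hs1.le hcont ⟨hs.le, hend⟩
  exact ⟨τ, hs0.trans_le hτ.1, hτ.2, hτ'⟩

theorem shockVolume_eq (h : IsProfile K P) {τ₀ p₀ p τ : ℝ} (hp₀ : 0 < p₀) (hp : 0 < p)
    (hτ : 0 < τ) (hug : hugoniot K P τ₀ p₀ τ p = 0) : shockVolume K P τ₀ p₀ p = τ := by
  have hs := Classical.epsilon_spec (p := fun τ => 0 < τ ∧ hugoniot K P τ₀ p₀ τ p = 0)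
    ⟨τ, hτ, hug⟩
  exact (h.strictMonoOn_hugoniot τ₀ hp₀ hp).injOn hs.1 hτ (hs.2.trans hug.symm)

theorem shockVolume_spec (h : IsProfile K P) {τ₀ p₀ p : ℝ} (hτ₀ : 0 < τ₀) (hp₀ : 0 < p₀)
    (hp : p₀ ≤ p) : 0 < shockVolume K P τ₀ p₀ p ∧ shockVolume K P τ₀ p₀ p ≤ τ₀ ∧
      hugoniot K P τ₀ p₀ (shockVolume K P τ₀ p₀ p) p = 0 := by
  obtain ⟨τ, h1, h2, h3⟩ := h.exists_shockVolume hτ₀ hp₀ hp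
  rw [h.shockVolume_eq hp₀ (hp₀.trans_le hp) h1 h3]
  exact ⟨h1, h2, h3⟩

theorem shockVolume_lt (h : IsProfile K P) {τ₀ p₀ p : ℝ} (hτ₀ : 0 < τ₀) (hp₀ : 0 < p₀)
    (hp : p₀ < p) : shockVolume K P τ₀ p₀ p < τ₀ := by
  obtain ⟨h1, h2, h3⟩ := h.shockVolume_spec hτ₀ hp₀ hp.le
  refine h2.lt_of_ne fun heq => ?_
  rw [heq, hugoniot_self] at h3
  have := mul_pos (sub_pos.2 hp) (div_pos (h.K_pos τ₀ hτ₀) (h.P_pos τ₀ hτ₀))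
  linarith

/-- Raising the pressure at the old root t₁ changes the Hugoniot function by a multiple of K/P - (τ₀
- t₁)/2. The equation for t₁ shows that this factor is nonnegative, so the root moves to the left.
-/
theorem shockVolume_antitoneOn (h : IsProfile K P) {τ₀ p₀ : ℝ} (hτ₀ : 0 < τ₀) (hp₀ : 0 < p₀) :
    AntitoneOn (shockVolume K P τ₀ p₀) (Ici p₀) := by
  intro p₁ (hp₁ : p₀ ≤ p₁) p₂ (hp₂ : p₀ ≤ p₂) h12
  obtain ⟨h1, h1', e1⟩ := h.shockVolume_spec hτ₀ hp₀ hp₁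
  obtain ⟨h2, h2', e2⟩ := h.shockVolume_spec hτ₀ hp₀ hp₂
  set t₁ := shockVolume K P τ₀ p₀ p₁
  set t₂ := shockVolume K P τ₀ p₀ p₂
  have ha₀ := div_pos (h.K_pos τ₀ hτ₀) (h.P_pos τ₀ hτ₀)
  have hpos₁ := hp₀.trans_le hp₁
  have hpos₂ := hp₀.trans_le hp₂
  have ha : 0 ≤ K t₁ / P t₁ - (τ₀ - t₁) / 2 := by
    have h3 : p₁ * (K t₁ / P t₁ - (τ₀ - t₁) / 2) = p₀ * (K τ₀ / P τ₀) + p₀ / 2 * (τ₀ - t₁) := by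
      unfold hugoniot at e1; linear_combination e1
    have h4 : 0 ≤ p₁ * (K t₁ / P t₁ - (τ₀ - t₁) / 2) := by
      rw [h3]
      have : 0 ≤ τ₀ - t₁ := by linarith
      positivity
    exact nonneg_of_mul_nonneg_right h4 hpos₁
  have h5 : hugoniot K P τ₀ p₀ t₂ p₂ ≤ hugoniot K P τ₀ p₀ t₁ p₂ := by
    have : hugoniot K P τ₀ p₀ t₁ p₂ = hugoniot K P τ₀ p₀ t₁ p₁
        + (p₂ - p₁) * (K t₁ / P t₁ - (τ₀ - t₁) / 2) := by unfold hugoniot; ring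
    rw [this, e1, e2]
    have := mul_nonneg (sub_nonneg.2 h12) ha
    linarith
  exact ((h.strictMonoOn_hugoniot τ₀ hp₀ hpos₂).le_iff_le h2 h1).1 h5

theorem continuousOn_shockVolume (h : IsProfile K P) {τ₀ p₀ : ℝ} (hτ₀ : 0 < τ₀) (hp₀ : 0 < p₀) :
    ContinuousOn (shockVolume K P τ₀ p₀) (Ici p₀) := by
  refine continuousOn_root (h := hugoniot K P τ₀ p₀) (I := Ioi 0) isOpen_Ioi
    (fun p hp => h.strictMonoOn_hugoniot τ₀ hp₀ (hp₀.trans_le hp))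
    (fun p hp => (h.shockVolume_spec hτ₀ hp₀ hp).1)
    (fun p hp => (h.shockVolume_spec hτ₀ hp₀ hp).2.2) fun τ _ => ?_
  unfold hugoniot
  fun_prop

theorem exists_rarefactionVolume (h : IsProfile K P) {τ₀ φ₀ p : ℝ} (hτ₀ : 0 < τ₀)
    (hp : 0 < p) (hle : p ≤ φ₀ * P τ₀) : ∃ τ, τ₀ ≤ τ ∧ φ₀ * P τ = p := by
  have h1 : Tendsto (fun τ => φ₀ * P τ) atTop (𝓝 0) := by
    simpa using h.tendsto_atTop.const_mul φ₀
  obtain ⟨s, hs, hs'⟩ := ((h1.eventually_lt_const hp).and (eventually_ge_atTop τ₀)).exists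
  have hcont : ContinuousOn (fun τ => φ₀ * P τ) (Icc τ₀ s) :=
    continuousOn_const.mul (h.smooth.continuousOn.mono fun x hx => hτ₀.trans_le hx.1)
  obtain ⟨τ, hτ, hτ'⟩ := intermediate_value_Icc' hs' hcont ⟨hs.le, hle⟩
  exact ⟨τ, hτ.1, hτ'⟩

theorem rarefactionVolume_eq (h : IsProfile K P) {φ₀ p τ : ℝ} (hφ₀ : 0 < φ₀) (hτ : 0 < τ)
    (hp : φ₀ * P τ = p) : rarefactionVolume P φ₀ p = τ := by
  have hs := Classical.epsilon_spec (p := fun τ => 0 < τ ∧ φ₀ * P τ = p) ⟨τ, hτ, hp⟩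
  exact h.strictAntiOn.injOn hs.1 hτ (mul_left_cancel₀ hφ₀.ne' (hs.2.trans hp.symm))

theorem rarefactionVolume_spec (h : IsProfile K P) {τ₀ φ₀ p : ℝ} (hτ₀ : 0 < τ₀) (hφ₀ : 0 < φ₀)
    (hp : 0 < p) (hle : p ≤ φ₀ * P τ₀) :
    τ₀ ≤ rarefactionVolume P φ₀ p ∧ φ₀ * P (rarefactionVolume P φ₀ p) = p := by
  obtain ⟨τ, h1, h2⟩ := h.exists_rarefactionVolume hτ₀ hp hle
  rw [h.rarefactionVolume_eq hφ₀ (hτ₀.trans_le h1) h2]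
  exact ⟨h1, h2⟩

theorem rarefactionVolume_strictAntiOn (h : IsProfile K P) {τ₀ φ₀ : ℝ} (hτ₀ : 0 < τ₀)
    (hφ₀ : 0 < φ₀) : StrictAntiOn (rarefactionVolume P φ₀) (Ioc 0 (φ₀ * P τ₀)) := by
  intro p₁ hp₁ p₂ hp₂ h12
  obtain ⟨h1, e1⟩ := h.rarefactionVolume_spec hτ₀ hφ₀ hp₁.1 hp₁.2
  obtain ⟨h2, e2⟩ := h.rarefactionVolume_spec hτ₀ hφ₀ hp₂.1 hp₂.2
  refine (h.strictAntiOn.lt_iff_gt (hτ₀.trans_le h1) (hτ₀.trans_le h2)).1 ?_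
  exact lt_of_mul_lt_mul_left (by rw [e1, e2]; exact h12) hφ₀.le

theorem continuousOn_rarefactionVolume (h : IsProfile K P) {τ₀ φ₀ : ℝ} (hτ₀ : 0 < τ₀)
    (hφ₀ : 0 < φ₀) : ContinuousOn (rarefactionVolume P φ₀) (Ioc 0 (φ₀ * P τ₀)) := by
  refine continuousOn_root (h := fun τ p => p - φ₀ * P τ) (I := Ioi 0) isOpen_Ioi
    (fun p _ s hs t ht hst => ?_)
    (fun p hp => hτ₀.trans_le (h.rarefactionVolume_spec hτ₀ hφ₀ hp.1 hp.2).1)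
    (fun p hp => ?_) fun τ _ => by fun_prop
  · have := mul_lt_mul_of_pos_left (h.strictAntiOn hs ht hst) hφ₀
    simp only; linarith
  · simp only [(h.rarefactionVolume_spec hτ₀ hφ₀ hp.1 hp.2).2, sub_self]

theorem velocityDrop_of_ge (h : IsProfile K P) {τ₀ φ₀ p : ℝ} (hτ₀ : 0 < τ₀) (hφ₀ : 0 < φ₀)
    (hp : φ₀ * P τ₀ ≤ p) : velocityDrop K P τ₀ φ₀ p =
      √((p - φ₀ * P τ₀) * (τ₀ - shockVolume K P τ₀ (φ₀ * P τ₀) p)) := by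
  rw [velocityDrop, max_eq_left hp, min_eq_right hp, h.rarefactionVolume_eq hφ₀ hτ₀ rfl]
  ring

theorem velocityDrop_of_le {τ₀ φ₀ p : ℝ} (hp : p ≤ φ₀ * P τ₀) :
    velocityDrop K P τ₀ φ₀ p =
      -(√φ₀ * (speedIntegral P (rarefactionVolume P φ₀ p) - speedIntegral P τ₀)) := by
  rw [velocityDrop, max_eq_right hp, min_eq_left hp]
  simp

/-- On the rarefaction branch the volume falls as the pressure grows. On the shock branch p - p₀
increases and τ₀ - τ does not decrease. The branches share the point p₀. -/
theorem strictMonoOn_velocityDrop (h : IsProfile K P) {τ₀ φ₀ : ℝ} (hτ₀ : 0 < τ₀)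
    (hφ₀ : 0 < φ₀) : StrictMonoOn (velocityDrop K P τ₀ φ₀) (Ioi 0) := by
  have hp₀ : 0 < φ₀ * P τ₀ := mul_pos hφ₀ (h.P_pos τ₀ hτ₀)
  have h1 : StrictMonoOn (velocityDrop K P τ₀ φ₀) (Ioc 0 (φ₀ * P τ₀)) := by
    intro p₁ hp₁ p₂ hp₂ h12
    rw [velocityDrop_of_le hp₁.2, velocityDrop_of_le hp₂.2]
    have h3 := h.strictMonoOn_speedIntegral
      (hτ₀.trans_le (h.rarefactionVolume_spec hτ₀ hφ₀ hp₂.1 hp₂.2).1)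
      (hτ₀.trans_le (h.rarefactionVolume_spec hτ₀ hφ₀ hp₁.1 hp₁.2).1)
      (h.rarefactionVolume_strictAntiOn hτ₀ hφ₀ hp₁ hp₂ h12)
    have := mul_lt_mul_of_pos_left h3 (Real.sqrt_pos.2 hφ₀)
    linarith
  have h2 : StrictMonoOn (velocityDrop K P τ₀ φ₀) (Ici (φ₀ * P τ₀)) := by
    intro p₁ hp₁ p₂ hp₂ h12
    have hlt : φ₀ * P τ₀ < p₂ := lt_of_le_of_lt hp₁ h12
    rw [h.velocityDrop_of_ge hτ₀ hφ₀ hp₁, h.velocityDrop_of_ge hτ₀ hφ₀ hp₂]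
    have h3 := h.shockVolume_antitoneOn hτ₀ hp₀ hp₁ hp₂ h12.le
    have h4 := (h.shockVolume_spec hτ₀ hp₀ hp₁).2.1
    have h5 := h.shockVolume_lt hτ₀ hp₀ hlt
    have h6 : φ₀ * P τ₀ ≤ p₁ := hp₁
    apply Real.sqrt_lt_sqrt (mul_nonneg (by linarith) (by linarith))
    nlinarith
  have := StrictMonoOn.union h1 h2 (isGreatest_Ioc hp₀) isLeast_Ici
  rwa [Ioc_union_Ici_eq_Ioi hp₀] at this

/-- The truncations by `max` and `min` make both terms continuous on all of (0, ∞), so no gluing at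
p₀ is needed. -/
theorem continuousOn_velocityDrop (h : IsProfile K P) {τ₀ φ₀ : ℝ} (hτ₀ : 0 < τ₀)
    (hφ₀ : 0 < φ₀) : ContinuousOn (velocityDrop K P τ₀ φ₀) (Ioi 0) := by
  have hp₀ : 0 < φ₀ * P τ₀ := mul_pos hφ₀ (h.P_pos τ₀ hτ₀)
  have h1 : ContinuousOn (fun p => shockVolume K P τ₀ (φ₀ * P τ₀) (max p (φ₀ * P τ₀))) (Ioi 0) :=
    (h.continuousOn_shockVolume hτ₀ hp₀).comp (by fun_prop) fun p _ => mem_Ici.2 (le_max_right _ _)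
  have h2 : ContinuousOn (fun p => rarefactionVolume P φ₀ (min p (φ₀ * P τ₀))) (Ioi 0) :=
    (h.continuousOn_rarefactionVolume hτ₀ hφ₀).comp (by fun_prop)
      fun p hp => ⟨lt_min hp hp₀, min_le_right _ _⟩
  have h3 : ContinuousOn (fun p => speedIntegral P (rarefactionVolume P φ₀ (min p (φ₀ * P τ₀))))
      (Ioi 0) := h.continuousOn_speedIntegral.comp h2 fun p hp =>
    hτ₀.trans_le (h.rarefactionVolume_spec hτ₀ hφ₀ (lt_min hp hp₀) (min_le_right _ _)).1
  unfold velocityDrop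
  fun_prop

/-- Beyond a reference pressure p₁ > p₀ the compression τ₀ - τ is bounded below by its value at p₁,
so the drop grows at least like √(p - p₀). -/
theorem tendsto_velocityDrop_atTop (h : IsProfile K P) {τ₀ φ₀ : ℝ} (hτ₀ : 0 < τ₀)
    (hφ₀ : 0 < φ₀) : Tendsto (velocityDrop K P τ₀ φ₀) atTop atTop := by
  have hp₀ : 0 < φ₀ * P τ₀ := mul_pos hφ₀ (h.P_pos τ₀ hτ₀)
  set p₁ := φ₀ * P τ₀ + 1 with hp₁
  have hv := h.shockVolume_lt (p := p₁) hτ₀ hp₀ (by linarith)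
  have h1 : Tendsto (fun p => √((p - φ₀ * P τ₀) * (τ₀ - shockVolume K P τ₀ (φ₀ * P τ₀) p₁)))
      atTop atTop := by
    refine Real.tendsto_sqrt_atTop.comp (Tendsto.atTop_mul_const (by linarith) ?_)
    exact tendsto_atTop_add_const_right _ (-(φ₀ * P τ₀)) tendsto_id
  refine tendsto_atTop_mono' _ ?_ h1
  filter_upwards [eventually_ge_atTop p₁] with p hp
  have hp' : φ₀ * P τ₀ ≤ p := by linarith
  rw [h.velocityDrop_of_ge hτ₀ hφ₀ hp']
  have := h.shockVolume_antitoneOn hτ₀ hp₀ (show φ₀ * P τ₀ ≤ p₁ by linarith) hp' hp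
  gcongr

/-- As p → 0 the volume tends to infinity, and the speed integral diverges with it. This limit
ensures that even rapidly separating data are joined at a positive pressure. -/
theorem tendsto_velocityDrop_zero (h : IsProfile K P) {τ₀ φ₀ : ℝ} (hτ₀ : 0 < τ₀)
    (hφ₀ : 0 < φ₀) : Tendsto (velocityDrop K P τ₀ φ₀) (𝓝[>] 0) atBot := by
  have hp₀ : 0 < φ₀ * P τ₀ := mul_pos hφ₀ (h.P_pos τ₀ hτ₀)
  have hT : Tendsto (rarefactionVolume P φ₀) (𝓝[>] 0) atTop := by
    refine Filter.tendsto_atTop.2 fun M => ?_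
    set M' := max M 1
    have hM' : 0 < M' := lt_of_lt_of_le one_pos (le_max_right _ _)
    filter_upwards [Ioo_mem_nhdsGT (lt_min hp₀ (mul_pos hφ₀ (h.P_pos M' hM')))] with p hp
    obtain ⟨h1, h2⟩ := h.rarefactionVolume_spec hτ₀ hφ₀ hp.1 (hp.2.le.trans (min_le_left _ _))
    refine (le_max_left M 1).trans (le_of_lt ?_)
    refine (h.strictAntiOn.lt_iff_gt (hτ₀.trans_le h1) hM').1 ?_
    exact lt_of_mul_lt_mul_left (by rw [h2]; exact hp.2.trans_le (min_le_right _ _)) hφ₀.le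
  have h1 : Tendsto (fun p => -(√φ₀ * (speedIntegral P (rarefactionVolume P φ₀ p)
      - speedIntegral P τ₀))) (𝓝[>] 0) atBot := by
    refine tendsto_neg_atTop_atBot.comp (Tendsto.const_mul_atTop (Real.sqrt_pos.2 hφ₀) ?_)
    exact tendsto_atTop_add_const_right _ (-speedIntegral P τ₀) (h.tendsto_speedIntegral.comp hT)
  refine h1.congr' ?_
  filter_upwards [Ioo_mem_nhdsGT hp₀] with p hp
  rw [velocityDrop_of_le hp.2.le]

/-- The pressure between the two waves of a Riemann problem. -/
theorem exists_pressure (h : IsProfile K P) {τl φl τr φr : ℝ} (hτl : 0 < τl) (hφl : 0 < φl)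
    (hτr : 0 < τr) (hφr : 0 < φr) (d : ℝ) :
    ∃ p, 0 < p ∧ velocityDrop K P τl φl p + velocityDrop K P τr φr p = d := by
  have hbot := (h.tendsto_velocityDrop_zero hτl hφl).atBot_add_atBot
    (h.tendsto_velocityDrop_zero hτr hφr)
  have htop := (h.tendsto_velocityDrop_atTop hτl hφl).atTop_add_atTop
    (h.tendsto_velocityDrop_atTop hτr hφr)
  obtain ⟨a, ha, ha0⟩ := ((hbot.eventually_le_atBot d).and self_mem_nhdsWithin).exists
  obtain ⟨b, hb, hab⟩ := ((htop.eventually_ge_atTop d).and (eventually_ge_atTop a)).exists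
  have ha0 : 0 < a := ha0
  obtain ⟨p, hp, hp'⟩ := intermediate_value_Icc hab
    (((h.continuousOn_velocityDrop hτl hφl).add (h.continuousOn_velocityDrop hτr hφr)).mono
      fun x hx => ha0.trans_le hx.1) ⟨ha, hb⟩
  exact ⟨p, ha0.trans_le hp.1, hp'⟩

end IsProfile

/-! ### The equations in Lagrangian form -/

/-- The energy `E(τ, S) = f(S) K(τ)`. -/
def productEnergy (f K : ℝ → ℝ) (τ S : ℝ) : ℝ := f S * K τ

/-- The mass flux `ρ (u - ξ)` through the ray of speed `ξ`. -/
def massFlux (ξ : ℝ) (U : GasState) : ℝ := U.rho * (U.u - ξ)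

variable {f K P : ℝ → ℝ}

theorem pressure_productEnergy (h : IsProfile K P) {τ : ℝ} (hτ : 0 < τ) (S : ℝ) :
    pressure (productEnergy f K) τ S = f S * P τ := by
  have := ((h.hasDerivAt_K τ hτ).const_mul (f S)).deriv
  simp only [pressure, productEnergy]
  rw [this]; ring

theorem pHat_productEnergy (h : IsProfile K P) {ρ : ℝ} (hρ : 0 < ρ) (S : ℝ) :
    pHat (productEnergy f K) ρ S = f S * P (1 / ρ) := by
  rw [pHat, if_pos hρ, pressure_productEnergy h (by positivity)]

/-- Subtracting ξ times the density from the flux gives the Lagrangian form, in which the mass flux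
plays the role of the shock speed. -/
theorem rankineHugoniot_iff (E : ℝ → ℝ → ℝ) (ξ : ℝ) (Ul Ur : GasState) :
    RankineHugoniot E ξ Ul Ur ↔
      massFlux ξ Ul = massFlux ξ Ur ∧
      massFlux ξ Ul * Ul.u + pHat E Ul.rho Ul.S = massFlux ξ Ur * Ur.u + pHat E Ur.rho Ur.S ∧
      massFlux ξ Ul * (1 / 2 * Ul.u ^ 2 + E (1 / Ul.rho) Ul.S) + Ul.u * pHat E Ul.rho Ul.S =
        massFlux ξ Ur * (1 / 2 * Ur.u ^ 2 + E (1 / Ur.rho) Ur.S) + Ur.u * pHat E Ur.rho Ur.S := by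
  simp only [RankineHugoniot, Fin.forall_fin_succ, conserved, flux, massFlux]
  simp only [Matrix.cons_val_zero, Matrix.cons_val_succ, IsEmpty.forall_iff, and_true]
  refine and_congr ?_ (and_congr ?_ ?_) <;> constructor <;> intro h <;> linear_combination h

/-- The smooth Euler equations for a self-similar flow. -/
theorem eulerAt_iff (hf : IsEntropyFactor f) (h : IsProfile K P) {W : ℝ → GasState}
    {ξ τ' u' S' : ℝ} (hρ : 0 < (W ξ).rho) (hτ : HasDerivAt (fun η => 1 / (W η).rho) τ' ξ)
    (hu : HasDerivAt (fun η => (W η).u) u' ξ) (hS : HasDerivAt (fun η => (W η).S) S' ξ) :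
    (∀ t, 0 < t → EulerAt (productEnergy f K) (fun x s => W (x / s)) (ξ * t) t) ↔
      u' = massFlux ξ (W ξ) * τ' ∧
      massFlux ξ (W ξ) * u' + (deriv f (W ξ).S * S' * P (1 / (W ξ).rho)
        + f (W ξ).S * (deriv P (1 / (W ξ).rho) * τ')) = 0 ∧
      massFlux ξ (W ξ) * S' = 0 := by
  set E := productEnergy f K with hE
  set τ := 1 / (W ξ).rho with hτdef
  set u := (W ξ).u with hudef
  set S := (W ξ).S with hSdef
  have hτ0 : 0 < τ := by positivity
  have hρτ : (W ξ).rho = τ⁻¹ := by rw [hτdef, one_div, inv_inv]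
  have hdρ : HasDerivAt (fun η => (W η).rho) (-τ' / τ ^ 2) ξ := by
    have := hτ.inv hτ0.ne'
    refine (this.congr_of_eventuallyEq (Eventually.of_forall fun η => ?_))
    simp
  have hev : ∀ᶠ η in 𝓝 ξ, 0 < (W η).rho := hdρ.continuousAt.eventually (lt_mem_nhds hρ)
  have hf1 : HasDerivAt f (deriv f S) S :=
    (hf.smooth.differentiable (by norm_num)).differentiableAt.hasDerivAt
  have hfS : HasDerivAt (fun η => f (W η).S) (deriv f S * S') ξ := hf1.comp ξ hS
  have hKd : HasDerivAt (fun η => K (1 / (W η).rho)) (-P τ * τ') ξ :=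
    (h.hasDerivAt_K τ hτ0).comp ξ hτ
  have hPd : HasDerivAt (fun η => P (1 / (W η).rho)) (deriv P τ * τ') ξ :=
    (h.hasDerivAt_P hτ0).comp ξ hτ
  have hpd : HasDerivAt (fun η => pHat E (W η).rho (W η).S)
      (deriv f S * S' * P τ + f S * (deriv P τ * τ')) ξ := by
    refine (hfS.mul hPd).congr_of_eventuallyEq ?_
    filter_upwards [hev] with η hη
    rw [pHat_productEnergy h hη]; rfl
  set p' := deriv f S * S' * P τ + f S * (deriv P τ * τ') with hp'
  set ρ' := -τ' / τ ^ 2 with hρ'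
  set e' := deriv f S * S' * K τ + f S * (-P τ * τ') with he'
  have hed : HasDerivAt (fun η => E (1 / (W η).rho) (W η).S) e' ξ := hfS.mul hKd
  have hp0 : pHat E (W ξ).rho S = f S * P τ := pHat_productEnergy h hρ _
  have hC : ∀ i, HasDerivAt (fun η => conserved E (W η) i)
      ((![ρ', ρ' * u + τ⁻¹ * u', 1 / 2 * ρ' * u ^ 2 + τ⁻¹ * u * u' + ρ' * (f S * K τ) + τ⁻¹ * e'] :
        Fin 3 → ℝ) i) ξ := by
    intro i
    fin_cases i
    · exact hdρ
    · refine (hdρ.mul hu).congr_deriv ?_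
      simp [hρτ, hudef]
    · refine (((hdρ.const_mul (1 / 2)).mul (hu.pow 2)).add (hdρ.mul hed)).congr_deriv ?_
      simp [hρτ, hE, productEnergy, ← hudef, ← hSdef]
      ring
  have hF : ∀ i, HasDerivAt (fun η => flux E (W η) i)
      ((![ρ' * u + τ⁻¹ * u', ρ' * u ^ 2 + τ⁻¹ * (2 * u * u') + p',
        u' * (1 / 2 * τ⁻¹ * u ^ 2 + τ⁻¹ * (f S * K τ) + f S * P τ)
        + u * (1 / 2 * ρ' * u ^ 2 + τ⁻¹ * u * u' + ρ' * (f S * K τ) + τ⁻¹ * e' + p')] :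
        Fin 3 → ℝ) i) ξ := by
    intro i
    fin_cases i
    · refine (hdρ.mul hu).congr_deriv ?_
      simp [hρτ, hudef]
    · refine ((hdρ.mul (hu.pow 2)).add hpd).congr_deriv ?_
      simp [hρτ, ← hudef]
    · refine (hu.mul ((((hdρ.const_mul (1 / 2)).mul (hu.pow 2)).add (hdρ.mul hed)).add
        hpd)).congr_deriv ?_
      simp [hρτ, hE, productEnergy, ← hudef, ← hSdef]
      rw [← hρτ, ← hE, hp0, hρτ]
      ring
  -- By the chain rule for x/t the time derivative carries the factor -ξ/t and the space derivative
  -- 1/t, so the equations become F' = ξ C' in the similarity variable.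
  have key : (∀ t, 0 < t → EulerAt E (fun x s => W (x / s)) (ξ * t) t) ↔
      ∀ i, deriv (fun η => flux E (W η) i) ξ - ξ * deriv (fun η => conserved E (W η) i) ξ = 0 := by
    have hform : ∀ t, 0 < t → ∀ i, deriv (fun s => conserved E (W (ξ * t / s)) i) t
        + deriv (fun y => flux E (W (y / t)) i) (ξ * t)
        = (deriv (fun η => flux E (W η) i) ξ - ξ * deriv (fun η => conserved E (W η) i) ξ) / t := by
      intro t ht i
      have e1 : ξ * t / t = ξ := by field_simp
      have d1 : HasDerivAt (fun s => ξ * t / s) (-(ξ / t)) t := by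
        have := (hasDerivAt_inv ht.ne').const_mul (ξ * t)
        refine this.congr_deriv ?_
        field_simp
      have d2 : HasDerivAt (fun y => y / t) (1 / t) (ξ * t) := (hasDerivAt_id _).div_const t
      have c1 := (e1 ▸ hC i : HasDerivAt _ _ (ξ * t / t)).comp t d1
      have c2 := (e1 ▸ hF i : HasDerivAt _ _ (ξ * t / t)).comp (ξ * t) d2
      rw [(hC i).deriv, (hF i).deriv]
      have c1' := c1.deriv
      have c2' := c2.deriv
      simp only [Function.comp_def] at c1' c2'
      rw [c1', c2']
      field_simp
      ring
    constructor
    · intro H i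
      have := H 1 one_pos i
      simp only at this
      rw [hform 1 one_pos i] at this
      simpa using this
    · intro H t ht i
      simp only
      rw [hform t ht i, H i, zero_div]
  rw [key]
  have hm : massFlux ξ (W ξ) = τ⁻¹ * (u - ξ) := by rw [massFlux, hρτ]
  simp only [Fin.forall_fin_succ, (hC _).deriv, (hF _).deriv]
  simp only [Matrix.cons_val_zero, Matrix.cons_val_succ, IsEmpty.forall_iff, and_true]
  rw [hm]
  have hfp := hf.deriv_pos S
  have hKp := h.K_pos τ hτ0
  have hρe : ρ' = -τ' * τ⁻¹ ^ 2 := by rw [hρ']; field_simp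
  have hττ : τ * τ⁻¹ = 1 := mul_inv_cancel₀ hτ0.ne'
  have hi0 : τ⁻¹ ≠ 0 := inv_ne_zero hτ0.ne'
  constructor
  · rintro ⟨h1, h2, h3⟩
    rw [hρe] at h1 h2 h3
    have a1 : u' = τ⁻¹ * (u - ξ) * τ' := by
      apply mul_left_cancel₀ hi0
      linear_combination h1
    have a2 : τ⁻¹ * (u - ξ) * u' + p' = 0 := by linear_combination h2 - u * h1
    refine ⟨a1, a2, ?_⟩
    -- Once the mass and momentum equations are subtracted, the energy equation is m T S' = 0 with T
    -- = f'(S) K > 0.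
    have a3 : τ⁻¹ * (u - ξ) * S' * (deriv f S * K τ) = 0 := by
      rw [he'] at h3
      linear_combination h3 - (1 / 2 * u ^ 2 + f S * K τ) * h1 - u * a2 - f S * P τ * a1
    exact (mul_eq_zero.1 a3).resolve_right (by positivity)
  · rintro ⟨a1, a2, a3⟩
    rw [hρe]
    have h1 : -τ' * τ⁻¹ ^ 2 * u + τ⁻¹ * u' - ξ * (-τ' * τ⁻¹ ^ 2) = 0 := by
      linear_combination τ⁻¹ * a1
    refine ⟨h1, ?_, ?_⟩
    · linear_combination a2 + u * h1
    · rw [he']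
      linear_combination (1 / 2 * u ^ 2 + f S * K τ) * h1 + u * a2 + f S * P τ * a1
        + deriv f S * K τ * a3

/-! ### Piecewise differentiable functions of one variable -/

/-- Induction on the exceptional points: the interval is cut at one of them, which is interior to
neither half, and continuity joins the halves. -/
theorem monotoneOn_of_deriv_nonneg_off_finset {g : ℝ → ℝ} (B : Finset ℝ) :
    ∀ {I : Set ℝ}, I.OrdConnected → ContinuousOn g I →
      (∀ x ∈ interior I, x ∉ B → ∃ g', HasDerivAt g g' x ∧ 0 ≤ g') → MonotoneOn g I := by
  induction B using Finset.induction_on with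
  | empty =>
    intro I hI hc hd
    refine monotoneOn_of_deriv_nonneg hI.convex hc (fun x hx => ?_) fun x hx => ?_
    · obtain ⟨g', h1, -⟩ := hd x hx (by simp)
      exact h1.differentiableAt.differentiableWithinAt
    · obtain ⟨g', h1, h2⟩ := hd x hx (by simp)
      rwa [h1.deriv]
  | insert b B _ ih =>
    intro I hI hc hd
    have h1 : MonotoneOn g (I ∩ Iic b) := by
      refine ih (hI.inter ordConnected_Iic) (hc.mono inter_subset_left) fun x hx hxB => ?_
      rw [interior_inter, interior_Iic] at hx
      exact hd x hx.1 (by simp [hxB, (mem_Iio.1 hx.2).ne])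
    have h2 : MonotoneOn g (I ∩ Ici b) := by
      refine ih (hI.inter ordConnected_Ici) (hc.mono inter_subset_left) fun x hx hxB => ?_
      rw [interior_inter, interior_Ici] at hx
      exact hd x hx.1 (by simp [hxB, (mem_Ioi.1 hx.2).ne'])
    intro x hx y hy hxy
    rcases le_total y b with hyb | hyb
    · exact h1 ⟨hx, hxy.trans hyb⟩ ⟨hy, hyb⟩ hxy
    · rcases le_total b x with hbx | hbx
      · exact h2 ⟨hx, hbx⟩ ⟨hy, hyb⟩ hxy
      · have hb : b ∈ I := hI.out hx hy ⟨hbx, hyb⟩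
        exact (h1 ⟨hx, hbx⟩ ⟨hb, self_mem_Iic⟩ hbx).trans (h2 ⟨hb, self_mem_Ici⟩ ⟨hy, hyb⟩ hyb)

theorem eq_of_deriv_zero_off_finset {g : ℝ → ℝ} (B : Finset ℝ) {I : Set ℝ} (hI : I.OrdConnected)
    (hc : ContinuousOn g I) (hd : ∀ x ∈ interior I, x ∉ B → HasDerivAt g 0 x) {x y : ℝ}
    (hx : x ∈ I) (hy : y ∈ I) : g x = g y := by
  have h1 := monotoneOn_of_deriv_nonneg_off_finset B hI hc
    fun z hz hzB => ⟨0, hd z hz hzB, le_rfl⟩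
  have h2 := monotoneOn_of_deriv_nonneg_off_finset (g := fun z => -g z) B hI hc.neg
    fun z hz hzB => ⟨0, (hd z hz hzB).neg.congr_deriv neg_zero, le_rfl⟩
  have key : ∀ {a b : ℝ}, a ∈ I → b ∈ I → a ≤ b → g a = g b := fun ha hb hab =>
    le_antisymm (h1 ha hb hab) (neg_le_neg_iff.1 (h2 ha hb hab))
  rcases le_total x y with h | h
  · exact key hx hy h
  · exact (key hy hx h).symm

theorem eventually_notMem_finset {B : Finset ℝ} {ξ : ℝ} (hξ : ξ ∉ B) : ∀ᶠ η in 𝓝 ξ, η ∉ B :=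
  B.finite_toSet.isClosed.isOpen_compl.mem_nhds hξ

theorem eventually_ne_notMem_finset (B : Finset ℝ) (ξ : ℝ) : ∀ᶠ η in 𝓝[≠] ξ, η ∉ B := by
  have : ∀ᶠ η in 𝓝 ξ, η ∉ B.erase ξ := eventually_notMem_finset (by simp)
  filter_upwards [this.filter_mono nhdsWithin_le_nhds, self_mem_nhdsWithin] with η h1 h2 h3
  exact h1 (Finset.mem_erase.2 ⟨h2, h3⟩)

theorem strictAntiOn_of_deriv_neg_off_finset {g : ℝ → ℝ} (B : Finset ℝ) {I : Set ℝ}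
    (hI : I.OrdConnected) (hc : ContinuousOn g I)
    (hd : ∀ x ∈ interior I, x ∉ B → ∃ g', HasDerivAt g g' x ∧ g' < 0) : StrictAntiOn g I := by
  have h1 := monotoneOn_of_deriv_nonneg_off_finset (g := fun z => -g z) B hI hc.neg
    fun z hz hzB => by
      obtain ⟨g', h1, h2⟩ := hd z hz hzB
      exact ⟨-g', h1.neg, by linarith⟩
  intro x hx y hy hxy
  -- Equality at two points would make g constant between them, with zero derivative at some point
  -- outside B.
  refine lt_of_le_of_ne (neg_le_neg_iff.1 (h1 hx hy hxy.le)) fun heq => ?_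
  have hsub : Icc x y ⊆ I := hI.out hx hy
  obtain ⟨z, hz, hzB⟩ : ∃ z ∈ Ioo x y, z ∉ B := by
    obtain ⟨z, hz⟩ := ((Ioo_infinite hxy).sdiff B.finite_toSet).nonempty
    exact ⟨z, hz.1, fun h => hz.2 h⟩
  have hzI : z ∈ interior I :=
    mem_interior.2 ⟨Ioo x y, Ioo_subset_Icc_self.trans hsub, isOpen_Ioo, hz⟩
  obtain ⟨g', h2, h3⟩ := hd z hzI hzB
  have hconst : g =ᶠ[𝓝 z] fun _ => g x := by
    filter_upwards [isOpen_Ioo.mem_nhds hz] with t ht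
    have htI := hsub (Ioo_subset_Icc_self ht)
    have h4 := neg_le_neg_iff.1 (h1 hx htI ht.1.le)
    have h5 := neg_le_neg_iff.1 (h1 htI hy ht.2.le)
    linarith
  have := h2.unique ((hasDerivAt_const z (g x)).congr_of_eventuallyEq hconst)
  linarith

/-! ### States and their limits -/

/-- The characteristic speed `u - c` of backward waves. -/
def backSpeed (f P : ℝ → ℝ) (U : GasState) : ℝ :=
  U.u - 1 / U.rho * (√(f U.S) * speed P (1 / U.rho))

namespace StateTendsto

variable {W V : ℝ → GasState} {l : Filter ℝ} {U U' : GasState}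

theorem congr' (hW : StateTendsto W l U) (h : W =ᶠ[l] V) : StateTendsto V l U :=
  ⟨hW.1.congr' (h.mono fun _ e => by rw [e]), hW.2.1.congr' (h.mono fun _ e => by rw [e]),
    hW.2.2.congr' (h.mono fun _ e => by rw [e])⟩

theorem unique [l.NeBot] (h1 : StateTendsto W l U) (h2 : StateTendsto W l U') : U = U' :=
  GasState.ext (tendsto_nhds_unique h1.1 h2.1) (tendsto_nhds_unique h1.2.1 h2.2.1)
    (tendsto_nhds_unique h1.2.2 h2.2.2)

theorem of_eventually_eq (h : ∀ᶠ ξ in l, W ξ = U) : StateTendsto W l U :=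
  ⟨tendsto_const_nhds.congr' (h.mono fun _ e => by simp only [e]),
    tendsto_const_nhds.congr' (h.mono fun _ e => by simp only [e]),
    tendsto_const_nhds.congr' (h.mono fun _ e => by simp only [e])⟩

theorem mono {l' : Filter ℝ} (hW : StateTendsto W l U) (h : l' ≤ l) : StateTendsto W l' U :=
  ⟨hW.1.mono_left h, hW.2.1.mono_left h, hW.2.2.mono_left h⟩

theorem volume (hW : StateTendsto W l U) (hU : 0 < U.rho) :
    Tendsto (fun ξ => 1 / (W ξ).rho) l (𝓝 (1 / U.rho)) :=
  tendsto_const_nhds.div hW.1 hU.ne'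

theorem massFlux {ξ : ℝ} {A : Set ℝ} (hW : StateTendsto W (𝓝[A] ξ) U) :
    Tendsto (fun η => massFlux η (W η)) (𝓝[A] ξ) (𝓝 (massFlux ξ U)) :=
  hW.1.mul (hW.2.1.sub (tendsto_id.mono_left nhdsWithin_le_nhds))

theorem speedIntegral (h : IsProfile K P) (hW : StateTendsto W l U) (hU : 0 < U.rho) :
    Tendsto (fun ξ => speedIntegral P (1 / (W ξ).rho)) l (𝓝 (speedIntegral P (1 / U.rho))) :=
  ((h.hasDerivAt_speedIntegral (by positivity)).continuousAt.tendsto).comp (hW.volume hU)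

theorem backSpeed (hf : IsEntropyFactor f) (h : IsProfile K P) (hW : StateTendsto W l U)
    (hU : 0 < U.rho) :
    Tendsto (fun ξ => backSpeed f P (W ξ)) l (𝓝 (backSpeed f P U)) := by
  have h1 : Tendsto (fun ξ => speed P (1 / (W ξ).rho)) l (𝓝 (speed P (1 / U.rho))) :=
    ((h.hasDerivAt_speed (by positivity)).continuousAt.tendsto).comp (hW.volume hU)
  have h2 : Tendsto (fun ξ => √(f (W ξ).S)) l (𝓝 √(f U.S)) :=
    ((hf.smooth.continuous.tendsto U.S).comp hW.2.2).sqrt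
  exact hW.2.1.sub ((hW.volume hU).mul (h2.mul h1))

end StateTendsto

namespace IsSmoothAt

variable {W : ℝ → GasState} {ξ : ℝ}

theorem stateTendsto {E : ℝ → ℝ → ℝ} (hW : IsSmoothAt E W ξ) : StateTendsto W (𝓝 ξ) (W ξ) :=
  ⟨hW.2.1.continuousAt, hW.2.2.1.continuousAt, hW.2.2.2.1.continuousAt⟩

theorem contDiffAt_volume {E : ℝ → ℝ → ℝ} (hW : IsSmoothAt E W ξ) :
    ContDiffAt ℝ 1 (fun η => 1 / (W η).rho) ξ :=
  contDiffAt_const.div hW.2.1 hW.1.ne'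

theorem exists_derivs (hf : IsEntropyFactor f) (h : IsProfile K P)
    (hW : IsSmoothAt (productEnergy f K) W ξ) :
    ∃ τ' u' S', HasDerivAt (fun η => 1 / (W η).rho) τ' ξ ∧ HasDerivAt (fun η => (W η).u) u' ξ ∧
      HasDerivAt (fun η => (W η).S) S' ξ ∧ u' = massFlux ξ (W ξ) * τ' ∧
      massFlux ξ (W ξ) * u' + (deriv f (W ξ).S * S' * P (1 / (W ξ).rho)
        + f (W ξ).S * (deriv P (1 / (W ξ).rho) * τ')) = 0 ∧
      massFlux ξ (W ξ) * S' = 0 := by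
  have h1 := (hW.contDiffAt_volume.differentiableAt (by norm_num)).hasDerivAt
  have h2 := (hW.2.2.1.differentiableAt (by norm_num)).hasDerivAt
  have h3 := (hW.2.2.2.1.differentiableAt (by norm_num)).hasDerivAt
  exact ⟨_, _, _, h1, h2, h3, (eulerAt_iff hf h hW.1 h1 h2 h3).1 hW.2.2.2.2⟩

/-- Only the mass equation u' = m τ' is used, in m = (u - ξ)/τ. It makes the mass flux strictly
decreasing whatever the flow does. -/
theorem hasDerivAt_massFlux (hf : IsEntropyFactor f) (h : IsProfile K P)
    (hW : IsSmoothAt (productEnergy f K) W ξ) :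
    HasDerivAt (fun η => massFlux η (W η)) (-(W ξ).rho) ξ := by
  obtain ⟨τ', u', S', hτ, hu, -, hode, -⟩ := hW.exists_derivs hf h
  have hρ := hW.1
  have h1 := (hu.sub (hasDerivAt_id ξ)).div hτ (by positivity)
  refine (h1.congr_deriv ?_).congr_of_eventuallyEq (Eventually.of_forall fun η => ?_)
  · rw [hode]
    simp only [massFlux, Pi.sub_apply, id]
    field_simp
    ring
  · simp [massFlux, mul_comm]

end IsSmoothAt

/-! ### Continuous pieces of a flow in which the gas moves to the right -/

/-- The position of the ray relative to the backward characteristic is decided by comparing m with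
the Lagrangian sound speed. -/
theorem sub_backSpeed_eq {U : GasState} (hU : 0 < U.rho) (ξ : ℝ) :
    ξ - backSpeed f P U = 1 / U.rho * (√(f U.S) * speed P (1 / U.rho) - massFlux ξ U) := by
  simp only [backSpeed, massFlux]
  field_simp
  ring

/-- On an interval on which the flow is continuous and the mass flux is positive, the flow is a
sequence of constant states and backward rarefactions. -/
theorem continuous_piece (hf : IsEntropyFactor f) (h : IsProfile K P) {W : ℝ → GasState}
    {I : Set ℝ} (hI : I.OrdConnected) (hIo : IsOpen I) {B : Finset ℝ}
    (hs : ∀ ξ ∈ I, ξ ∉ B → IsSmoothAt (productEnergy f K) W ξ)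
    (hc : ∀ ξ ∈ I, StateTendsto W (𝓝 ξ) (W ξ)) (hρ : ∀ ξ ∈ I, 0 < (W ξ).rho)
    (hm : ∀ ξ ∈ I, 0 < massFlux ξ (W ξ)) :
    (∀ ξ ∈ I, ∀ η ∈ I, (W ξ).S = (W η).S) ∧
    (∀ ξ ∈ I, ∀ η ∈ I, (W ξ).u - √(f (W ξ).S) * speedIntegral P (1 / (W ξ).rho)
      = (W η).u - √(f (W η).S) * speedIntegral P (1 / (W η).rho)) ∧
    MonotoneOn (fun ξ => backSpeed f P (W ξ)) I ∧
    MonotoneOn (fun ξ => ξ - backSpeed f P (W ξ)) I ∧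
    ∀ ξ ∈ I, ξ ∉ B → HasDerivAt (fun η => backSpeed f P (W η)) 0 ξ ∨
      backSpeed f P (W ξ) = ξ := by
  have hIint := hIo.interior_eq
  have hS : ∀ ξ ∈ I, ∀ η ∈ I, (W ξ).S = (W η).S := by
    intro ξ hξ η hη
    refine eq_of_deriv_zero_off_finset (g := fun η => (W η).S) B hI
      (fun ζ hζ => (hc ζ hζ).2.2.mono_left nhdsWithin_le_nhds) (fun ζ hζ hζB => ?_) hξ hη
    rw [hIint] at hζ
    obtain ⟨τ', u', S', -, -, hS, -, -, h3⟩ := (hs ζ hζ hζB).exists_derivs hf h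
    rwa [(mul_eq_zero.1 h3).resolve_left (hm ζ hζ).ne'] at hS
  -- With S' = 0 and u' = m τ' the momentum equation is (m² + f P') τ' = 0: the point is either
  -- stationary or sonic. Since m > 0, only the backward characteristic can be the sonic one.
  have hode : ∀ ξ ∈ I, ξ ∉ B → ∃ τ' u', HasDerivAt (fun η => 1 / (W η).rho) τ' ξ ∧
      HasDerivAt (fun η => (W η).u) u' ξ ∧
      u' = √(f (W ξ).S) * (speed P (1 / (W ξ).rho) * τ') ∧
      (τ' = 0 ∨ backSpeed f P (W ξ) = ξ) := by
    intro ξ hξ hξB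
    obtain ⟨τ', u', S', hτ, hu, -, h1, h2, h3⟩ := (hs ξ hξ hξB).exists_derivs hf h
    have hm' := hm ξ hξ
    have hρ' := hρ ξ hξ
    have hS0 := (mul_eq_zero.1 h3).resolve_left hm'.ne'
    refine ⟨τ', u', hτ, hu, ?_⟩
    by_cases h0 : τ' = 0
    · exact ⟨by rw [h1, h0]; ring, Or.inl h0⟩
    have hq := h.speed_pos (τ := 1 / (W ξ).rho) (by positivity)
    have hq2 := h.speed_sq (τ := 1 / (W ξ).rho) (by positivity)
    have hfp := hf.pos (W ξ).S
    have hsq : massFlux ξ (W ξ) ^ 2 = (√(f (W ξ).S) * speed P (1 / (W ξ).rho)) ^ 2 := by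
      rw [mul_pow, Real.sq_sqrt hfp.le, hq2]
      apply mul_right_cancel₀ h0
      rw [h1, hS0] at h2
      linear_combination h2
    have hmeq : massFlux ξ (W ξ) = √(f (W ξ).S) * speed P (1 / (W ξ).rho) :=
      (pow_left_inj₀ hm'.le (by positivity) two_ne_zero).1 hsq
    refine ⟨by rw [h1, hmeq]; ring, Or.inr ?_⟩
    have := sub_backSpeed_eq (f := f) (P := P) hρ' ξ
    rw [hmeq, sub_self, mul_zero] at this
    linarith
  have hκ : ∀ ξ ∈ I, ∀ η ∈ I, (W ξ).u - √(f (W ξ).S) * speedIntegral P (1 / (W ξ).rho)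
      = (W η).u - √(f (W η).S) * speedIntegral P (1 / (W η).rho) := by
    intro ξ hξ η hη
    have := eq_of_deriv_zero_off_finset
      (g := fun ζ => (W ζ).u - √(f (W ξ).S) * speedIntegral P (1 / (W ζ).rho)) B hI
      (fun ζ hζ => ((hc ζ hζ).2.1.sub (((hc ζ hζ).speedIntegral h (hρ ζ hζ)).const_mul
        _)).mono_left nhdsWithin_le_nhds) (fun ζ hζ hζB => ?_) hξ hη
    · rw [hS η hη ξ hξ]; exact this
    · rw [hIint] at hζ
      obtain ⟨τ', u', hτ, hu, h1, -⟩ := hode ζ hζ hζB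
      have hρ' := hρ ζ hζ
      have hQ := (h.hasDerivAt_speedIntegral (τ := 1 / (W ζ).rho) (by positivity)).comp ζ hτ
      refine (hu.sub (hQ.const_mul (√(f (W ξ).S)))).congr_deriv ?_
      rw [h1, hS ζ hζ ξ hξ]
      ring
  -- The entropy and the invariant u - √f Q being constant, u - c is a function of the volume alone.
  have hback : ∀ ξ ∈ I, ∀ η ∈ I, backSpeed f P (W η) = (W ξ).u
      - √(f (W ξ).S) * speedIntegral P (1 / (W ξ).rho)
      + √(f (W ξ).S) * charSpeed P (1 / (W η).rho) := by
    intro ξ hξ η hη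
    rw [hκ ξ hξ η hη, hS ξ hξ η hη, backSpeed, charSpeed]
    ring
  have hcont : ContinuousOn (fun ξ => backSpeed f P (W ξ)) I := fun ζ hζ =>
    ((hc ζ hζ).backSpeed hf h (hρ ζ hζ)).mono_left nhdsWithin_le_nhds
  have hdich : ∀ ξ ∈ I, ξ ∉ B → HasDerivAt (fun η => backSpeed f P (W η)) 0 ξ ∨
      backSpeed f P (W ξ) = ξ := by
    intro ξ hξ hξB
    obtain ⟨τ', u', hτ, hu, h1, h2⟩ := hode ξ hξ hξB
    refine h2.imp_left fun h0 => ?_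
    have hρ' := hρ ξ hξ
    have hR := (h.hasDerivAt_charSpeed (τ := 1 / (W ξ).rho) (by positivity)).comp ξ hτ
    have := (hR.const_mul (√(f (W ξ).S))).const_add
      ((W ξ).u - √(f (W ξ).S) * speedIntegral P (1 / (W ξ).rho))
    rw [h0, mul_zero, mul_zero] at this
    refine this.congr_of_eventuallyEq ?_
    filter_upwards [hIo.mem_nhds hξ] with η hη using hback ξ hξ η hη
  -- The derivative of u - c is continuous. Where it is nonzero it is nonzero nearby, so u - c
  -- coincides with the identity near that point and the derivative is 1. Slopes 0 and 1 give both
  -- monotonicity claims.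
  have hderiv : ∀ ξ ∈ I, ξ ∉ B → HasDerivAt (fun η => backSpeed f P (W η)) 0 ξ ∨
      HasDerivAt (fun η => backSpeed f P (W η)) 1 ξ := by
    intro ξ hξ hξB
    have hρ' := hρ ξ hξ
    have hC1 : ContDiffAt ℝ 1 (fun η => backSpeed f P (W η)) ξ := by
      have hR : ContDiffAt ℝ 1 (charSpeed P) (1 / (W ξ).rho) :=
        h.contDiffOn_charSpeed.contDiffAt (Ioi_mem_nhds (by positivity))
      have := (contDiffAt_const (c := (W ξ).u
        - √(f (W ξ).S) * speedIntegral P (1 / (W ξ).rho))).add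
        ((contDiffAt_const (c := √(f (W ξ).S))).mul
          (hR.comp ξ (hs ξ hξ hξB).contDiffAt_volume))
      refine this.congr_of_eventuallyEq ?_
      filter_upwards [hIo.mem_nhds hξ] with η hη using hback ξ hξ η hη
    by_cases h0 : deriv (fun η => backSpeed f P (W η)) ξ = 0
    · exact Or.inl (h0 ▸ (hC1.differentiableAt (by norm_num)).hasDerivAt)
    · right
      have hne : ∀ᶠ η in 𝓝 ξ, deriv (fun η => backSpeed f P (W η)) η ≠ 0 :=
        ((hC1.continuousAt_fderiv (by norm_num)).clm_apply continuousAt_const).eventually_ne h0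
      refine (hasDerivAt_id ξ).congr_of_eventuallyEq ?_
      filter_upwards [hne, hIo.mem_nhds hξ, eventually_notMem_finset hξB] with η h1 h2 h3
      exact (hdich η h2 h3).resolve_left fun h4 => h1 h4.deriv
  refine ⟨hS, hκ, ?_, ?_, hdich⟩
  · refine monotoneOn_of_deriv_nonneg_off_finset B hI hcont fun ξ hξ hξB => ?_
    rw [hIint] at hξ
    rcases hderiv ξ hξ hξB with h1 | h1
    · exact ⟨0, h1, le_rfl⟩
    · exact ⟨1, h1, zero_le_one⟩
  · refine monotoneOn_of_deriv_nonneg_off_finset B hI (continuousOn_id.sub hcont)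
      fun ξ hξ hξB => ?_
    rw [hIint] at hξ
    rcases hderiv ξ hξ hξB with h1 | h1
    · exact ⟨1 - 0, (hasDerivAt_id ξ).sub h1, by norm_num⟩
    · exact ⟨1 - 1, (hasDerivAt_id ξ).sub h1, by norm_num⟩

theorem state_eq_of_backSpeed_eq (hf : IsEntropyFactor f) (h : IsProfile K P) {U V : GasState}
    (hU : 0 < U.rho) (hV : 0 < V.rho) (hS : U.S = V.S)
    (hκ : U.u - √(f U.S) * speedIntegral P (1 / U.rho)
      = V.u - √(f V.S) * speedIntegral P (1 / V.rho))
    (hb : backSpeed f P U = backSpeed f P V) : U = V := by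
  have hfp := Real.sqrt_pos.2 (hf.pos V.S)
  have hR : charSpeed P (1 / U.rho) = charSpeed P (1 / V.rho) := by
    apply mul_left_cancel₀ hfp.ne'
    simp only [backSpeed, charSpeed, hS] at *
    linear_combination hb - hκ
  have hτ := h.strictMonoOn_charSpeed.injOn (show 0 < 1 / U.rho by positivity)
    (show 0 < 1 / V.rho by positivity) hR
  have hρ : U.rho = V.rho := by simpa using hτ
  refine GasState.ext hρ ?_ hS
  rw [hS, hρ] at hκ
  linarith

/-- A piece of the flow that contains no sonic point is constant. -/
theorem piece_const (hf : IsEntropyFactor f) (h : IsProfile K P) {W : ℝ → GasState}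
    {I : Set ℝ} (hI : I.OrdConnected) (hIo : IsOpen I) {B : Finset ℝ}
    (hs : ∀ ξ ∈ I, ξ ∉ B → IsSmoothAt (productEnergy f K) W ξ)
    (hc : ∀ ξ ∈ I, StateTendsto W (𝓝 ξ) (W ξ)) (hρ : ∀ ξ ∈ I, 0 < (W ξ).rho)
    (hm : ∀ ξ ∈ I, 0 < massFlux ξ (W ξ)) (hne : ∀ ξ ∈ I, backSpeed f P (W ξ) ≠ ξ) {ξ η : ℝ}
    (hξ : ξ ∈ I) (hη : η ∈ I) : W ξ = W η := by
  obtain ⟨h1, h2, -, -, h5⟩ := continuous_piece hf h hI hIo hs hc hρ hm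
  refine state_eq_of_backSpeed_eq hf h (hρ ξ hξ) (hρ η hη) (h1 ξ hξ η hη) (h2 ξ hξ η hη) ?_
  refine eq_of_deriv_zero_off_finset (g := fun ζ => backSpeed f P (W ζ)) B hI
    (fun ζ hζ => ((hc ζ hζ).backSpeed hf h (hρ ζ hζ)).mono_left nhdsWithin_le_nhds)
    (fun ζ hζ hζB => ?_) hξ hη
  rw [hIo.interior_eq] at hζ
  exact (h5 ζ hζ hζB).resolve_right (hne ζ hζ)

/-! ### Flows without vacuum -/

/-- At `ξ` the flow `W` is right continuous with left limit `L ξ`, both states have positive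
density, and they are connected by an admissible discontinuity (or are equal). -/
structure FlowAt (E : ℝ → ℝ → ℝ) (W L : ℝ → GasState) (ξ : ℝ) : Prop where
  rho_pos : 0 < (W ξ).rho
  rho_pos_left : 0 < (L ξ).rho
  right : StateTendsto W (𝓝[>] ξ) (W ξ)
  left : StateTendsto W (𝓝[<] ξ) (L ξ)
  rh : RankineHugoniot E ξ (L ξ) (W ξ)
  entropy : EntropyAdmissible E ξ (L ξ) (W ξ)

/-- On the set `A` the pair `(W, L)` is a flow without vacuum, smooth outside the finite set `B`. -/
structure IsFlowOn (E : ℝ → ℝ → ℝ) (W L : ℝ → GasState) (B : Finset ℝ) (A : Set ℝ) : Prop where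
  flowAt : ∀ ξ ∈ A, FlowAt E W L ξ
  smooth : ∀ ξ ∈ A, ξ ∉ B → IsSmoothAt E W ξ
  eq : ∀ ξ ∈ A, ξ ∉ B → L ξ = W ξ

theorem FlowAt.massFlux_eq {E : ℝ → ℝ → ℝ} {W L : ℝ → GasState} {ξ : ℝ} (hW : FlowAt E W L ξ) :
    massFlux ξ (L ξ) = massFlux ξ (W ξ) := ((rankineHugoniot_iff _ _ _ _).1 hW.rh).1

theorem FlowAt.stateTendsto {E : ℝ → ℝ → ℝ} {W L : ℝ → GasState} {ξ : ℝ} (hW : FlowAt E W L ξ)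
    (heq : L ξ = W ξ) : StateTendsto W (𝓝 ξ) (W ξ) := by
  have h1 := hW.left
  rw [heq] at h1
  have h2 := hW.right
  exact ⟨continuousAt_iff_continuous_left'_right'.2 ⟨h1.1, h2.1⟩,
    continuousAt_iff_continuous_left'_right'.2 ⟨h1.2.1, h2.2.1⟩,
    continuousAt_iff_continuous_left'_right'.2 ⟨h1.2.2, h2.2.2⟩⟩

/-- The first Rankine–Hugoniot condition says precisely that the mass flux does not jump. -/
theorem FlowAt.continuousAt_massFlux {E : ℝ → ℝ → ℝ} {W L : ℝ → GasState} {ξ : ℝ}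
    (hW : FlowAt E W L ξ) : ContinuousAt (fun η => massFlux η (W η)) ξ := by
  refine continuousAt_iff_continuous_left'_right'.2 ⟨?_, hW.right.massFlux⟩
  have := hW.left.massFlux
  rwa [hW.massFlux_eq] at this

/-- The jump relations across a backward shock. -/
theorem shock_relations (h : IsProfile K P) {ξ : ℝ} {Ul Ur : GasState} (hl : 0 < Ul.rho)
    (hr : 0 < Ur.rho) (hRH : RankineHugoniot (productEnergy f K) ξ Ul Ur)
    (hm : 0 < massFlux ξ Ul) (hp : f Ul.S * P (1 / Ul.rho) < f Ur.S * P (1 / Ur.rho)) :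
    1 / Ur.rho < 1 / Ul.rho ∧
    massFlux ξ Ul ^ 2 * (1 / Ul.rho - 1 / Ur.rho)
      = f Ur.S * P (1 / Ur.rho) - f Ul.S * P (1 / Ul.rho) ∧
    Ur.u = Ul.u - massFlux ξ Ul * (1 / Ul.rho - 1 / Ur.rho) ∧
    f Ur.S * K (1 / Ur.rho) - f Ul.S * K (1 / Ul.rho) =
      (f Ur.S * P (1 / Ur.rho) + f Ul.S * P (1 / Ul.rho)) / 2 * (1 / Ul.rho - 1 / Ur.rho) := by
  obtain ⟨h1, h2, h3⟩ := (rankineHugoniot_iff _ _ _ _).1 hRH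
  rw [pHat_productEnergy h hl, pHat_productEnergy h hr, ← h1] at h2 h3
  have hul : Ul.u = ξ + massFlux ξ Ul * (1 / Ul.rho) := by
    rw [massFlux]; field_simp; ring
  have hur : Ur.u = ξ + massFlux ξ Ul * (1 / Ur.rho) := by
    rw [h1, massFlux]; field_simp; ring
  set m := massFlux ξ Ul
  set a := 1 / Ul.rho
  set b := 1 / Ur.rho
  simp only [productEnergy] at h3
  have hd : m ^ 2 * (a - b) = f Ur.S * P b - f Ul.S * P a := by
    rw [hul, hur] at h2; linear_combination h2
  refine ⟨?_, hd, by rw [hul, hur]; ring, ?_⟩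
  · have : 0 < m ^ 2 * (a - b) := by rw [hd]; linarith
    have := pos_of_mul_pos_right this (by positivity)
    linarith
  · apply mul_left_cancel₀ hm.ne'
    rw [hul, hur] at h3
    linear_combination -h3 + (1 / 2) * (2 * ξ + m * (a + b)) * hd

/-- By the jump relations m² is the ratio of the pressure rise to the loss of volume. `lax` places
it between the squared Lagrangian sound speeds ahead and behind, and `sub_backSpeed_eq` turns this
into speeds. -/
theorem shock_lax (hf : IsEntropyFactor f) (h : IsProfile K P) {ξ : ℝ} {Ul Ur : GasState}
    (hl : 0 < Ul.rho) (hr : 0 < Ur.rho) (hRH : RankineHugoniot (productEnergy f K) ξ Ul Ur)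
    (hm : 0 < massFlux ξ Ul) (hp : f Ul.S * P (1 / Ul.rho) < f Ur.S * P (1 / Ur.rho)) :
    ξ < backSpeed f P Ul ∧ backSpeed f P Ur < ξ := by
  obtain ⟨h1, h2, -, h4⟩ := shock_relations h hl hr hRH hm hp
  have hmr := ((rankineHugoniot_iff _ _ _ _).1 hRH).1
  have hfl := hf.pos Ul.S
  have hfr := hf.pos Ur.S
  have ha : 0 < 1 / Ul.rho := by positivity
  have hb : 0 < 1 / Ur.rho := by positivity
  obtain ⟨l1, l2⟩ := h.lax hb h1 hfr hfl h4
  have el := sub_backSpeed_eq (f := f) (P := P) hl ξ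
  have er := sub_backSpeed_eq (f := f) (P := P) hr ξ
  rw [← hmr] at er
  have hv : 0 < 1 / Ul.rho - 1 / Ur.rho := by linarith
  rw [← h2] at l1 l2
  have ql := h.speed_pos ha
  have qr := h.speed_pos hb
  have b1 : √(f Ul.S) * speed P (1 / Ul.rho) < massFlux ξ Ul := by
    refine lt_of_pow_lt_pow_left₀ 2 hm.le ?_
    rw [mul_pow, Real.sq_sqrt hfl.le, h.speed_sq ha]
    exact lt_of_mul_lt_mul_right l1 hv.le
  have b2 : massFlux ξ Ul < √(f Ur.S) * speed P (1 / Ur.rho) := by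
    refine lt_of_pow_lt_pow_left₀ 2 (by positivity) ?_
    rw [mul_pow, Real.sq_sqrt hfr.le, h.speed_sq hb]
    exact lt_of_mul_lt_mul_right l2 hv.le
  constructor
  · have := mul_neg_of_pos_of_neg ha (sub_neg.2 b1)
    linarith
  · have := mul_pos hb (sub_pos.2 b2)
    linarith

theorem FlowAt.pressure_lt (h : IsProfile K P) {W L : ℝ → GasState} {ξ : ℝ}
    (hW : FlowAt (productEnergy f K) W L ξ) (hm : 0 < massFlux ξ (W ξ)) (hne : L ξ ≠ W ξ) :
    f (L ξ).S * P (1 / (L ξ).rho) < f (W ξ).S * P (1 / (W ξ).rho) := by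
  have := (hW.entropy hne).1 (by have := hW.massFlux_eq; rw [massFlux] at this; rwa [this])
  rwa [pHat_productEnergy h hW.rho_pos, pHat_productEnergy h hW.rho_pos_left] at this

theorem FlowAt.lax (hf : IsEntropyFactor f) (h : IsProfile K P) {W L : ℝ → GasState} {ξ : ℝ}
    (hW : FlowAt (productEnergy f K) W L ξ) (hm : 0 < massFlux ξ (W ξ)) (hne : L ξ ≠ W ξ) :
    ξ < backSpeed f P (L ξ) ∧ backSpeed f P (W ξ) < ξ :=
  shock_lax hf h hW.rho_pos_left hW.rho_pos hW.rh (by rwa [hW.massFlux_eq])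
    (hW.pressure_lt h hm hne)

section Jumps

variable {W L : ℝ → GasState} {B : Finset ℝ} {A : Set ℝ}

/-- Lax's condition makes ξ - (u - c) positive just behind the shock, and it is nondecreasing. No
sonic point follows, hence no rarefaction. -/
theorem const_after_jump (hf : IsEntropyFactor f) (h : IsProfile K P)
    (hW : IsFlowOn (productEnergy f K) W L B A) {s b : ℝ} (hA : Ico s b ⊆ A)
    (hm : ∀ ξ ∈ Ico s b, 0 < massFlux ξ (W ξ)) (hs : L s ≠ W s)
    (hno : ∀ ξ ∈ Ioo s b, L ξ = W ξ) :
    ∀ ξ ∈ Ioo s b, W ξ = W s := by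
  intro ξ hξ
  have hsA : s ∈ Ico s b := ⟨le_rfl, hξ.1.trans hξ.2⟩
  have hsub : Ioo s b ⊆ Ico s b := Ioo_subset_Ico_self
  have hF := hW.flowAt s (hA hsA)
  have e1 : ∀ ξ ∈ Ioo s b, ξ ∉ B → IsSmoothAt (productEnergy f K) W ξ :=
    fun η hη => hW.smooth η (hA (hsub hη))
  have e2 : ∀ ξ ∈ Ioo s b, StateTendsto W (𝓝 ξ) (W ξ) :=
    fun η hη => (hW.flowAt η (hA (hsub hη))).stateTendsto (hno η hη)
  have e3 : ∀ ξ ∈ Ioo s b, 0 < (W ξ).rho := fun η hη => (hW.flowAt η (hA (hsub hη))).rho_pos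
  have e4 : ∀ ξ ∈ Ioo s b, 0 < massFlux ξ (W ξ) := fun η hη => hm η (hsub hη)
  obtain ⟨-, -, -, hz, -⟩ := continuous_piece hf h ordConnected_Ioo isOpen_Ioo e1 e2 e3 e4
  have hlim : Tendsto (fun η => η - backSpeed f P (W η)) (𝓝[>] s) (𝓝 (s - backSpeed f P (W s))) :=
    (tendsto_id.mono_left nhdsWithin_le_nhds).sub (hF.right.backSpeed hf h hF.rho_pos)
  have hev := hlim.eventually_const_lt (sub_pos.2 (hF.lax hf h (hm s hsA) hs).2)
  have hpos : ∀ ζ ∈ Ioo s b, 0 < ζ - backSpeed f P (W ζ) := by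
    intro ζ hζ
    obtain ⟨η, h1, h2⟩ := (hev.and (Ioo_mem_nhdsGT hζ.1)).exists
    exact h1.trans_le (hz ⟨h2.1, h2.2.trans hζ.2⟩ hζ h2.2.le)
  have hconst : ∀ η ∈ Ioo s b, W η = W ξ := fun η hη =>
    piece_const hf h ordConnected_Ioo isOpen_Ioo e1 e2 e3 e4
      (fun ζ hζ => by have := hpos ζ hζ; linarith) hη hξ
  have : StateTendsto W (𝓝[>] s) (W ξ) := .of_eventually_eq (by
    filter_upwards [Ioo_mem_nhdsGT (hξ.1.trans hξ.2)] with η hη using hconst η hη)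
  exact this.unique hF.right

/-- Just ahead of the shock ξ - (u - c) is negative, and by monotonicity it is negative all the way
to -∞. -/
theorem const_before_jump (hf : IsEntropyFactor f) (h : IsProfile K P)
    (hW : IsFlowOn (productEnergy f K) W L B A) {s : ℝ} (hA : Iic s ⊆ A)
    (hm : ∀ ξ ∈ Iic s, 0 < massFlux ξ (W ξ)) (hs : L s ≠ W s)
    (hno : ∀ ξ ∈ Iio s, L ξ = W ξ) {Ul : GasState} (hl : StateTendsto W atBot Ul) :
    ∀ ξ ∈ Iio s, W ξ = Ul := by
  intro ξ hξ
  have hsA : s ∈ Iic s := self_mem_Iic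
  have hsub : Iio s ⊆ Iic s := Iio_subset_Iic_self
  have hF := hW.flowAt s (hA hsA)
  have e1 : ∀ ξ ∈ Iio s, ξ ∉ B → IsSmoothAt (productEnergy f K) W ξ :=
    fun η hη => hW.smooth η (hA (hsub hη))
  have e2 : ∀ ξ ∈ Iio s, StateTendsto W (𝓝 ξ) (W ξ) :=
    fun η hη => (hW.flowAt η (hA (hsub hη))).stateTendsto (hno η hη)
  have e3 : ∀ ξ ∈ Iio s, 0 < (W ξ).rho := fun η hη => (hW.flowAt η (hA (hsub hη))).rho_pos
  have e4 : ∀ ξ ∈ Iio s, 0 < massFlux ξ (W ξ) := fun η hη => hm η (hsub hη)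
  obtain ⟨-, -, -, hz, -⟩ := continuous_piece hf h ordConnected_Iio isOpen_Iio e1 e2 e3 e4
  have hlim : Tendsto (fun η => η - backSpeed f P (W η)) (𝓝[<] s) (𝓝 (s - backSpeed f P (L s))) :=
    (tendsto_id.mono_left nhdsWithin_le_nhds).sub (hF.left.backSpeed hf h hF.rho_pos_left)
  have hev := hlim.eventually_lt_const (sub_neg.2 (hF.lax hf h (hm s hsA) hs).1)
  have hneg : ∀ ζ ∈ Iio s, ζ - backSpeed f P (W ζ) < 0 := by
    intro ζ hζ
    obtain ⟨η, h1, h2⟩ := (hev.and (Ioo_mem_nhdsLT hζ)).exists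
    exact (hz hζ h2.2 h2.1.le).trans_lt h1
  have hconst : ∀ η ∈ Iio s, W η = W ξ := fun η hη =>
    piece_const hf h ordConnected_Iio isOpen_Iio e1 e2 e3 e4
      (fun ζ hζ => by have := hneg ζ hζ; linarith) hη hξ
  have : StateTendsto W atBot (W ξ) := .of_eventually_eq (by
    filter_upwards [Iio_mem_atBot s] with η hη using hconst η hη)
  exact this.unique hl

/-- There is at most one backward shock. -/
theorem jump_unique (hf : IsEntropyFactor f) (h : IsProfile K P)
    (hW : IsFlowOn (productEnergy f K) W L B A) {s t : ℝ} (hA : Icc s t ⊆ A)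
    (hm : ∀ ξ ∈ Icc s t, 0 < massFlux ξ (W ξ)) (hs : L s ≠ W s) (ht : L t ≠ W t) :
    ¬ s < t := by
  intro hst
  classical
  -- Let r be the first jump after s. The flow is constant between them, so Lax's condition puts the
  -- same characteristic speed below s and above r.
  set J := B.filter fun ξ => s < ξ ∧ ξ ≤ t ∧ L ξ ≠ W ξ with hJ
  have hJmem : ∀ ξ ∈ Icc s t, s < ξ → L ξ ≠ W ξ → ξ ∈ J := fun ξ hξ hsξ hne =>
    Finset.mem_filter.2 ⟨by_contra fun hB => hne (hW.eq ξ (hA hξ) hB), hsξ, hξ.2, hne⟩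
  have hJne : J.Nonempty := ⟨t, hJmem t ⟨hst.le, le_rfl⟩ hst ht⟩
  obtain ⟨-, h1, h2, h3⟩ := Finset.mem_filter.1 (J.min'_mem hJne)
  set r := J.min' hJne with hr
  have hsub : Icc s r ⊆ Icc s t := Icc_subset_Icc_right h2
  have hrr : r ∈ Icc s r := ⟨h1.le, le_rfl⟩
  have hF := hW.flowAt r (hA (hsub hrr))
  have hconst := const_after_jump hf h hW (s := s) (b := r)
    (Ico_subset_Icc_self.trans (hsub.trans hA))
    (fun ξ hξ => hm ξ (hsub (Ico_subset_Icc_self hξ))) hs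
    (fun ξ hξ => by_contra fun hne => not_lt.2
      (J.min'_le ξ (hJmem ξ (hsub (Ioo_subset_Icc_self hξ)) hξ.1 hne)) hξ.2)
  have hL : L r = W s := hF.left.unique (.of_eventually_eq (by
    filter_upwards [Ioo_mem_nhdsLT h1] with η hη using hconst η hη))
  have l1 := (hF.lax hf h (hm r (hsub hrr)) h3).1
  have hs' : s ∈ Icc s t := ⟨le_rfl, hst.le⟩
  have l2 := ((hW.flowAt s (hA hs')).lax hf h (hm s hs') hs).2
  rw [hL] at l1
  linarith

end Jumps

/-! ### The backward wave fan -/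

/-- The speed of the backward shock of pressure `p`. -/
def shockSpeed (f K P : ℝ → ℝ) (U : GasState) (p : ℝ) : ℝ :=
  U.u - 1 / U.rho * √((p - f U.S * P (1 / U.rho)) /
    (1 / U.rho - shockVolume K P (1 / U.rho) (f U.S * P (1 / U.rho)) p))

/-- The state behind the backward shock of pressure `p`. -/
def shockState (f K P : ℝ → ℝ) (U : GasState) (p : ℝ) : GasState where
  rho := 1 / shockVolume K P (1 / U.rho) (f U.S * P (1 / U.rho)) p
  u := U.u - velocityDrop K P (1 / U.rho) (f U.S) p
  S := Function.invFun f (p / P (shockVolume K P (1 / U.rho) (f U.S * P (1 / U.rho)) p))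

/-- The state of specific volume `τ` on the backward simple wave through `U`. -/
def simpleState (f P : ℝ → ℝ) (U : GasState) (τ : ℝ) : GasState where
  rho := 1 / τ
  u := U.u + √(f U.S) * (speedIntegral P τ - speedIntegral P (1 / U.rho))
  S := U.S

/-- The specific volume at which the backward simple wave through `U` has characteristic speed
`y`. -/
def simpleVolume (f P : ℝ → ℝ) (U : GasState) (y : ℝ) : ℝ :=
  Function.invFunOn (charSpeed P) (Ioi 0)
    ((y - U.u) / √(f U.S) + speedIntegral P (1 / U.rho))

open Classical in
/-- The state behind the backward wave of pressure `p`. -/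
def postState (f K P : ℝ → ℝ) (U : GasState) (p : ℝ) : GasState :=
  if f U.S * P (1 / U.rho) < p then shockState f K P U p
  else simpleState f P U (rarefactionVolume P (f U.S) p)

open Classical in
/-- The backward wave of pressure `p`. -/
def waveFan (f K P : ℝ → ℝ) (U : GasState) (p ξ : ℝ) : GasState :=
  if f U.S * P (1 / U.rho) < p then
    if ξ < shockSpeed f K P U p then U else shockState f K P U p
  else simpleState f P U (simpleVolume f P U
    (max (backSpeed f P U) (min ξ (backSpeed f P (postState f K P U p)))))

theorem IsEntropyFactor.strictMono (hf : IsEntropyFactor f) : StrictMono f :=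
  strictMono_of_deriv_pos hf.deriv_pos

theorem IsEntropyFactor.exists_eq (hf : IsEntropyFactor f) {y : ℝ} (hy : 0 < y) :
    ∃ S, f S = y := by
  obtain ⟨a, ha⟩ := (hf.tendsto_atBot.eventually_lt_const hy).exists
  obtain ⟨b, hb⟩ := (hf.tendsto_atTop.eventually_ge_atTop y).exists
  exact mem_range_of_exists_le_of_exists_ge hf.smooth.continuous ⟨a, ha.le⟩ ⟨b, hb⟩

theorem backSpeed_simpleState {U : GasState} {τ : ℝ} :
    backSpeed f P (simpleState f P U τ) = U.u - √(f U.S) * speedIntegral P (1 / U.rho)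
      + √(f U.S) * charSpeed P τ := by
  simp only [backSpeed, simpleState, charSpeed, one_div_one_div]
  ring

theorem simpleState_self (U : GasState) : simpleState f P U (1 / U.rho) = U := by
  ext <;> simp [simpleState]

theorem simpleVolume_backSpeed (hf : IsEntropyFactor f) (h : IsProfile K P) {U : GasState}
    {τ : ℝ} (hτ : 0 < τ) :
    simpleVolume f P U (backSpeed f P (simpleState f P U τ)) = τ := by
  have hs := Real.sqrt_pos.2 (hf.pos U.S)
  have : (backSpeed f P (simpleState f P U τ) - U.u) / √(f U.S) + speedIntegral P (1 / U.rho)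
      = charSpeed P τ := by
    rw [backSpeed_simpleState]; field_simp; ring
  rw [simpleVolume, this]
  exact h.strictMonoOn_charSpeed.injOn.leftInvOn_invFunOn hτ

theorem postState_u {U : GasState} {p : ℝ} :
    (postState f K P U p).u = U.u - velocityDrop K P (1 / U.rho) (f U.S) p := by
  rw [postState]
  split_ifs with hp
  · rfl
  · rw [IsProfile.velocityDrop_of_le (not_lt.1 hp)]
    simp [simpleState]

/-- A monotone function `y` that is at each point either stationary or equal to its argument is the
argument cut off at the limits of `y`. -/
theorem eq_clamp {y : ℝ → ℝ} {b yl yr : ℝ} {B : Finset ℝ} (hc : ContinuousOn y (Iio b))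
    (hy : MonotoneOn y (Iio b)) (hz : MonotoneOn (fun ξ => ξ - y ξ) (Iio b))
    (hd : ∀ ξ ∈ Iio b, ξ ∉ B → HasDerivAt y 0 ξ ∨ y ξ = ξ) (hl : Tendsto y atBot (𝓝 yl))
    (hr : Tendsto y (𝓝[<] b) (𝓝 yr)) {ξ : ℝ} (hξ : ξ < b) :
    y ξ = max yl (min ξ yr) ∧ yl ≤ yr := by
  have h1 : yl ≤ y ξ := by
    refine le_of_tendsto hl ?_
    filter_upwards [Iic_mem_atBot ξ] with η hη
    exact hy (lt_of_le_of_lt hη hξ) hξ hη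
  have h2 : y ξ ≤ yr := by
    refine ge_of_tendsto hr ?_
    filter_upwards [Ioo_mem_nhdsLT hξ] with η hη
    exact hy hξ hη.2 hη.1.le
  refine ⟨?_, h1.trans h2⟩
  -- Since ξ - y(ξ) is nondecreasing, y < ξ persists to the right and forces y to be constant there,
  -- equal to yr; y > ξ persists to the left and gives yl.
  rcases lt_trichotomy (y ξ) ξ with hlt | heq | hlt
  · have hconst : ∀ η ∈ Ico ξ b, y η = y ξ := fun η hη =>
      eq_of_deriv_zero_off_finset B ordConnected_Ico (hc.mono Ico_subset_Iio_self)
        (fun ζ hζ hζB => by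
          rw [interior_Ico] at hζ
          have := hz hξ hζ.2 hζ.1.le
          simp only at this
          exact (hd ζ hζ.2 hζB).resolve_right (by linarith)) hη ⟨le_rfl, hξ⟩
    have : yr = y ξ := tendsto_nhds_unique hr (tendsto_const_nhds.congr' (by
      filter_upwards [Ioo_mem_nhdsLT hξ] with η hη using (hconst η (Ioo_subset_Ico_self hη)).symm))
    rw [this, min_eq_right hlt.le, max_eq_right h1]
  · rw [min_eq_left (by linarith), max_eq_right (by linarith), heq]
  · have hconst : ∀ η ∈ Iic ξ, y η = y ξ := fun η hη =>
      eq_of_deriv_zero_off_finset B ordConnected_Iic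
        (hc.mono (Iic_subset_Iio.2 hξ))
        (fun ζ hζ hζB => by
          rw [interior_Iic] at hζ
          have hζ' : ζ < ξ := hζ
          have := hz (hζ'.trans hξ) hξ hζ'.le
          simp only at this
          exact (hd ζ (hζ'.trans hξ) hζB).resolve_right (by linarith)) hη self_mem_Iic
    have : yl = y ξ := tendsto_nhds_unique hl (tendsto_const_nhds.congr' (by
      filter_upwards [Iic_mem_atBot ξ] with η hη using (hconst η hη).symm))
    rw [max_eq_left, this]
    exact (min_le_left _ _).trans (by linarith)

/-- To the left of the contact, a flow is a backward wave. -/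
theorem eq_waveFan (hf : IsEntropyFactor f) (h : IsProfile K P) {W L : ℝ → GasState}
    {B : Finset ℝ} (hW : IsFlowOn (productEnergy f K) W L B univ) {b : ℝ}
    (hm : ∀ ξ < b, 0 < massFlux ξ (W ξ)) {Ul : GasState} (hUl : 0 < Ul.rho)
    (hl : StateTendsto W atBot Ul) {p : ℝ} (hp : p = f (L b).S * P (1 / (L b).rho)) :
    L b = postState f K P Ul p ∧ ∀ ξ < b, W ξ = waveFan f K P Ul p ξ := by
  have hFb := hW.flowAt b (mem_univ _)
  have hrb := hFb.rho_pos_left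
  have hinj : Function.Injective f := hf.strictMono.injective
  -- With a jump the flow is constant on both sides of it and is a shock. Without one it is a
  -- rarefaction, possibly trivial, described by `eq_clamp`.
  by_cases hjump : ∃ s < b, L s ≠ W s
  · obtain ⟨s, hsb, hs⟩ := hjump
    have hno : ∀ ξ < b, ξ ≠ s → L ξ = W ξ := by
      intro ξ hξ hne
      by_contra hcon
      rcases lt_or_gt_of_ne hne with hlt | hlt
      · exact jump_unique hf h hW (subset_univ _)
          (fun η hη => hm η (hη.2.trans_lt hsb)) hcon hs hlt
      · exact jump_unique hf h hW (subset_univ _)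
          (fun η hη => hm η (hη.2.trans_lt hξ)) hs hcon hlt
    have hafter := const_after_jump hf h hW (subset_univ _)
      (fun ξ (hξ : ξ ∈ Ico s b) => hm ξ hξ.2) hs (fun ξ hξ => hno ξ hξ.2 hξ.1.ne')
    have hbefore := const_before_jump hf h hW (subset_univ _)
      (fun ξ (hξ : ξ ∈ Iic s) => hm ξ (lt_of_le_of_lt hξ hsb)) hs
      (fun ξ hξ => hno ξ (lt_trans hξ hsb) (ne_of_lt hξ)) hl
    have hLb : L b = W s := hFb.left.unique (.of_eventually_eq (by
      filter_upwards [Ioo_mem_nhdsLT hsb] with η hη using hafter η hη))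
    have hF := hW.flowAt s (mem_univ _)
    have hLs : L s = Ul := hF.left.unique (.of_eventually_eq (by
      filter_upwards [self_mem_nhdsWithin] with η hη using hbefore η hη))
    have hplt := hF.pressure_lt h (hm s hsb) hs
    have hms : 0 < massFlux s (L s) := by rw [hF.massFlux_eq]; exact hm s hsb
    obtain ⟨r1, r2, r3, r4⟩ := shock_relations h hF.rho_pos_left hF.rho_pos hF.rh hms hplt
    rw [hLs] at hplt r1 r2 r3 r4 hms
    rw [hLb] at hp
    rw [← hp] at hplt r2 r4
    have hrs := hF.rho_pos
    have hτ : 0 < 1 / (W s).rho := by positivity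
    have hτl : 0 < 1 / Ul.rho := by positivity
    have hPl := h.P_pos _ hτl
    have hPs := h.P_pos _ hτ
    have hfl := hf.pos Ul.S
    have hp0 : 0 < p := lt_trans (by positivity) hplt
    have hug : hugoniot K P (1 / Ul.rho) (f Ul.S * P (1 / Ul.rho)) (1 / (W s).rho) p = 0 := by
      have e1 : p * (K (1 / (W s).rho) / P (1 / (W s).rho)) = f (W s).S * K (1 / (W s).rho) := by
        rw [hp, mul_div_assoc', div_eq_iff hPs.ne']; ring
      have e2 : f Ul.S * P (1 / Ul.rho) * (K (1 / Ul.rho) / P (1 / Ul.rho))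
          = f Ul.S * K (1 / Ul.rho) := by
        rw [mul_div_assoc', div_eq_iff hPl.ne']; ring
      rw [hugoniot, e1, e2, r4]; ring
    have hvol := h.shockVolume_eq (mul_pos hfl hPl) hp0 hτ hug
    have hv : 0 < 1 / Ul.rho - 1 / (W s).rho := by linarith
    have hdrop : velocityDrop K P (1 / Ul.rho) (f Ul.S) p
        = massFlux s Ul * (1 / Ul.rho - 1 / (W s).rho) := by
      rw [h.velocityDrop_of_ge hτl hfl hplt.le, hvol, ← r2]
      rw [Real.sqrt_eq_iff_mul_self_eq (by positivity) (by positivity)]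
      ring
    have hstate : W s = shockState f K P Ul p := by
      refine GasState.ext ?_ ?_ ?_
      · simp only [shockState, hvol, one_div_one_div]
      · simp only [shockState, hdrop, r3]
      · simp only [shockState, hvol]
        rw [hp, mul_div_cancel_right₀ _ hPs.ne', Function.leftInverse_invFun hinj]
    have hspeed : s = shockSpeed f K P Ul p := by
      rw [shockSpeed, hvol, ← r2, mul_div_cancel_right₀ _ hv.ne', Real.sqrt_sq hms.le, massFlux]
      field_simp
      ring
    refine ⟨?_, fun ξ hξ => ?_⟩
    · rw [hLb, postState, if_pos hplt, hstate]
    · rw [waveFan, if_pos hplt, ← hspeed, ← hstate]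
      split_ifs with hlt
      · exact hbefore ξ hlt
      · rcases (not_lt.1 hlt).eq_or_lt with heq | hgt
        · rw [heq]
        · exact hafter ξ ⟨hgt, hξ⟩
  · push Not at hjump
    have e2 : ∀ ξ ∈ Iio b, StateTendsto W (𝓝 ξ) (W ξ) :=
      fun η hη => (hW.flowAt η (mem_univ _)).stateTendsto (hjump η hη)
    have e3 : ∀ ξ ∈ Iio b, 0 < (W ξ).rho := fun η hη => (hW.flowAt η (mem_univ _)).rho_pos
    obtain ⟨hS, hκ, hy, hz, hd⟩ := continuous_piece hf h ordConnected_Iio isOpen_Iio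
      (fun ξ _ => hW.smooth ξ (mem_univ _)) e2 e3 (fun ξ hξ => hm ξ hξ)
    have hyl := hl.backSpeed hf h hUl
    have hyr := hFb.left.backSpeed hf h hrb
    have hSl : ∀ ξ < b, (W ξ).S = Ul.S := fun ξ hξ =>
      tendsto_nhds_unique (tendsto_const_nhds.congr' (by
        filter_upwards [Iio_mem_atBot b] with η hη using hS ξ hξ η hη)) hl.2.2
    have hκlim : ∀ {l : Filter ℝ} {U : GasState}, 0 < U.rho → StateTendsto W l U →
        Tendsto (fun η => (W η).u - √(f (W η).S) * speedIntegral P (1 / (W η).rho)) l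
          (𝓝 (U.u - √(f U.S) * speedIntegral P (1 / U.rho))) := fun hU ht =>
      ht.2.1.sub ((((hf.smooth.continuous.tendsto _).comp ht.2.2).sqrt).mul
        (ht.speedIntegral h hU))
    have hκl : ∀ ξ < b, (W ξ).u - √(f (W ξ).S) * speedIntegral P (1 / (W ξ).rho)
        = Ul.u - √(f Ul.S) * speedIntegral P (1 / Ul.rho) := fun ξ hξ =>
      tendsto_nhds_unique (tendsto_const_nhds.congr' (by
        filter_upwards [Iio_mem_atBot b] with η hη using hκ ξ hξ η hη)) (hκlim hUl hl)
    have hSb : (L b).S = Ul.S := tendsto_nhds_unique hFb.left.2.2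
      (tendsto_const_nhds.congr' (by
        filter_upwards [self_mem_nhdsWithin] with η hη using (hSl η hη).symm))
    have hκb : (L b).u - √(f (L b).S) * speedIntegral P (1 / (L b).rho)
        = Ul.u - √(f Ul.S) * speedIntegral P (1 / Ul.rho) :=
      tendsto_nhds_unique (hκlim hrb hFb.left) (tendsto_const_nhds.congr' (by
        filter_upwards [self_mem_nhdsWithin] with η hη using (hκl η hη).symm))
    have hsimple : ∀ {V : GasState}, V.S = Ul.S →
        V.u - √(f V.S) * speedIntegral P (1 / V.rho)
          = Ul.u - √(f Ul.S) * speedIntegral P (1 / Ul.rho) →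
        V = simpleState f P Ul (1 / V.rho) := by
      intro V h1 h2
      refine GasState.ext (by simp [simpleState]) ?_ h1
      simp only [simpleState]
      rw [h1] at h2
      linarith
    have hLb := hsimple hSb hκb
    have hclamp : ∀ ξ < b, _ := fun ξ hξ => eq_clamp (fun ζ hζ => ((e2 ζ hζ).backSpeed hf h
      (e3 ζ hζ)).mono_left nhdsWithin_le_nhds) hy hz hd hyl hyr hξ
    -- Any point left of b serves; only yl ≤ yr is wanted. As u - c increases with the volume, the
    -- gas expands and p falls on the rarefaction branch.
    have hle := (hclamp (b - 1) (by linarith)).2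
    have hτb : 0 < 1 / (L b).rho := by positivity
    have hτl : 0 < 1 / Ul.rho := by positivity
    have hfl := hf.pos Ul.S
    have hτle : 1 / Ul.rho ≤ 1 / (L b).rho := by
      rw [hLb] at hle
      nth_rewrite 1 [← simpleState_self (f := f) (P := P) Ul] at hle
      rw [backSpeed_simpleState, backSpeed_simpleState] at hle
      refine (h.strictMonoOn_charSpeed.le_iff_le hτl hτb).1 ?_
      exact le_of_mul_le_mul_left (by linarith) (Real.sqrt_pos.2 hfl)
    have hple : ¬ f Ul.S * P (1 / Ul.rho) < p := by
      rw [not_lt, hp, hSb]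
      exact mul_le_mul_of_nonneg_left (h.strictAntiOn.antitoneOn hτl hτb hτle) hfl.le
    have hpost : L b = postState f K P Ul p := by
      rw [postState, if_neg hple, h.rarefactionVolume_eq hfl hτb (by rw [hp, hSb])]
      exact hLb
    refine ⟨hpost, fun ξ hξ => ?_⟩
    rw [waveFan, if_neg hple, ← hpost, ← (hclamp ξ hξ).1]
    have hWξ := hsimple (hSl ξ hξ) (hκl ξ hξ)
    have hρξ := e3 ξ hξ
    have hvol : simpleVolume f P Ul (backSpeed f P (W ξ)) = 1 / (W ξ).rho := by
      conv_lhs => rw [hWξ]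
      exact simpleVolume_backSpeed hf h (by positivity)
    rw [hvol]
    exact hWξ

/-! ### Reflection in space -/

theorem isSmoothAt_of_derivs (hf : IsEntropyFactor f) (h : IsProfile K P) {W : ℝ → GasState}
    {ξ τ' u' S' : ℝ} (hρ : 0 < (W ξ).rho) (c1 : ContDiffAt ℝ 1 (fun η => (W η).rho) ξ)
    (c2 : ContDiffAt ℝ 1 (fun η => (W η).u) ξ) (c3 : ContDiffAt ℝ 1 (fun η => (W η).S) ξ)
    (hτ : HasDerivAt (fun η => 1 / (W η).rho) τ' ξ)
    (hu : HasDerivAt (fun η => (W η).u) u' ξ) (hS : HasDerivAt (fun η => (W η).S) S' ξ)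
    (h1 : u' = massFlux ξ (W ξ) * τ')
    (h2 : massFlux ξ (W ξ) * u' + (deriv f (W ξ).S * S' * P (1 / (W ξ).rho)
        + f (W ξ).S * (deriv P (1 / (W ξ).rho) * τ')) = 0)
    (h3 : massFlux ξ (W ξ) * S' = 0) : IsSmoothAt (productEnergy f K) W ξ :=
  ⟨hρ, c1, c2, c3, (eulerAt_iff hf h hρ hτ hu hS).2 ⟨h1, h2, h3⟩⟩

theorem IsSmoothAt.congr (hf : IsEntropyFactor f) (h : IsProfile K P) {W V : ℝ → GasState}
    {ξ : ℝ} (hW : IsSmoothAt (productEnergy f K) W ξ) (hV : V =ᶠ[𝓝 ξ] W) :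
    IsSmoothAt (productEnergy f K) V ξ := by
  obtain ⟨τ', u', S', d1, d2, d3, h1, h2, h3⟩ := hW.exists_derivs hf h
  have he := hV.eq_of_nhds
  refine isSmoothAt_of_derivs hf h (τ' := τ') (u' := u') (S' := S') (by rw [he]; exact hW.1)
    (hW.2.1.congr_of_eventuallyEq ?_) (hW.2.2.1.congr_of_eventuallyEq ?_)
    (hW.2.2.2.1.congr_of_eventuallyEq ?_) (d1.congr_of_eventuallyEq ?_)
    (d2.congr_of_eventuallyEq ?_) (d3.congr_of_eventuallyEq ?_) (by rw [he]; exact h1)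
    (by rw [he]; exact h2) (by rw [he]; exact h3) <;>
  · filter_upwards [hV] with η hη
    rw [hη]

/-- The mirror image of a state. -/
def reflect (U : GasState) : GasState := ⟨U.rho, -U.u, U.S⟩

/-- The mirror image of a flow. -/
def reflectFlow (W : ℝ → GasState) (ξ : ℝ) : GasState := reflect (W (-ξ))

theorem reflect_reflect (U : GasState) : reflect (reflect U) = U := by
  simp [reflect]

theorem massFlux_reflect (ξ : ℝ) (U : GasState) :
    massFlux ξ (reflect U) = -massFlux (-ξ) U := by
  simp only [massFlux, reflect]; ring

theorem StateTendsto.reflect {W : ℝ → GasState} {l l' : Filter ℝ} {U : GasState}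
    (hW : StateTendsto W l U) (hl : Tendsto Neg.neg l' l) :
    StateTendsto (reflectFlow W) l' (reflect U) :=
  ⟨hW.1.comp hl, (hW.2.1.comp hl).neg, hW.2.2.comp hl⟩

theorem RankineHugoniot.reflect {E : ℝ → ℝ → ℝ} {ξ : ℝ} {Ul Ur : GasState}
    (h : RankineHugoniot E (-ξ) Ul Ur) : RankineHugoniot E ξ (reflect Ur) (reflect Ul) := by
  rw [rankineHugoniot_iff] at h ⊢
  obtain ⟨h1, h2, h3⟩ := h
  simp only [massFlux, GasDynamics.reflect] at *
  exact ⟨by linear_combination h1, by linear_combination -h2, by linear_combination h3⟩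

theorem EntropyAdmissible.reflect {E : ℝ → ℝ → ℝ} {ξ : ℝ} {Ul Ur : GasState}
    (h : EntropyAdmissible E (-ξ) Ul Ur) : EntropyAdmissible E ξ (reflect Ur) (reflect Ul) := by
  intro hne
  have h' := h fun e => hne (by rw [e])
  simp only [GasDynamics.reflect]
  exact ⟨fun h1 => h'.2 (by linarith), fun h1 => h'.1 (by linarith)⟩

theorem IsSmoothAt.reflect (hf : IsEntropyFactor f) (h : IsProfile K P) {W : ℝ → GasState}
    {ξ : ℝ} (hW : IsSmoothAt (productEnergy f K) W (-ξ)) :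
    IsSmoothAt (productEnergy f K) (reflectFlow W) ξ := by
  obtain ⟨τ', u', S', d1, d2, d3, h1, h2, h3⟩ := hW.exists_derivs hf h
  have cn : ContDiffAt ℝ 1 (fun η : ℝ => -η) ξ := contDiffAt_id.neg
  have dn := hasDerivAt_neg ξ
  have hm : massFlux ξ (reflectFlow W ξ) = -massFlux (-ξ) (W (-ξ)) := massFlux_reflect _ _
  refine isSmoothAt_of_derivs hf h (τ' := -τ') (u' := u') (S' := -S') hW.1
    (hW.2.1.comp ξ cn) (hW.2.2.1.comp ξ cn).neg (hW.2.2.2.1.comp ξ cn) ?_ ?_ ?_ ?_ ?_ ?_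
  · exact (d1.comp ξ dn).congr_deriv (by ring)
  · exact (d2.comp ξ dn).neg.congr_deriv (by ring)
  · exact (d3.comp ξ dn).congr_deriv (by ring)
  · rw [hm, h1]; ring
  · rw [hm]; simp only [reflectFlow, GasDynamics.reflect]
    linear_combination -h2
  · rw [hm]; linear_combination h3

theorem IsFlowOn.eventually_eq {E : ℝ → ℝ → ℝ} {W L : ℝ → GasState} {B : Finset ℝ} {A : Set ℝ}
    (hW : IsFlowOn E W L B A) (hA : IsOpen A) {ξ : ℝ} (hξ : ξ ∈ A) :
    ∀ᶠ η in 𝓝[≠] ξ, W η = L η := by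
  filter_upwards [eventually_ne_notMem_finset B ξ, nhdsWithin_le_nhds (hA.mem_nhds hξ)]
    with η h1 h2 using (hW.eq η h2 h1).symm

/-- Reflection turns right limits into left limits, so the flow and its left-limit function exchange
roles. -/
theorem IsFlowOn.reflect (hf : IsEntropyFactor f) (h : IsProfile K P) {W L : ℝ → GasState}
    {B : Finset ℝ} {A : Set ℝ} (hA : IsOpen A) (hW : IsFlowOn (productEnergy f K) W L B A) :
    IsFlowOn (productEnergy f K) (reflectFlow L) (reflectFlow W) (B.image Neg.neg)
      (Neg.neg ⁻¹' A) := by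
  have hB : ∀ {ξ : ℝ}, ξ ∉ B.image Neg.neg → -ξ ∉ B := fun {ξ} h1 h2 =>
    h1 (Finset.mem_image.2 ⟨-ξ, h2, neg_neg ξ⟩)
  have hgt : ∀ ξ : ℝ, Tendsto Neg.neg (𝓝[>] ξ) (𝓝[<] (-ξ)) := fun ξ => tendsto_neg_nhdsGT
  have hlt : ∀ ξ : ℝ, Tendsto Neg.neg (𝓝[<] ξ) (𝓝[>] (-ξ)) := fun ξ => tendsto_neg_nhdsLT
  refine ⟨fun ξ hξ => ?_, fun ξ hξ hξB => ?_, fun ξ hξ hξB => ?_⟩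
  · have hF := hW.flowAt (-ξ) hξ
    have hev := hW.eventually_eq hA hξ
    refine ⟨hF.rho_pos_left, hF.rho_pos, ?_, ?_, hF.rh.reflect, hF.entropy.reflect⟩
    · exact (hF.left.congr' (hev.filter_mono (nhdsWithin_mono _ fun _ hx => ne_of_lt hx))).reflect
        (hgt ξ)
    · exact (hF.right.congr' (hev.filter_mono (nhdsWithin_mono _ fun _ hx => ne_of_gt hx))).reflect
        (hlt ξ)
  · refine ((hW.smooth (-ξ) hξ (hB hξB)).reflect hf h).congr hf h ?_
    have h1 : ∀ᶠ η in 𝓝 (-ξ), L η = W η := by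
      filter_upwards [eventually_notMem_finset (hB hξB), hA.mem_nhds hξ] with η h1 h2
        using hW.eq η h2 h1
    filter_upwards [(continuous_neg.tendsto ξ).eventually h1] with η hη
    simp only [reflectFlow, hη]
  · simp only [reflectFlow, hW.eq (-ξ) hξ (hB hξB)]

/-! ### Uniqueness of flows without vacuum -/

/-- The mass flux is continuous and strictly decreasing. It changes sign because u has finite limits
while ξ runs to ∓∞. -/
theorem exists_contact (hf : IsEntropyFactor f) (h : IsProfile K P) {W L : ℝ → GasState}
    {B : Finset ℝ} (hW : IsFlowOn (productEnergy f K) W L B univ) {Ul Ur : GasState}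
    (hl : StateTendsto W atBot Ul) (hr : StateTendsto W atTop Ur) :
    ∃ b, massFlux b (W b) = 0 ∧ (∀ ξ < b, 0 < massFlux ξ (W ξ)) ∧
      ∀ ξ > b, massFlux ξ (W ξ) < 0 := by
  have hc : Continuous fun ξ => massFlux ξ (W ξ) := continuous_iff_continuousAt.2 fun ξ =>
    (hW.flowAt ξ (mem_univ _)).continuousAt_massFlux
  have hanti : StrictAntiOn (fun ξ => massFlux ξ (W ξ)) univ := by
    refine strictAntiOn_of_deriv_neg_off_finset B ordConnected_univ hc.continuousOn
      fun ξ _ hξB => ⟨_, (hW.smooth ξ (mem_univ _) hξB).hasDerivAt_massFlux hf h, ?_⟩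
    linarith [(hW.flowAt ξ (mem_univ _)).rho_pos]
  obtain ⟨a, ha1, ha2⟩ := ((hl.2.1.eventually_const_lt (show Ul.u - 1 < Ul.u by linarith)).and
    (Iio_mem_atBot (Ul.u - 1))).exists
  obtain ⟨c, hc1, hc2⟩ := ((hr.2.1.eventually_lt_const (show Ur.u < Ur.u + 1 by linarith)).and
    (Ioi_mem_atTop (Ur.u + 1))).exists
  have ha2 : a < Ul.u - 1 := ha2
  have hc2 : Ur.u + 1 < c := hc2
  have ha : 0 ≤ massFlux a (W a) :=
    mul_nonneg (hW.flowAt a (mem_univ _)).rho_pos.le (by linarith)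
  have hc' : massFlux c (W c) ≤ 0 :=
    mul_nonpos_of_nonneg_of_nonpos (hW.flowAt c (mem_univ _)).rho_pos.le (by linarith)
  obtain ⟨b, hb⟩ := mem_range_of_exists_le_of_exists_ge hc ⟨c, hc'⟩ ⟨a, ha⟩
  have hb : massFlux b (W b) = 0 := hb
  refine ⟨b, hb, fun ξ hξ => ?_, fun ξ hξ => ?_⟩
  · have := hanti (mem_univ ξ) (mem_univ b) hξ
    simp only [hb] at this
    exact this
  · have := hanti (mem_univ b) (mem_univ ξ) hξ
    simp only [hb] at this
    exact this

/-- At the zero b of the mass flux the jump conditions leave equal pressures, and both velocities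
equal b. Equating the velocities behind the two waves gives the equation for p. The right half is
stated for L, because the reflected flow is built from left limits. -/
theorem flow_structure (hf : IsEntropyFactor f) (h : IsProfile K P) {W L : ℝ → GasState}
    {B : Finset ℝ} (hW : IsFlowOn (productEnergy f K) W L B univ) {Ul Ur : GasState}
    (hUl : 0 < Ul.rho) (hUr : 0 < Ur.rho)
    (hl : StateTendsto W atBot Ul) (hr : StateTendsto W atTop Ur) :
    ∃ p, 0 < p ∧ velocityDrop K P (1 / Ul.rho) (f Ul.S) p
        + velocityDrop K P (1 / Ur.rho) (f Ur.S) p = Ul.u - Ur.u ∧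
      (∀ ξ < (postState f K P Ul p).u, W ξ = waveFan f K P Ul p ξ) ∧
      ∀ ξ > (postState f K P Ul p).u, L ξ = reflect (waveFan f K P (reflect Ur) p (-ξ)) := by
  obtain ⟨b, hb, hb1, hb2⟩ := exists_contact hf h hW hl hr
  have hF := hW.flowAt b (mem_univ _)
  have hbL : massFlux b (L b) = 0 := by rw [hF.massFlux_eq, hb]
  have hpeq : f (L b).S * P (1 / (L b).rho) = f (W b).S * P (1 / (W b).rho) := by
    have := ((rankineHugoniot_iff _ _ _ _).1 hF.rh).2.1
    rw [hbL, hb, pHat_productEnergy h hF.rho_pos, pHat_productEnergy h hF.rho_pos_left] at this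
    simpa using this
  have huL : (L b).u = b := by
    have := (mul_eq_zero.1 hbL).resolve_left hF.rho_pos_left.ne'
    linarith
  have huW : (W b).u = b := by
    have := (mul_eq_zero.1 hb).resolve_left hF.rho_pos.ne'
    linarith
  set p := f (L b).S * P (1 / (L b).rho) with hp
  obtain ⟨l1, l2⟩ := eq_waveFan hf h hW hb1 hUl hl hp
  have hWr := hW.reflect hf h isOpen_univ
  rw [preimage_univ] at hWr
  have hlr : StateTendsto (reflectFlow L) atBot (reflect Ur) := by
    refine StateTendsto.reflect (hr.congr' ?_) tendsto_neg_atBot_atTop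
    have : ∀ᶠ η : ℝ in atTop, η ∉ B := by
      obtain ⟨M, hM⟩ := B.bddAbove
      filter_upwards [eventually_gt_atTop M] with η hη hηB using not_lt.2 (hM hηB) hη
    filter_upwards [this] with η hη using (hW.eq η (mem_univ _) hη).symm
  obtain ⟨r1, r2⟩ := eq_waveFan hf h hWr (b := -b) (fun ξ hξ => by
      have e : massFlux ξ (reflectFlow L ξ) = -massFlux (-ξ) (L (-ξ)) := massFlux_reflect _ _
      rw [e, (hW.flowAt (-ξ) (mem_univ _)).massFlux_eq]
      have := hb2 (-ξ) (by linarith)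
      linarith) (Ul := reflect Ur) hUr hlr (p := p) (by
      rw [hpeq]; simp [reflectFlow, reflect])
  have hub : (postState f K P Ul p).u = b := by rw [← l1, huL]
  refine ⟨p, mul_pos (hf.pos _) (h.P_pos _ (one_div_pos.2 hF.rho_pos_left)), ?_, ?_, ?_⟩
  · have e1 := postState_u (f := f) (K := K) (P := P) (U := Ul) (p := p)
    have e2 := postState_u (f := f) (K := K) (P := P) (U := reflect Ur) (p := p)
    rw [hub] at e1
    rw [← r1] at e2
    simp only [reflectFlow, reflect, neg_neg, huW] at e2
    linarith
  · rw [hub]; exact l2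
  · rw [hub]
    intro ξ hξ
    rw [← r2 (-ξ) (by linarith), reflectFlow, neg_neg, reflect_reflect]

theorem flow_unique (hf : IsEntropyFactor f) (h : IsProfile K P) {W₁ L₁ W₂ L₂ : ℝ → GasState}
    {B₁ B₂ : Finset ℝ} (hW₁ : IsFlowOn (productEnergy f K) W₁ L₁ B₁ univ)
    (hW₂ : IsFlowOn (productEnergy f K) W₂ L₂ B₂ univ) {Ul Ur : GasState}
    (hUl : 0 < Ul.rho) (hUr : 0 < Ur.rho)
    (hl₁ : StateTendsto W₁ atBot Ul) (hr₁ : StateTendsto W₁ atTop Ur)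
    (hl₂ : StateTendsto W₂ atBot Ul) (hr₂ : StateTendsto W₂ atTop Ur) : W₁ = W₂ := by
  obtain ⟨p, hp, e1, l1, r1⟩ := flow_structure hf h hW₁ hUl hUr hl₁ hr₁
  obtain ⟨p', hp', e2, l2, r2⟩ := flow_structure hf h hW₂ hUl hUr hl₂ hr₂
  have hpp : p = p' := by
    have hmono := (h.strictMonoOn_velocityDrop (one_div_pos.2 hUl) (hf.pos Ul.S)).add
      (h.strictMonoOn_velocityDrop (one_div_pos.2 hUr) (hf.pos Ur.S))
    exact hmono.injOn hp hp' (e1.trans e2.symm)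
  subst hpp
  funext ξ
  rcases lt_or_ge ξ (postState f K P Ul p).u with hlt | hge
  · rw [l1 ξ hlt, l2 ξ hlt]
  -- From the contact on, the structure result controls only the left limits. These agree with the
  -- flows off finite sets, and right continuity recovers the values.
  · refine StateTendsto.unique (hW₁.flowAt ξ (mem_univ _)).right
      ((hW₂.flowAt ξ (mem_univ _)).right.congr' ?_)
    have hsub : Ioi ξ ⊆ {ξ}ᶜ := fun _ hx => ne_of_gt hx
    filter_upwards [(hW₁.eventually_eq isOpen_univ (mem_univ ξ)).filter_mono
        (nhdsWithin_mono _ hsub),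
      (hW₂.eventually_eq isOpen_univ (mem_univ ξ)).filter_mono (nhdsWithin_mono _ hsub),
      self_mem_nhdsWithin] with η h1 h2 h3
    have h3 : ξ < η := h3
    rw [h1, h2, r1 η (by linarith), r2 η (by linarith)]

/-! ### Absence of vacuum -/

theorem conserved_of_vacuum {E : ℝ → ℝ → ℝ} {U : GasState} (hU : U.rho = 0) :
    conserved E U = 0 := by
  ext i; fin_cases i <;> simp [conserved, hU]

theorem flux_of_vacuum {E : ℝ → ℝ → ℝ} {U : GasState} (hU : U.rho = 0) : flux E U = 0 := by
  ext i; fin_cases i <;> simp [flux, hU, pHat]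

theorem HasTrace.rho_nonneg {E : ℝ → ℝ → ℝ} {W : ℝ → GasState} {l : Filter ℝ} {U : GasState}
    (h : HasTrace E W l U) : 0 ≤ U.rho := by
  rcases h with h | h
  · exact h.1.le
  · exact h.1.ge

theorem HasTrace.stateTendsto {E : ℝ → ℝ → ℝ} {W : ℝ → GasState} {l : Filter ℝ} {U : GasState}
    (h : HasTrace E W l U) (hU : 0 < U.rho) : StateTendsto W l U := by
  rcases h with h | h
  · exact h.2
  · exact absurd h.1 (ne_of_gt hU)

/-- A discontinuity cannot separate gas from vacuum. -/
theorem rankineHugoniot_vacuum (hf : IsEntropyFactor f) (h : IsProfile K P) {ξ : ℝ}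
    {Ul Ur : GasState} (hl : 0 ≤ Ul.rho) (hr : 0 ≤ Ur.rho)
    (hRH : RankineHugoniot (productEnergy f K) ξ Ul Ur) : Ul.rho = 0 ↔ Ur.rho = 0 := by
  obtain ⟨h1, h2, -⟩ := (rankineHugoniot_iff _ _ _ _).1 hRH
  -- On the vacuum side mass flux and pressure vanish, so the momentum condition would make the
  -- pressure of the gas zero.
  have key : ∀ {U V : GasState}, 0 ≤ V.rho → U.rho = 0 → massFlux ξ U = massFlux ξ V →
      massFlux ξ U * U.u + pHat (productEnergy f K) U.rho U.S
        = massFlux ξ V * V.u + pHat (productEnergy f K) V.rho V.S → V.rho = 0 := by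
    intro U V hV hU e1 e2
    by_contra hne
    have hV : 0 < V.rho := lt_of_le_of_ne hV (Ne.symm hne)
    have hU0 : massFlux ξ U = 0 := by simp [massFlux, hU]
    rw [← e1, hU0, pHat_productEnergy h hV, hU] at e2
    have : 0 < f V.S * P (1 / V.rho) := mul_pos (hf.pos _) (h.P_pos _ (one_div_pos.2 hV))
    simp [pHat] at e2
    rcases e2 with e2 | e2
    · exact (hf.pos V.S).ne' e2
    · have := h.P_pos _ (one_div_pos.2 hV)
      simp at this
      linarith
  exact ⟨fun hU => key hr hU h1 h2, fun hU => key hl hU h1.symm h2.symm⟩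

/-- A smooth flow of gas cannot tend to vacuum on its right side. -/
theorem not_tendsto_vacuum (hf : IsEntropyFactor f) (h : IsProfile K P) {W : ℝ → GasState}
    {a b : ℝ} (hab : a < b) (hs : ∀ ξ ∈ Ioo a b, IsSmoothAt (productEnergy f K) W ξ)
    (hC : Tendsto (fun ξ => conserved (productEnergy f K) (W ξ)) (𝓝[<] b) (𝓝 0))
    (hFl : Tendsto (fun ξ => flux (productEnergy f K) (W ξ)) (𝓝[<] b) (𝓝 0)) : False := by
  have hρlim : Tendsto (fun ξ => (W ξ).rho) (𝓝[<] b) (𝓝 0) := (tendsto_pi_nhds.1 hC) 0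
  have hj : Tendsto (fun ξ => (W ξ).rho * (W ξ).u) (𝓝[<] b) (𝓝 0) := (tendsto_pi_nhds.1 hFl) 0
  -- The velocity need not stay bounded at a vacuum; what tends to zero is ρu, the first component
  -- of the flux.
  have hmlim : Tendsto (fun ξ => massFlux ξ (W ξ)) (𝓝[<] b) (𝓝 0) := by
    have := hj.sub (hρlim.mul ((tendsto_id (α := ℝ)).mono_left nhdsWithin_le_nhds))
    simp only [zero_mul, sub_zero] at this
    refine this.congr fun ξ => ?_
    simp only [massFlux, id]; ring
  have hanti : StrictAntiOn (fun ξ => massFlux ξ (W ξ)) (Ioo a b) := by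
    refine strictAntiOn_of_deriv_neg_off_finset ∅ ordConnected_Ioo
      (fun ξ hξ => ((hs ξ hξ).hasDerivAt_massFlux hf h).continuousAt.continuousWithinAt)
      fun ξ hξ _ => ?_
    rw [interior_Ioo] at hξ
    exact ⟨_, (hs ξ hξ).hasDerivAt_massFlux hf h, by linarith [(hs ξ hξ).1]⟩
  have hm : ∀ ξ ∈ Ioo a b, 0 < massFlux ξ (W ξ) := by
    intro ξ hξ
    obtain ⟨η, hη⟩ := exists_between hξ.2
    have hη' : η ∈ Ioo a b := ⟨hξ.1.trans hη.1, hη.2⟩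
    refine lt_of_le_of_lt (le_of_tendsto hmlim ?_) (hanti hξ hη' hη.1)
    filter_upwards [Ioo_mem_nhdsLT hη.2] with ζ hζ
    exact (hanti hη' ⟨hη'.1.trans hζ.1, hζ.2⟩ hζ.1).le
  obtain ⟨hS, hκ, -, hz, -⟩ := continuous_piece hf h ordConnected_Ioo isOpen_Ioo (B := ∅)
    (fun ξ hξ _ => hs ξ hξ) (fun ξ hξ => (hs ξ hξ).stateTendsto) (fun ξ hξ => (hs ξ hξ).1) hm
  obtain ⟨c, hc⟩ := exists_between hab
  have hτ : Tendsto (fun ξ => 1 / (W ξ).rho) (𝓝[<] b) atTop := by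
    simp only [one_div]
    refine tendsto_inv_nhdsGT_zero.comp (tendsto_nhdsWithin_iff.2 ⟨hρlim, ?_⟩)
    filter_upwards [Ioo_mem_nhdsLT hab] with ξ hξ using (hs ξ hξ).1
  -- On the piece u - c is a constant plus √f times `charSpeed`, and the volume tends to infinity.
  -- So u - c → ∞ at the finite point b, against the monotonicity of ξ - (u - c).
  have hblow : Tendsto (fun ξ => (W c).u - √(f (W c).S) * speedIntegral P (1 / (W c).rho)
      + √(f (W c).S) * charSpeed P (1 / (W ξ).rho)) (𝓝[<] b) atTop :=
    tendsto_atTop_add_const_left _ _ ((h.tendsto_charSpeed.comp hτ).const_mul_atTop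
      (Real.sqrt_pos.2 (hf.pos _)))
  obtain ⟨ξ, h1, h2⟩ := ((hblow.eventually_gt_atTop (b - (c - backSpeed f P (W c)))).and
    (Ioo_mem_nhdsLT hc.2)).exists
  have hξ : ξ ∈ Ioo a b := ⟨hc.1.trans h2.1, h2.2⟩
  have h3 := hz hc hξ h2.1.le
  have h4 : backSpeed f P (W ξ) = (W c).u - √(f (W c).S) * speedIntegral P (1 / (W c).rho)
      + √(f (W c).S) * charSpeed P (1 / (W ξ).rho) := by
    rw [hκ c hc ξ hξ, hS c hc ξ hξ, backSpeed, charSpeed]; ring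
  simp only at h3
  rw [h4] at h3
  linarith [h2.2]

/-- A solution of the Riemann problem contains no vacuum. -/
theorem IsRiemannSolution.exists_isFlowOn (hf : IsEntropyFactor f) (h : IsProfile K P)
    {Ul Ur : GasState} (hUl : 0 < Ul.rho) {W : ℝ → GasState}
    (hW : IsRiemannSolution (productEnergy f K) Ul Ur W) :
    ∃ L B, IsFlowOn (productEnergy f K) W L B univ := by
  classical
  obtain ⟨B, hB1, hB2⟩ := hW.piecewise_smooth
  have htr : ∀ ξ, ∃ U, HasTrace (productEnergy f K) W (𝓝[>] ξ) (W ξ) ∧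
      HasTrace (productEnergy f K) W (𝓝[<] ξ) U ∧ RankineHugoniot (productEnergy f K) ξ U (W ξ) ∧
      EntropyAdmissible (productEnergy f K) ξ U (W ξ) ∧ (ξ ∉ B → U = W ξ) := by
    intro ξ
    by_cases hξ : ξ ∈ B
    · obtain ⟨h1, U, h2, h3, h4⟩ := hB2 ξ hξ
      exact ⟨U, h1, h2, h3, h4, fun hn => absurd hξ hn⟩
    · have hboth : HasTrace (productEnergy f K) W (𝓝 ξ) (W ξ) := by
        rcases hB1 ξ hξ with hs | hv
        · exact Or.inl ⟨hs.1, hs.stateTendsto⟩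
        · refine Or.inr ⟨hv.self_of_nhds, ?_, ?_⟩
          · exact tendsto_const_nhds.congr' (hv.mono fun η hη => (conserved_of_vacuum hη).symm)
          · exact tendsto_const_nhds.congr' (hv.mono fun η hη => (flux_of_vacuum hη).symm)
      have hmono : ∀ A : Set ℝ, HasTrace (productEnergy f K) W (𝓝[A] ξ) (W ξ) := fun A => by
        rcases hboth with h1 | h1
        · exact Or.inl ⟨h1.1, h1.2.mono nhdsWithin_le_nhds⟩
        · exact Or.inr ⟨h1.1, h1.2.1.mono_left nhdsWithin_le_nhds,
            h1.2.2.mono_left nhdsWithin_le_nhds⟩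
      exact ⟨W ξ, hmono _, hmono _, fun i => by ring, fun hne => absurd rfl hne, fun _ => rfl⟩
  choose L hright hleft hrh hent heq using htr
  have hvac : ∀ ξ, (L ξ).rho = 0 ↔ (W ξ).rho = 0 := fun ξ =>
    rankineHugoniot_vacuum hf h (hleft ξ).rho_nonneg (hright ξ).rho_nonneg (hrh ξ)
  have hpos : ∀ ξ, 0 < (W ξ).rho := by
    by_contra hcon
    push Not at hcon
    -- Its infimum b is attained by right continuity. As a jump has vacuum on both sides or on
    -- neither, the left trace at b is a vacuum too, although smooth gas lies just to the left.
    set Bad := {ξ | (W ξ).rho = 0} with hBad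
    have hne : Bad.Nonempty := by
      obtain ⟨ξ, hξ⟩ := hcon
      exact ⟨ξ, le_antisymm hξ (hW.rho_nonneg ξ)⟩
    have hbdd : BddBelow Bad := by
      obtain ⟨a, ha⟩ := mem_atBot_sets.1 (hW.left_data.1.eventually_const_lt hUl)
      refine ⟨a, fun ξ hξ => le_of_not_ge fun hle => ?_⟩
      have : 0 < (W ξ).rho := ha ξ hle
      exact this.ne' hξ
    set b := sInf Bad with hb
    have hlt : ∀ ξ < b, 0 < (W ξ).rho := fun ξ hξ =>
      lt_of_le_of_ne (hW.rho_nonneg ξ) fun h0 => notMem_of_lt_csInf hξ hbdd h0.symm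
    have hbBad : (W b).rho = 0 := by
      by_contra hne0
      have hWb : 0 < (W b).rho := lt_of_le_of_ne (hW.rho_nonneg b) (Ne.symm hne0)
      have hev := ((hright b).stateTendsto hWb).1.eventually_const_lt hWb
      obtain ⟨c, hc, hc'⟩ := mem_nhdsGT_iff_exists_Ioo_subset.1 hev
      obtain ⟨ξ, hξ, hξc⟩ := exists_lt_of_csInf_lt hne (show sInf Bad < c from hc)
      rcases (csInf_le hbdd hξ).eq_or_lt with e | e
      · exact hne0 (by rw [hb, e]; exact hξ)
      · have : 0 < (W ξ).rho := hc' ⟨e, hξc⟩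
        exact this.ne' hξ
    have hLb : (L b).rho = 0 := (hvac b).2 hbBad
    obtain ⟨a, ha, haB⟩ : ∃ a < b, ∀ ξ ∈ Ioo a b, ξ ∉ B := by
      have := (eventually_ne_notMem_finset B b).filter_mono
        (nhdsWithin_mono b (show Iio b ⊆ {b}ᶜ from fun _ hx => ne_of_lt hx))
      obtain ⟨a, ha, ha'⟩ := mem_nhdsLT_iff_exists_Ioo_subset.1 this
      exact ⟨a, ha, fun ξ hξ => ha' hξ⟩
    have hL : Tendsto (fun ξ => conserved (productEnergy f K) (W ξ)) (𝓝[<] b) (𝓝 0) ∧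
        Tendsto (fun ξ => flux (productEnergy f K) (W ξ)) (𝓝[<] b) (𝓝 0) := by
      rcases hleft b with h1 | h1
      · exact absurd hLb h1.1.ne'
      · exact h1.2
    refine not_tendsto_vacuum hf h ha (fun ξ hξ => ?_) hL.1 hL.2
    exact (hB1 ξ (haB ξ hξ)).resolve_right fun hv => (hlt ξ hξ.2).ne' hv.self_of_nhds
  have hposL : ∀ ξ, 0 < (L ξ).rho := fun ξ => lt_of_le_of_ne (hleft ξ).rho_nonneg
    fun h0 => (hpos ξ).ne' ((hvac ξ).1 h0.symm)
  refine ⟨L, B, fun ξ _ => ⟨hpos ξ, hposL ξ, (hright ξ).stateTendsto (hpos ξ),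
    (hleft ξ).stateTendsto (hposL ξ), hrh ξ, hent ξ⟩, fun ξ _ hξ => ?_, fun ξ _ hξ => heq ξ hξ⟩
  exact (hB1 ξ hξ).resolve_right fun hv => (hpos ξ).ne' hv.self_of_nhds

/-- The data bound the density near ±∞. In between, both one-sided limits at each point are
positive, so a local bound exists and compactness makes it uniform. -/
theorem IsFlowOn.vacuumFree {E : ℝ → ℝ → ℝ} {W L : ℝ → GasState} {B : Finset ℝ}
    (hW : IsFlowOn E W L B univ) {Ul Ur : GasState} (hUl : 0 < Ul.rho) (hUr : 0 < Ur.rho)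
    (hl : StateTendsto W atBot Ul) (hr : StateTendsto W atTop Ur) : VacuumFree W := by
  obtain ⟨a, ha⟩ := mem_atBot_sets.1 (hl.1.eventually_const_lt (half_lt_self hUl))
  obtain ⟨c, hc⟩ := mem_atTop_sets.1 (hr.1.eventually_const_lt (half_lt_self hUr))
  obtain ⟨δ, hδ, hδ'⟩ : ∃ δ > 0, ∀ ξ ∈ Icc a c, δ ≤ (W ξ).rho := by
    refine isCompact_Icc.induction_on (p := fun s => ∃ δ > 0, ∀ ξ ∈ s, δ ≤ (W ξ).rho)
      ⟨1, one_pos, by simp⟩ ?_ ?_ ?_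
    · rintro s t hst ⟨δ, hδ, h1⟩
      exact ⟨δ, hδ, fun ξ hξ => h1 ξ (hst hξ)⟩
    · rintro s t ⟨δ, hδ, h1⟩ ⟨ε, hε, h2⟩
      refine ⟨min δ ε, lt_min hδ hε, ?_⟩
      rintro ξ (hξ | hξ)
      · exact (min_le_left _ _).trans (h1 ξ hξ)
      · exact (min_le_right _ _).trans (h2 ξ hξ)
    · intro ξ _
      have hF := hW.flowAt ξ (mem_univ _)
      set δ := min (W ξ).rho (L ξ).rho / 2 with hδ
      have h0 : 0 < min (W ξ).rho (L ξ).rho := lt_min hF.rho_pos hF.rho_pos_left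
      have e1 := hF.right.1.eventually_const_lt
        (show δ < (W ξ).rho by linarith [min_le_left (W ξ).rho (L ξ).rho])
      have e2 := hF.left.1.eventually_const_lt
        (show δ < (L ξ).rho by linarith [min_le_right (W ξ).rho (L ξ).rho])
      rw [eventually_nhdsWithin_iff] at e1 e2
      refine ⟨{η | δ ≤ (W η).rho}, nhdsWithin_le_nhds ?_, δ, by linarith, fun η hη => hη⟩
      filter_upwards [e1, e2] with η h1 h2
      rcases lt_trichotomy η ξ with hlt | heq | hgt
      · exact (h2 hlt).le
      · rw [heq]; linarith [min_le_left (W ξ).rho (L ξ).rho]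
      · exact (h1 hgt).le
  refine ⟨min δ (min (Ul.rho / 2) (Ur.rho / 2)), by positivity, fun ξ => ?_⟩
  rcases le_total ξ a with h1 | h1
  · have : Ul.rho / 2 < (W ξ).rho := ha ξ h1
    exact (min_le_right _ _).trans ((min_le_left _ _).trans this.le)
  · rcases le_total ξ c with h2 | h2
    · exact (min_le_left _ _).trans (hδ' ξ ⟨h1, h2⟩)
    · have : Ur.rho / 2 < (W ξ).rho := hc ξ h2
      exact (min_le_right _ _).trans ((min_le_right _ _).trans this.le)

theorem IsFlowOn.isRiemannSolution {E : ℝ → ℝ → ℝ} {W L : ℝ → GasState} {B : Finset ℝ}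
    (hW : IsFlowOn E W L B univ) {Ul Ur : GasState} (hl : StateTendsto W atBot Ul)
    (hr : StateTendsto W atTop Ur) : IsRiemannSolution E Ul Ur W where
  rho_nonneg ξ := (hW.flowAt ξ (mem_univ _)).rho_pos.le
  left_data := hl
  right_data := hr
  piecewise_smooth := ⟨B, fun ξ hξ => Or.inl (hW.smooth ξ (mem_univ _) hξ), fun ξ _ => by
    have hF := hW.flowAt ξ (mem_univ _)
    exact ⟨Or.inl ⟨hF.rho_pos, hF.right⟩, L ξ, Or.inl ⟨hF.rho_pos_left, hF.left⟩, hF.rh,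
      hF.entropy⟩⟩

/-! ### Existence -/

theorem flowAt_of_stateTendsto {E : ℝ → ℝ → ℝ} {W L : ℝ → GasState} {ξ : ℝ}
    (hρ : 0 < (W ξ).rho) (hW : StateTendsto W (𝓝 ξ) (W ξ)) (hL : L ξ = W ξ) : FlowAt E W L ξ where
  rho_pos := hρ
  rho_pos_left := by rw [hL]; exact hρ
  right := hW.mono nhdsWithin_le_nhds
  left := by rw [hL]; exact hW.mono nhdsWithin_le_nhds
  rh := fun i => by rw [hL]; ring
  entropy := fun hne => absurd hL hne

theorem isSmoothAt_of_eventually_eq (hf : IsEntropyFactor f) (h : IsProfile K P)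
    {W : ℝ → GasState} {U : GasState} {ξ : ℝ} (hU : 0 < U.rho) (hW : ∀ᶠ η in 𝓝 ξ, W η = U) :
    IsSmoothAt (productEnergy f K) W ξ := by
  have h0 : IsSmoothAt (productEnergy f K) (fun _ => U) ξ :=
    isSmoothAt_of_derivs hf h (τ' := 0) (u' := 0) (S' := 0) hU contDiffAt_const contDiffAt_const
      contDiffAt_const (hasDerivAt_const _ _) (hasDerivAt_const _ _) (hasDerivAt_const _ _)
      (by ring) (by ring) (by ring)
  exact h0.congr hf h hW

theorem IsFlowOn.congr (hf : IsEntropyFactor f) (h : IsProfile K P) {W L W' L' : ℝ → GasState}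
    {B B' : Finset ℝ} {A A' : Set ℝ} (hW : IsFlowOn (productEnergy f K) W L B A)
    (hA : IsOpen A') (hsub : A' ⊆ A) (hB : B ⊆ B') (h1 : ∀ ξ ∈ A', W' ξ = W ξ)
    (h2 : ∀ ξ ∈ A', L' ξ = L ξ) : IsFlowOn (productEnergy f K) W' L' B' A' := by
  have hev : ∀ ξ ∈ A', W' =ᶠ[𝓝 ξ] W := fun ξ hξ => by
    filter_upwards [hA.mem_nhds hξ] with η hη using h1 η hη
  refine ⟨fun ξ hξ => ?_, fun ξ hξ hξB => ?_, fun ξ hξ hξB => ?_⟩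
  · have hF := hW.flowAt ξ (hsub hξ)
    have e := (hev ξ hξ).symm
    refine ⟨?_, ?_, ?_, ?_, ?_, ?_⟩
    · rw [h1 ξ hξ]; exact hF.rho_pos
    · rw [h2 ξ hξ]; exact hF.rho_pos_left
    · rw [h1 ξ hξ]; exact hF.right.congr' (e.filter_mono nhdsWithin_le_nhds)
    · rw [h2 ξ hξ]; exact hF.left.congr' (e.filter_mono nhdsWithin_le_nhds)
    · rw [h1 ξ hξ, h2 ξ hξ]; exact hF.rh
    · rw [h1 ξ hξ, h2 ξ hξ]; exact hF.entropy
  · exact (hW.smooth ξ (hsub hξ) fun hb => hξB (hB hb)).congr hf h (hev ξ hξ)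
  · rw [h1 ξ hξ, h2 ξ hξ]
    exact hW.eq ξ (hsub hξ) fun hb => hξB (hB hb)

/-- What the construction of a solution uses about a backward wave. -/
structure IsBackwardWave (f K P : ℝ → ℝ) (U V : GasState) (p : ℝ) (W L : ℝ → GasState)
    (B : Finset ℝ) : Prop where
  flow : IsFlowOn (productEnergy f K) W L B univ
  rho_pos : 0 < V.rho
  pressure_eq : f V.S * P (1 / V.rho) = p
  u_eq : V.u = U.u - velocityDrop K P (1 / U.rho) (f U.S) p
  left_data : ∃ a, ∀ ξ < a, W ξ = U ∧ L ξ = U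
  right_data : ∃ a < V.u, ∀ ξ > a, W ξ = V ∧ L ξ = V

/-- Two constant states separated at `shockSpeed`: the derivation of the jump relations is run
backwards from the Hugoniot root, with m² the ratio of the pressure rise to the loss of volume. The
entropy behind exists because f maps onto (0, ∞). -/
theorem exists_shockWave (hf : IsEntropyFactor f) (h : IsProfile K P) {U : GasState}
    (hU : 0 < U.rho) {p : ℝ} (hp : f U.S * P (1 / U.rho) < p) :
    ∃ V W L B, IsBackwardWave f K P U V p W L B := by
  classical
  have hτ₀ : 0 < 1 / U.rho := by positivity
  have hφ := hf.pos U.S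
  have hP₀ := h.P_pos _ hτ₀
  have hp₀ := mul_pos hφ hP₀
  have hp' : 0 < p := hp₀.trans hp
  set V := shockState f K P U p with hV
  set s := shockSpeed f K P U p with hs
  obtain ⟨hτ, -, hug⟩ := h.shockVolume_spec hτ₀ hp₀ hp.le
  have hlt := h.shockVolume_lt hτ₀ hp₀ hp
  set τ := shockVolume K P (1 / U.rho) (f U.S * P (1 / U.rho)) p with hτdef
  have hPτ := h.P_pos τ hτ
  have hv : 0 < 1 / U.rho - τ := by linarith
  set m := √((p - f U.S * P (1 / U.rho)) / (1 / U.rho - τ)) with hm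
  have hm0 : 0 < m := Real.sqrt_pos.2 (div_pos (by linarith) hv)
  have hm2 : m ^ 2 * (1 / U.rho - τ) = p - f U.S * P (1 / U.rho) := by
    rw [hm, Real.sq_sqrt (div_nonneg (by linarith) hv.le), div_mul_cancel₀ _ hv.ne']
  have hVρ : 0 < V.rho := one_div_pos.2 hτ
  have hVτ : 1 / V.rho = τ := one_div_one_div τ
  have hVS : f V.S = p / P τ := Function.invFun_eq (hf.exists_eq (div_pos hp' hPτ))
  have hVp : f V.S * P (1 / V.rho) = p := by rw [hVτ, hVS, div_mul_cancel₀ _ hPτ.ne']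
  have hdrop : velocityDrop K P (1 / U.rho) (f U.S) p = m * (1 / U.rho - τ) := by
    rw [h.velocityDrop_of_ge hτ₀ hφ hp.le, ← hτdef, ← hm2,
      Real.sqrt_eq_iff_mul_self_eq (by positivity) (by positivity)]
    ring
  have hVu : V.u = U.u - m * (1 / U.rho - τ) := by rw [← hdrop]; rfl
  have hsU : s = U.u - 1 / U.rho * m := rfl
  have hmU : massFlux s U = m := by
    rw [massFlux, hsU]; field_simp; ring
  have hmV : massFlux s V = m := by
    rw [massFlux, hsU, hVu]
    have : V.rho = 1 / τ := rfl
    rw [this]; field_simp; ring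
  have hsV : s < V.u := by
    rw [hsU, hVu]
    nlinarith [mul_pos hm0 hτ]
  have hE : f V.S * K τ - f U.S * K (1 / U.rho)
      = (p + f U.S * P (1 / U.rho)) / 2 * (1 / U.rho - τ) := by
    have e1 : p * (K τ / P τ) = f V.S * K τ := by rw [hVS]; ring
    have e2 : f U.S * P (1 / U.rho) * (K (1 / U.rho) / P (1 / U.rho)) = f U.S * K (1 / U.rho) := by
      rw [mul_div_assoc', div_eq_iff hP₀.ne']; ring
    rw [hugoniot, e1, e2] at hug
    linarith
  have hRH : RankineHugoniot (productEnergy f K) s U V := by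
    rw [rankineHugoniot_iff, hmU, hmV, pHat_productEnergy h hU, pHat_productEnergy h hVρ, hVp,
      hVτ, hVu]
    simp only [productEnergy]
    refine ⟨trivial, by linear_combination hm2, ?_⟩
    linear_combination (-m) * hE + (U.u - m * (1 / U.rho - τ) / 2) * hm2
  have hent : EntropyAdmissible (productEnergy f K) s U V := by
    intro _
    rw [pHat_productEnergy h hU, pHat_productEnergy h hVρ, hVp]
    refine ⟨fun _ => hp, fun hneg => ?_⟩
    have : massFlux s V < 0 := hneg
    linarith
  set W : ℝ → GasState := fun ξ => if ξ < s then U else V with hW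
  set L : ℝ → GasState := fun ξ => if ξ ≤ s then U else V with hL
  have hWl : ∀ ξ < s, W ξ = U := fun ξ hξ => if_pos hξ
  have hWr : ∀ ξ, s ≤ ξ → W ξ = V := fun ξ hξ => if_neg (not_lt.2 hξ)
  have hLl : ∀ ξ ≤ s, L ξ = U := fun ξ hξ => if_pos hξ
  have hLr : ∀ ξ > s, L ξ = V := fun ξ hξ => if_neg (not_le.2 hξ)
  have hsm : ∀ ξ, ξ ≠ s → IsSmoothAt (productEnergy f K) W ξ := by
    intro ξ hξ
    rcases lt_or_gt_of_ne hξ with hl | hr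
    · refine isSmoothAt_of_eventually_eq hf h hU ?_
      filter_upwards [Iio_mem_nhds hl] with η hη using hWl η hη
    · refine isSmoothAt_of_eventually_eq hf h hVρ ?_
      filter_upwards [Ioi_mem_nhds hr] with η hη using hWr η (le_of_lt hη)
  have heq : ∀ ξ, ξ ≠ s → L ξ = W ξ := by
    intro ξ hξ
    rcases lt_or_gt_of_ne hξ with hl | hr
    · rw [hWl ξ hl, hLl ξ hl.le]
    · rw [hWr ξ hr.le, hLr ξ hr]
  refine ⟨V, W, L, {s}, ⟨fun ξ _ => ?_, fun ξ _ hξ => hsm ξ (by simpa using hξ),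
    fun ξ _ hξ => heq ξ (by simpa using hξ)⟩, hVρ, hVp, by rw [hdrop]; exact hVu,
    ⟨s, fun ξ hξ => ⟨hWl ξ hξ, hLl ξ hξ.le⟩⟩, ⟨s, hsV, fun ξ hξ => ⟨hWr ξ hξ.le, hLr ξ hξ⟩⟩⟩
  by_cases hξ : ξ = s
  · rw [hξ]
    refine ⟨by rw [hWr s le_rfl]; exact hVρ, by rw [hLl s le_rfl]; exact hU, ?_, ?_, ?_, ?_⟩
    · rw [hWr s le_rfl]
      refine .of_eventually_eq ?_
      filter_upwards [self_mem_nhdsWithin] with η hη using hWr η (le_of_lt hη)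
    · rw [hLl s le_rfl]
      refine .of_eventually_eq ?_
      filter_upwards [self_mem_nhdsWithin] with η hη using hWl η hη
    · rw [hWr s le_rfl, hLl s le_rfl]; exact hRH
    · rw [hWr s le_rfl, hLl s le_rfl]; exact hent
  · exact flowAt_of_stateTendsto (hsm ξ hξ).1 (hsm ξ hξ).stateTendsto (heq ξ hξ)

/-- On the ray ξ the fan takes the state of the simple wave whose characteristic speed is ξ clamped
to [yl, yr]. The only exceptional rays are the two edges, where the flow is continuous. -/
theorem exists_rarefactionWave (hf : IsEntropyFactor f) (h : IsProfile K P) {U : GasState}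
    (hU : 0 < U.rho) {p : ℝ} (hp0 : 0 < p) (hp : p ≤ f U.S * P (1 / U.rho)) :
    ∃ V W L B, IsBackwardWave f K P U V p W L B := by
  have hτ₀ : 0 < 1 / U.rho := by positivity
  have hφ := hf.pos U.S
  have hsφ := Real.sqrt_pos.2 hφ
  obtain ⟨hτle, hτp⟩ := h.rarefactionVolume_spec hτ₀ hφ hp0 hp
  set τ₁ := rarefactionVolume P (f U.S) p with hτ₁
  have hτ₁0 : 0 < τ₁ := hτ₀.trans_le hτle
  set V := simpleState f P U τ₁ with hV
  set Y : ℝ → ℝ := fun τ => backSpeed f P (simpleState f P U τ) with hY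
  have hYform : ∀ τ, Y τ = U.u - √(f U.S) * speedIntegral P (1 / U.rho)
      + √(f U.S) * charSpeed P τ := fun τ => backSpeed_simpleState
  have hYmono : StrictMonoOn Y (Ioi 0) := by
    intro a ha b hb hab
    rw [hYform, hYform]
    have := mul_lt_mul_of_pos_left (h.strictMonoOn_charSpeed ha hb hab) hsφ
    linarith
  have hYd : ∀ τ, 0 < τ → HasDerivAt Y (√(f U.S) * deriv (charSpeed P) τ) τ := by
    intro τ hτ
    have hd := (h.hasDerivAt_charSpeed hτ).differentiableAt.hasDerivAt
    exact ((hd.const_mul (√(f U.S))).const_add _).congr_of_eventuallyEq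
      (Eventually.of_forall hYform)
  have hYcont : ContinuousOn Y (Ioi 0) := fun τ hτ =>
    (hYd τ hτ).continuousAt.continuousWithinAt
  set yl := backSpeed f P U with hyl
  have hYl : Y (1 / U.rho) = yl := by rw [hY, hyl]; simp only [simpleState_self]
  set yr := Y τ₁ with hyr
  have hle : yl ≤ yr := by rw [← hYl]; exact hYmono.monotoneOn hτ₀ hτ₁0 hτle
  set T : ℝ → ℝ := simpleVolume f P U with hT
  have hTY : ∀ τ, 0 < τ → T (Y τ) = τ := fun τ hτ => simpleVolume_backSpeed hf h hτ
  have hTspec : ∀ y ∈ Icc yl yr, 0 < T y ∧ Y (T y) = y := by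
    intro y hy
    rw [← hYl] at hy
    obtain ⟨τ, hτ, rfl⟩ := intermediate_value_Icc hτle
      (hYcont.mono fun x hx => hτ₀.trans_le hx.1) hy
    have hτ0 := hτ₀.trans_le hτ.1
    rw [hTY τ hτ0]
    exact ⟨hτ0, rfl⟩
  have hTcont : ContinuousOn T (Icc yl yr) := by
    refine continuousOn_root (h := fun τ y => Y τ - y) (I := Ioi 0) isOpen_Ioi
      (fun y _ a ha b hb hab => ?_) (fun y hy => (hTspec y hy).1)
      (fun y hy => by simp only [(hTspec y hy).2, sub_self]) fun τ _ => by fun_prop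
    have := hYmono ha hb hab
    simp only; linarith
  have hT'pos : ∀ τ, 0 < τ → √(f U.S) * deriv (charSpeed P) τ ≠ 0 := by
    intro τ hτ
    rw [(h.hasDerivAt_charSpeed hτ).deriv]
    exact (mul_pos hsφ (h.charSpeed_deriv_pos hτ)).ne'
  -- Inverse function rule: the characteristic speed has positive derivative by genuine
  -- nonlinearity, and T is already known to be continuous.
  have hTd : ∀ y ∈ Ioo yl yr, HasDerivAt T (√(f U.S) * deriv (charSpeed P) (T y))⁻¹ y := by
    intro y hy
    have hy' := Ioo_subset_Icc_self hy
    refine HasDerivAt.of_local_left_inverse (hTcont.continuousAt (Icc_mem_nhds hy.1 hy.2))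
      (hYd _ (hTspec y hy').1) (hT'pos _ (hTspec y hy').1) ?_
    filter_upwards [isOpen_Ioo.mem_nhds hy] with z hz using (hTspec z (Ioo_subset_Icc_self hz)).2
  have hTC1 : ContDiffOn ℝ 1 T (Ioo yl yr) := by
    rw [contDiffOn_one_iff_derivWithin isOpen_Ioo.uniqueDiffOn]
    refine ⟨fun y hy => (hTd y hy).differentiableAt.differentiableWithinAt, ?_⟩
    have hc : ContinuousOn (fun y => (√(f U.S) * deriv (charSpeed P) (T y))⁻¹) (Ioo yl yr) := by
      refine ContinuousOn.inv₀ (continuousOn_const.mul ?_)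
        fun y hy => hT'pos _ (hTspec y (Ioo_subset_Icc_self hy)).1
      exact (h.contDiffOn_charSpeed.continuousOn_deriv_of_isOpen isOpen_Ioi le_rfl).comp
        (hTcont.mono Ioo_subset_Icc_self) fun y hy => (hTspec y (Ioo_subset_Icc_self hy)).1
    refine hc.congr fun y hy => ?_
    rw [derivWithin_of_isOpen isOpen_Ioo hy, (hTd y hy).deriv]
  set c : ℝ → ℝ := fun ξ => max yl (min ξ yr) with hc
  have hcmem : ∀ ξ, c ξ ∈ Icc yl yr := fun ξ =>
    ⟨le_max_left _ _, max_le hle (min_le_right _ _)⟩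
  set W : ℝ → GasState := fun ξ => simpleState f P U (T (c ξ)) with hW
  have hTc : Continuous fun ξ => T (c ξ) :=
    hTcont.comp_continuous (by simp only [hc]; fun_prop) hcmem
  have hTpos : ∀ ξ, 0 < T (c ξ) := fun ξ => (hTspec _ (hcmem ξ)).1
  have hρ : ∀ ξ, 0 < (W ξ).rho := fun ξ => one_div_pos.2 (hTpos ξ)
  have hQc : Continuous fun ξ => speedIntegral P (T (c ξ)) :=
    h.continuousOn_speedIntegral.comp_continuous hTc hTpos
  have hWc : ∀ ξ, StateTendsto W (𝓝 ξ) (W ξ) := by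
    intro ξ
    refine ⟨?_, ?_, tendsto_const_nhds⟩
    · exact (continuous_const.div hTc fun ξ => (hTpos ξ).ne').tendsto ξ
    · exact (continuous_const.add (continuous_const.mul (hQc.sub continuous_const))).tendsto ξ
  have hWl : ∀ ξ ≤ yl, W ξ = U := by
    intro ξ hξ
    have : c ξ = Y (1 / U.rho) := by rw [hYl]; exact max_eq_left ((min_le_left _ _).trans hξ)
    simp only [hW]
    rw [this, hTY _ hτ₀, simpleState_self]
  have hWr : ∀ ξ, yr ≤ ξ → W ξ = V := by
    intro ξ hξ
    have : c ξ = yr := by simp only [hc]; rw [min_eq_right hξ, max_eq_right hle]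
    simp only [hW]
    rw [this, hyr, hTY _ hτ₁0]
  have hVρ : 0 < V.rho := one_div_pos.2 hτ₁0
  have hsm : ∀ ξ, ξ ∉ ({yl, yr} : Finset ℝ) → IsSmoothAt (productEnergy f K) W ξ := by
    intro ξ hξ
    simp only [Finset.mem_insert, Finset.mem_singleton, not_or] at hξ
    rcases lt_or_gt_of_ne hξ.1 with hl | hl
    · refine isSmoothAt_of_eventually_eq hf h hU ?_
      filter_upwards [Iio_mem_nhds hl] with η hη using hWl η (le_of_lt hη)
    rcases lt_or_gt_of_ne hξ.2 with hr | hr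
    swap
    · refine isSmoothAt_of_eventually_eq hf h hVρ ?_
      filter_upwards [Ioi_mem_nhds hr] with η hη using hWr η (le_of_lt hη)
    have hmem : ξ ∈ Ioo yl yr := ⟨hl, hr⟩
    have hcev : (fun η => simpleState f P U (T η)) =ᶠ[𝓝 ξ] W := by
      filter_upwards [isOpen_Ioo.mem_nhds hmem] with η hη
      simp only [hW, hc]
      rw [min_eq_left hη.2.le, max_eq_right hη.1.le]
    obtain ⟨hTp, hTY'⟩ := hTspec ξ (Ioo_subset_Icc_self hmem)
    have hTat := hTC1.contDiffAt (isOpen_Ioo.mem_nhds hmem)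
    have hQat : ContDiffAt ℝ 1 (speedIntegral P) (T ξ) :=
      h.contDiffOn_speedIntegral.contDiffAt (Ioi_mem_nhds hTp)
    set τ' := (√(f U.S) * deriv (charSpeed P) (T ξ))⁻¹ with hτ'
    -- Inside the fan u - c = ξ, so the mass flux equals the Lagrangian sound speed; this solves the
    -- momentum equation.
    have hmf : massFlux ξ (simpleState f P U (T ξ)) = √(f U.S) * speed P (T ξ) := by
      have e := sub_backSpeed_eq (f := f) (P := P) (U := simpleState f P U (T ξ))
        (one_div_pos.2 hTp) ξ
      have e2 : backSpeed f P (simpleState f P U (T ξ)) = ξ := hTY'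
      rw [e2, sub_self] at e
      have e3 : 1 / (simpleState f P U (T ξ)).rho = T ξ := one_div_one_div _
      rw [e3] at e
      have e4 := (mul_eq_zero.1 e.symm).resolve_left hTp.ne'
      have e5 : (simpleState f P U (T ξ)).S = U.S := rfl
      rw [e5] at e4
      linarith
    have hvol : 1 / (simpleState f P U (T ξ)).rho = T ξ := one_div_one_div _
    refine (isSmoothAt_of_derivs hf h (W := fun η => simpleState f P U (T η)) (τ' := τ')
      (u' := √(f U.S) * (speed P (T ξ) * τ')) (S' := 0) (one_div_pos.2 hTp)
      (contDiffAt_const.div hTat hTp.ne')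
      (contDiffAt_const.add (contDiffAt_const.mul ((hQat.comp ξ hTat).sub contDiffAt_const)))
      contDiffAt_const ?_ ?_ (hasDerivAt_const _ _) ?_ ?_ ?_).congr hf h hcev.symm
    · refine (hTd ξ hmem).congr_of_eventuallyEq (Eventually.of_forall fun η => ?_)
      exact one_div_one_div _
    · exact ((((h.hasDerivAt_speedIntegral hTp).comp ξ (hTd ξ hmem)).sub_const _).const_mul
        _).const_add _
    · rw [hmf]; ring
    · rw [hmf, hvol]
      have e1 := h.speed_sq hTp
      have e2 := Real.sq_sqrt hφ.le
      have e3 : (simpleState f P U (T ξ)).S = U.S := rfl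
      rw [e3]
      linear_combination (speed P (T ξ) ^ 2 * τ') * e2 + (f U.S * τ') * e1
    · ring
  have hVp : f V.S * P (1 / V.rho) = p := by
    have e : 1 / V.rho = τ₁ := one_div_one_div _
    rw [e]; exact hτp
  have hyV : yr < V.u := by
    have e : yr = V.u - 1 / V.rho * (√(f V.S) * speed P (1 / V.rho)) := rfl
    have hq := h.speed_pos (one_div_pos.2 hVρ)
    have := Real.sqrt_pos.2 (hf.pos V.S)
    have : 0 < 1 / V.rho * (√(f V.S) * speed P (1 / V.rho)) := by positivity
    linarith
  refine ⟨V, W, W, {yl, yr}, ⟨fun ξ _ => flowAt_of_stateTendsto (hρ ξ) (hWc ξ) rfl,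
    fun ξ _ hξ => hsm ξ hξ, fun _ _ _ => rfl⟩, hVρ, hVp, ?_,
    ⟨yl, fun ξ hξ => ⟨hWl ξ hξ.le, hWl ξ hξ.le⟩⟩,
    ⟨yr, hyV, fun ξ hξ => ⟨hWr ξ hξ.le, hWr ξ hξ.le⟩⟩⟩
  rw [IsProfile.velocityDrop_of_le hp]
  simp only [hV, simpleState]
  ring

theorem exists_backwardWave (hf : IsEntropyFactor f) (h : IsProfile K P) {U : GasState}
    (hU : 0 < U.rho) {p : ℝ} (hp0 : 0 < p) : ∃ V W L B, IsBackwardWave f K P U V p W L B := by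
  rcases lt_or_ge (f U.S * P (1 / U.rho)) p with hp | hp
  · exact exists_shockWave hf h hU hp
  · exact exists_rarefactionWave hf h hU hp0 hp

/-- A backward wave from Ul, a contact moving with the common velocity b, and the mirror image of a
backward wave from the reflected Ur. The choice of p makes the two velocities agree. -/
theorem exists_flow (hf : IsEntropyFactor f) (h : IsProfile K P) {Ul Ur : GasState}
    (hUl : 0 < Ul.rho) (hUr : 0 < Ur.rho) : ∃ W L B,
      IsFlowOn (productEnergy f K) W L B univ ∧ StateTendsto W atBot Ul ∧
      StateTendsto W atTop Ur := by
  classical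
  obtain ⟨p, hp0, hp⟩ := h.exists_pressure (one_div_pos.2 hUl) (hf.pos Ul.S) (one_div_pos.2 hUr)
    (hf.pos Ur.S) (Ul.u - Ur.u)
  obtain ⟨Vl, Wl, Ll, Bl, hl⟩ := exists_backwardWave hf h hUl hp0
  obtain ⟨Vr, Wr, Lr, Br, hr⟩ := exists_backwardWave hf h (U := reflect Ur) hUr hp0
  set b := Vl.u with hb
  have hbr : Vr.u = -b := by
    have e1 := hl.u_eq
    have e2 := hr.u_eq
    simp only [reflect] at e2
    rw [hb]
    linarith
  have hrf := hr.flow.reflect hf h isOpen_univ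
  rw [preimage_univ] at hrf
  -- Both waves end strictly before the contact velocity, so the flow is constant on each side near
  -- b.
  obtain ⟨al, hal, hal'⟩ := hl.right_data
  obtain ⟨ar, har, har'⟩ := hr.right_data
  rw [hbr] at har
  set W : ℝ → GasState := fun ξ => if ξ < b then Wl ξ else if ξ = b then reflect Vr
    else reflectFlow Lr ξ with hW
  set L : ℝ → GasState := fun ξ => if ξ < b then Ll ξ else if ξ = b then Vl
    else reflectFlow Wr ξ with hL
  have hWlt : ∀ ξ < b, W ξ = Wl ξ := fun ξ hξ => if_pos hξ
  have hLlt : ∀ ξ < b, L ξ = Ll ξ := fun ξ hξ => if_pos hξ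
  have hWgt : ∀ ξ > b, W ξ = reflectFlow Lr ξ := fun ξ hξ => by
    simp only [hW]; rw [if_neg (not_lt.2 (le_of_lt hξ)), if_neg (ne_of_gt hξ)]
  have hLgt : ∀ ξ > b, L ξ = reflectFlow Wr ξ := fun ξ hξ => by
    simp only [hL]; rw [if_neg (not_lt.2 (le_of_lt hξ)), if_neg (ne_of_gt hξ)]
  have hWb : W b = reflect Vr := by simp [hW]
  have hLb : L b = Vl := by simp [hL]
  set B : Finset ℝ := Bl ∪ (Br.image Neg.neg) ∪ {b} with hB
  have hleft : IsFlowOn (productEnergy f K) W L B (Iio b) :=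
    hl.flow.congr hf h isOpen_Iio (subset_univ _)
      (Finset.subset_union_left.trans Finset.subset_union_left) hWlt hLlt
  have hright : IsFlowOn (productEnergy f K) W L B (Ioi b) :=
    hrf.congr hf h isOpen_Ioi (subset_univ _)
      (Finset.subset_union_right.trans Finset.subset_union_left) hWgt hLgt
  have hVrρ : 0 < (reflect Vr).rho := hr.rho_pos
  have hcontact : FlowAt (productEnergy f K) W L b := by
    have hmr : massFlux b (reflect Vr) = 0 := by
      rw [massFlux_reflect, massFlux, hbr]; simp
    have hml : massFlux b Vl = 0 := by rw [massFlux, hb]; simp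
    refine ⟨by rw [hWb]; exact hVrρ, by rw [hLb]; exact hl.rho_pos, ?_, ?_, ?_, ?_⟩
    · rw [hWb]
      refine .of_eventually_eq ?_
      filter_upwards [Ioo_mem_nhdsGT (show b < -ar by linarith)] with η hη
      rw [hWgt η hη.1, reflectFlow, (har' (-η) (by linarith [hη.2])).2]
    · rw [hLb]
      refine .of_eventually_eq ?_
      filter_upwards [Ioo_mem_nhdsLT hal] with η hη
      rw [hWlt η hη.2, (hal' η hη.1).1]
    · rw [hWb, hLb, rankineHugoniot_iff, hmr, hml, pHat_productEnergy h hl.rho_pos,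
        pHat_productEnergy h hVrρ, hl.pressure_eq]
      have e1 : f (reflect Vr).S * P (1 / (reflect Vr).rho) = p := hr.pressure_eq
      have e2 : (reflect Vr).u = b := by simp [reflect, hbr]
      rw [e1, e2]
      simp [hb]
    · rw [hWb, hLb]
      -- No gas crosses the contact, so both clauses of the entropy condition are vacuous.
      refine fun _ => ⟨fun h1 => ?_, fun h1 => ?_⟩
      · exact absurd hml (ne_of_gt h1)
      · exact absurd hmr (ne_of_lt h1)
  refine ⟨W, L, B, ⟨fun ξ _ => ?_, fun ξ _ hξ => ?_, fun ξ _ hξ => ?_⟩, ?_, ?_⟩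
  · rcases lt_trichotomy ξ b with h1 | h1 | h1
    · exact hleft.flowAt ξ h1
    · rw [h1]; exact hcontact
    · exact hright.flowAt ξ h1
  · rcases lt_trichotomy ξ b with h1 | h1 | h1
    · exact hleft.smooth ξ h1 hξ
    · exact absurd (by simp [hB, h1]) hξ
    · exact hright.smooth ξ h1 hξ
  · rcases lt_trichotomy ξ b with h1 | h1 | h1
    · exact hleft.eq ξ h1 hξ
    · exact absurd (by simp [hB, h1]) hξ
    · exact hright.eq ξ h1 hξ
  · obtain ⟨a, ha⟩ := hl.left_data
    refine .of_eventually_eq ?_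
    filter_upwards [Iio_mem_atBot a, Iio_mem_atBot b] with η h1 h2
    rw [hWlt η h2, (ha η h1).1]
  · obtain ⟨a, ha⟩ := hr.left_data
    refine .of_eventually_eq ?_
    filter_upwards [Ioi_mem_atTop (-a), Ioi_mem_atTop b] with η h1 h2
    have h1 : -a < η := h1
    rw [hWgt η h2, reflectFlow, (ha (-η) (by linarith)).2, reflect_reflect]

theorem riemannProblem (hf : IsEntropyFactor f) (h : IsProfile K P) {Ul Ur : GasState}
    (hUl : 0 < Ul.rho) (hUr : 0 < Ur.rho) :
    (∃! W : ℝ → GasState, IsRiemannSolution (productEnergy f K) Ul Ur W) ∧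
      ∀ W : ℝ → GasState, IsRiemannSolution (productEnergy f K) Ul Ur W → VacuumFree W := by
  constructor
  · obtain ⟨W, L, B, hW, hl, hr⟩ := exists_flow hf h hUl hUr
    refine ⟨W, hW.isRiemannSolution hl hr, fun V hV => ?_⟩
    obtain ⟨M, C, hM⟩ := hV.exists_isFlowOn hf h hUl
    exact flow_unique hf h hM hW hUl hUr hV.left_data hV.right_data hl hr
  · intro W hW
    obtain ⟨L, B, hF⟩ := hW.exists_isFlowOn hf h hUl
    exact hF.vacuumFree hUl hUr hW.left_data hW.right_data

/-! ### Thermodynamics -/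

variable {k : ℝ → ℝ}

theorem IsProfile.contDiffOn_K (h : IsProfile K P) : ContDiffOn ℝ 2 K (Ioi 0) := by
  rw [show (2 : WithTop ℕ∞) = 1 + 1 by norm_num, contDiffOn_succ_iff_deriv_of_isOpen isOpen_Ioi]
  refine ⟨fun τ hτ => (h.hasDerivAt_K τ hτ).differentiableAt.differentiableWithinAt, by simp, ?_⟩
  exact ((h.smooth.of_le (by norm_num)).neg).congr fun τ hτ => (h.hasDerivAt_K τ hτ).deriv

theorem temperature_productEnergy (hf : IsEntropyFactor f) (τ S : ℝ) :
    temperature (productEnergy f K) τ S = deriv f S * K τ := by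
  simp only [temperature, productEnergy]
  exact deriv_mul_const (hf.smooth.differentiable (by norm_num)).differentiableAt _

theorem hasFDerivAt_productEnergy (hf : IsEntropyFactor f) (h : IsProfile K P) {τ : ℝ}
    (hτ : 0 < τ) (S : ℝ) : HasFDerivAt (fun q : ℝ × ℝ => productEnergy f K q.1 q.2)
      (temperature (productEnergy f K) τ S • ContinuousLinearMap.snd ℝ ℝ ℝ
        - pressure (productEnergy f K) τ S • ContinuousLinearMap.fst ℝ ℝ ℝ) (τ, S) := by
  have h1 : HasFDerivAt (fun q : ℝ × ℝ => f q.2) (deriv f S • ContinuousLinearMap.snd ℝ ℝ ℝ)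
      (τ, S) :=
    HasDerivAt.comp_hasFDerivAt (τ, S)
      (hf.smooth.differentiable (by norm_num)).differentiableAt.hasDerivAt hasFDerivAt_snd
  have h2 : HasFDerivAt (fun q : ℝ × ℝ => K q.1) ((-P τ) • ContinuousLinearMap.fst ℝ ℝ ℝ)
      (τ, S) := HasDerivAt.comp_hasFDerivAt (τ, S) (h.hasDerivAt_K τ hτ) hasFDerivAt_fst
  refine (h1.mul h2).congr_fderiv ?_
  rw [temperature_productEnergy hf, pressure_productEnergy h hτ]
  ext <;> simp [mul_comm]

theorem deriv_deriv_productEnergy_volume (h : IsProfile K P) {τ : ℝ} (hτ : 0 < τ) (S : ℝ) :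
    deriv (fun t => deriv (fun r => productEnergy f K r S) t) τ = f S * -deriv P τ := by
  have : (fun t => deriv (fun r => productEnergy f K r S) t) =ᶠ[𝓝 τ] fun t => f S * -P t := by
    filter_upwards [Ioi_mem_nhds hτ] with t ht
    exact ((h.hasDerivAt_K t ht).const_mul (f S)).deriv
  rw [this.deriv_eq]
  exact ((h.hasDerivAt_P hτ).neg.const_mul (f S)).deriv

theorem deriv_deriv_productEnergy_entropy (hf : IsEntropyFactor f) (τ S : ℝ) :
    deriv (fun s => deriv (fun r => productEnergy f K τ r) s) S = deriv (deriv f) S * K τ := by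
  have : (fun s => deriv (fun r => productEnergy f K τ r) s) = fun s => deriv f s * K τ :=
    funext fun s => temperature_productEnergy hf τ s
  rw [this]
  refine deriv_mul_const ?_ _
  have hc : ContDiff ℝ 1 (deriv f) := by
    have := hf.smooth
    rw [show (2 : WithTop ℕ∞) = 1 + 1 by norm_num, contDiff_succ_iff_deriv] at this
    exact this.2.2
  exact (hc.differentiable (by norm_num)).differentiableAt

theorem pressure_integral_Ioi (hf : IsEntropyFactor f) (h : IsProfile K P)
    (hK : Tendsto K atTop (𝓝 0)) {τ : ℝ} (hτ : 0 < τ) (S : ℝ) :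
    IntegrableOn (fun t => pressure (productEnergy f K) t S) (Ioi τ) ∧
      ∫ t in Ioi τ, pressure (productEnergy f K) t S = productEnergy f K τ S := by
  have hd : ∀ t ∈ Ici τ, HasDerivAt (fun t => -productEnergy f K t S)
      (pressure (productEnergy f K) t S) t := by
    intro t ht
    have ht0 : 0 < t := hτ.trans_le ht
    rw [pressure_productEnergy h ht0]
    exact ((h.hasDerivAt_K t ht0).const_mul (f S)).neg.congr_deriv (by ring)
  have hpos : ∀ t ∈ Ioi τ, 0 ≤ pressure (productEnergy f K) t S := by
    intro t ht
    have ht0 : 0 < t := hτ.trans ht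
    rw [pressure_productEnergy h ht0]
    exact mul_nonneg (hf.pos S).le (h.P_pos t ht0).le
  have hlim : Tendsto (fun t => -productEnergy f K t S) atTop (𝓝 0) := by
    simpa [productEnergy] using (hK.const_mul (f S)).neg
  exact ⟨integrableOn_Ioi_deriv_of_nonneg' hd hpos hlim, by
    rw [integral_Ioi_of_hasDerivAt_of_nonneg' hd hpos hlim]; ring⟩

theorem pressure_integral_inv (E : ℝ → ℝ → ℝ) (S : ℝ) :
    ∫ τ in Ioi (1 : ℝ), pressure E τ S = ∫ ρ in Ioo (0 : ℝ) 1, pHat E ρ S / ρ ^ 2 := by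
  have himage : (fun ρ : ℝ => ρ⁻¹) '' Ioo 0 1 = Ioi 1 := by
    ext τ
    constructor
    · rintro ⟨ρ, hρ, rfl⟩
      exact (one_lt_inv₀ hρ.1).2 hρ.2
    · intro hτ
      have hτ : 1 < τ := hτ
      exact ⟨τ⁻¹, ⟨by positivity, inv_lt_one_of_one_lt₀ hτ⟩, inv_inv τ⟩
  rw [← himage, integral_image_eq_integral_abs_deriv_smul (f' := fun ρ => -(ρ ^ 2)⁻¹)
    measurableSet_Ioo (fun ρ hρ => (hasDerivAt_inv hρ.1.ne').hasDerivWithinAt)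
    (inv_injective.injOn)]
  refine setIntegral_congr_fun measurableSet_Ioo fun ρ hρ => ?_
  have hρ0 := hρ.1
  simp only [pHat, if_pos hρ0, one_div, abs_neg, smul_eq_mul]
  rw [abs_of_pos (by positivity), div_eq_inv_mul]

theorem deriv_pHat (h : IsProfile K P) {ρ : ℝ} (hρ : 0 < ρ) (S : ℝ) :
    deriv (fun r => pHat (productEnergy f K) r S) ρ
      = f S * ((1 / ρ) ^ 2 * -deriv P (1 / ρ)) := by
  have hd : HasDerivAt (fun r : ℝ => 1 / r) (-(ρ ^ 2)⁻¹) ρ := by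
    simpa only [one_div] using hasDerivAt_inv hρ.ne'
  have h1 := ((h.hasDerivAt_P (one_div_pos.2 hρ)).comp ρ hd).const_mul (f S)
  have h2 : (fun r => pHat (productEnergy f K) r S) =ᶠ[𝓝 ρ] fun r => f S * (P ∘ fun r => 1 / r) r := by
    filter_upwards [Ioi_mem_nhds hρ] with r hr using pHat_productEnergy h hr S
  rw [h2.deriv_eq, h1.deriv]
  field_simp

theorem tendsto_one_div_nhdsGT_zero : Tendsto (fun ρ : ℝ => 1 / ρ) (𝓝[>] 0) atTop := by
  simpa only [one_div] using tendsto_inv_nhdsGT_zero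

theorem IsVolumeKernel.tendsto_mul_pressureFactor (hk : IsVolumeKernel k) :
    Tendsto (fun τ => τ * pressureFactor k τ) atTop (𝓝 0) := by
  have h1 : Tendsto (fun τ : ℝ => k (Real.log (τ + 1)) ^ 2) atTop (𝓝 0) := by
    simpa using (hk.tendsto_atTop_zero.comp tendsto_log_add_one).pow 2
  refine tendsto_of_tendsto_of_tendsto_of_le_of_le' tendsto_const_nhds h1 ?_ ?_ <;>
  · filter_upwards [eventually_gt_atTop 0] with τ hτ
    unfold pressureFactor
    first
    | positivity
    | rw [← mul_div_assoc, div_le_iff₀ (by positivity)]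
      nlinarith [sq_nonneg (k (Real.log (τ + 1)))]

theorem thermodynamicConstraints (hf : IsEntropyFactor f) (hk : IsVolumeKernel k) :
    ThermodynamicConstraints (productEnergy f (energyFactor k)) := by
  have h := hk.isProfile
  have hK : Tendsto (energyFactor k) atTop (𝓝 0) := hk.tail_tendsto.comp tendsto_log_add_one
  -- Limits at vacuum become limits as τ = 1/ρ → ∞, applied to P, τP and τ²(-P').
  have hrho : ∀ {g g' : ℝ → ℝ}, Tendsto g atTop (𝓝 0) → ∀ S,
      (∀ ρ > 0, g' ρ = f S * g (1 / ρ)) → Tendsto g' (𝓝[>] 0) (𝓝 0) := by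
    intro g g' hg S he
    have := (hg.comp tendsto_one_div_nhdsGT_zero).const_mul (f S)
    rw [mul_zero] at this
    refine this.congr' ?_
    filter_upwards [self_mem_nhdsWithin] with ρ hρ using (he ρ hρ).symm
  exact {
    smooth := (hf.smooth.comp contDiff_snd).contDiffOn.mul
      (h.contDiffOn_K.comp contDiff_fst.contDiffOn fun q hq => hq.1)
    second_law := fun τ hτ S => hasFDerivAt_productEnergy hf h hτ S
    pressure_pos := fun τ hτ S => by
      rw [pressure_productEnergy h hτ]
      exact mul_pos (hf.pos S) (h.P_pos τ hτ)
    temperature_nonneg := fun τ hτ S => by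
      rw [temperature_productEnergy hf]
      exact mul_nonneg (hf.deriv_pos S).le (h.K_pos τ hτ).le
    energy_at_infinity := fun S => by simpa [productEnergy] using hK.const_mul (f S)
    energy_pos := fun τ hτ S => mul_pos (hf.pos S) (h.K_pos τ hτ)
    energy_tau_tau_pos := fun τ hτ S => by
      rw [deriv_deriv_productEnergy_volume h hτ]
      exact mul_pos (hf.pos S) (neg_pos.2 (h.deriv_neg τ hτ))
    energy_S_S_nonneg := fun τ hτ S => by
      rw [deriv_deriv_productEnergy_entropy hf]
      exact mul_nonneg (hf.deriv_deriv_nonneg S) (h.K_pos τ hτ).le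
    pressure_integrable := fun S => (pressure_integral_Ioi hf h hK one_pos S).1
    pressure_integral := fun S => pressure_integral_inv _ S
    energy_eq_integral := fun τ hτ S => (pressure_integral_Ioi hf h hK hτ S).2.symm
    pHat_zero := fun S => hrho h.tendsto_atTop S fun ρ hρ => pHat_productEnergy h hρ S
    pHat_div_zero := fun S => hrho hk.tendsto_mul_pressureFactor S fun ρ hρ => by
      rw [pHat_productEnergy h hρ]; ring
    deriv_pHat_zero := fun S => hrho hk.tendsto_sq_mul_deriv S fun ρ hρ => deriv_pHat h hρ S }

/-- Entropy enters only through f(S), so p = e P/K. At e = f K the τ-derivative is (f/K)(K P' + P²),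
and `medium` bounds the bracket by P²/2. -/
theorem IsProfile.mediumCondition (hf : IsEntropyFactor f) (h : IsProfile K P) :
    MediumCondition (productEnergy f K) := by
  refine ⟨fun τ e => e * (P τ / K τ), fun τ hτ S => ?_, fun τ hτ S => ?_⟩
  · have := h.K_pos τ hτ
    rw [pressure_productEnergy h hτ, productEnergy]
    field_simp
  · have hKp := h.K_pos τ hτ
    have hd := ((h.hasDerivAt_P hτ).div (h.hasDerivAt_K τ hτ) hKp.ne').const_mul
      (productEnergy f K τ S)
    have hd' : HasDerivAt (fun t => productEnergy f K τ S * (P t / K t)) _ τ := hd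
    refine ⟨hd'.differentiableAt, ?_⟩
    rw [hd'.deriv, pressure_productEnergy h hτ, productEnergy]
    have hfp := hf.pos S
    have hm := h.medium τ hτ
    have e1 : f S * K τ * ((deriv P τ * K τ - P τ * -P τ) / K τ ^ 2)
        = f S / K τ * (K τ * deriv P τ + P τ ^ 2) := by field_simp; ring
    have e2 : (f S * P τ) ^ 2 / (2 * (f S * K τ)) = f S / K τ * (P τ ^ 2 / 2) := by field_simp
    rw [e1, e2]
    exact mul_le_mul_of_nonneg_left (by linarith) (by positivity)

end GasDynamics

end

/-! ### The theorem for the separable energy -/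

theorem mainTheorem1 (f k : ℝ → ℝ) (hf : GasDynamics.IsEntropyFactor f)
    (hk : GasDynamics.IsVolumeKernel k) :
    (∀ Ul Ur : GasDynamics.GasState, 0 < Ul.rho → 0 < Ur.rho →
      (∃! W : ℝ → GasDynamics.GasState,
        GasDynamics.IsRiemannSolution (GasDynamics.separableEnergy f k) Ul Ur W) ∧
      ∀ W : ℝ → GasDynamics.GasState,
        GasDynamics.IsRiemannSolution (GasDynamics.separableEnergy f k) Ul Ur W →
          GasDynamics.VacuumFree W) ∧
    GasDynamics.ThermodynamicConstraints (GasDynamics.separableEnergy f k) ∧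
    GasDynamics.MediumCondition (GasDynamics.separableEnergy f k) := by
  have hE : GasDynamics.separableEnergy f k
      = GasDynamics.productEnergy f (GasDynamics.energyFactor k) := rfl
  rw [hE]
  exact ⟨fun Ul Ur hUl hUr => GasDynamics.riemannProblem hf hk.isProfile hUl hUr,
    GasDynamics.thermodynamicConstraints hf hk, hk.isProfile.mediumCondition hf⟩
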